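/- Let $\Omega\subset\mathbb{R}^3$ be a bounded convex domain with $C^2$ boundary of positive Gaussian curvature. Let $0\le\gamma\le 1$ and let $B=B(r,\theta)$ be a measurable cross-section satisfying Grad's angular cutoff condition $$0\le B(|v-v_*|,\theta)\le C_0\,|v-v_*|^{\gamma}\cos\theta\sin\theta ,\qquad 0\le\theta\le\tfrac{\pi}{2}.$$ For $v\neq v_*$ put $e_1=\frac{v_*-v}{|v_*-v|}$, complete it to an orthonormal basis $(e_1,e_2,e_3)$ of $\mathbb{R}^3$, let $\alpha=\cos\theta\,e_1+\sin\theta\cos\phi\,e_2+\sin\theta\sin\phi\,e_3$, $v'=v+((v_*-v)\cdot\alpha)\alpha$, $v_*'=v_*-((v_*-v)\cdot\alpha)\alpha$, and $$Q(F,G)(v)=\int_{\mathbb{R}^3}\int_0^{2\pi}\int_0^{\pi/2}\bigl(F(v')G(v_*')-F(v)G(v_*)\bigr)B(|v-v_*|,\theta)\,d\theta\,d\phi\,dv_* .$$ With $M(v)=\pi^{-3/2}e^{-|v|^2}$ let $L(f)=M^{-1/2}\bigl(Q(M,M^{1/2}f)+Q(M^{1/2}f,M)\bigr)$ be the linearized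 collision operator, $\nu(v)=\int_{\mathbb{R}^3}\int_0^{2\pi}\int_0^{\pi/2}M(v_*)B(|v-v_*|,\theta)\,d\theta\,d\phi\,dv_*$ the collision frequency, and $K$ the integral operator in the decomposition $L(f)=-\nu f+K(f)$; $K$ acts on functions of $(x,v)$ with $x$ as a parameter. Assume that $\nu(v)\ge\nu_0(1+|v|)^\gamma$ for all $v\in\mathbb{R}^3$, with some constant $\nu_0>0$. For $x\in\Omega$ and $v\in\mathbb{R}^3$ let $\tau_-(x,v)=\inf\{t>0:\ x-tv\notin\Omega\}$ and $$(S_\Omega f)(x,v)=\int_0^{\tau_-(x,v)}e^{-\nu(v)s}f(x-sv,v)\,ds .$$ For $s\in(0,1)$ let $L^2_v(\mathbb{R}^3;H^s_x(\Omega))$ be the space of all $f\in L^2(\Omega\times\mathbb{R}^3)$ with $$\|f\|^2_{L^2_v(\mathbb{R}^3;H^s_x(\Omega))}=\|f\|^2_{L^2(\Omega\times\mathbb{R}^3)}+\int_{\mathbb{R}^3}\int_\Omega\int_\Omega\frac{|f(x,v)-f(y,v)|^2}{|x-y|^{3+2s}}\,dx\,dy\,dv<\infty .$$ Then for every $\epsilon\in(0,\tfrac12)$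 the operator $KS_\Omega KS_\Omega KS_\Omega K$ is a bounded linear operator from $L^2(\Omega\times\mathbb{R}^3)$ to $L^2_v(\mathbb{R}^3;H^{1-\epsilon}_x(\Omega))$: there is a constant $C$ such that for all $f\in L^2(\Omega\times\mathbb{R}^3)$ $$\|KS_\Omega KS_\Omega KS_\Omega Kf\|_{L^2_v(\mathbb{R}^3;H^{1-\epsilon}_x(\Omega))}\le C\,\|f\|_{L^2(\Omega\times\mathbb{R}^3)} .$$ -/

import Mathlib

open MeasureTheory Set Filter Topology
open scoped ENNReal NNReal

noncomputable section

namespace LinBoltzmann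

/-- Euclidean three-space, used both for positions `x` and for velocities `v`. -/
abbrev E3 : Type := EuclideanSpace ℝ (Fin 3)

/-! ### The collision operator -/

/-- The second vector of an orthonormal frame whose first vector is the unit vector `e`. -/
def frame₂ (e : E3) : E3 :=
  open Classical in
  if e 0 = 0 ∧ e 1 = 0 then !₂[1, 0, 0]
  else (Real.sqrt (e 0 ^ 2 + e 1 ^ 2))⁻¹ • !₂[-e 1, e 0, 0]

/-- The third vector of the frame: the cross product of `e` and `frame₂ e`. -/
def frame₃ (e : E3) : E3 :=
  !₂[e 1 * frame₂ e 2 - e 2 * frame₂ e 1,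
     e 2 * frame₂ e 0 - e 0 * frame₂ e 2,
     e 0 * frame₂ e 1 - e 1 * frame₂ e 0]

theorem frame_orthonormal (e : E3) (he : ‖e‖ = 1) :
    Orthonormal ℝ ![e, frame₂ e, frame₃ e] := by
  have h1 : e 0 ^ 2 + e 1 ^ 2 + e 2 ^ 2 = 1 := by
    have h := EuclideanSpace.real_norm_sq_eq e
    rw [he, Fin.sum_univ_three] at h
    linarith
  have key : frame₂ e 0 ^ 2 + frame₂ e 1 ^ 2 + frame₂ e 2 ^ 2 = 1 ∧
      e 0 * frame₂ e 0 + e 1 * frame₂ e 1 + e 2 * frame₂ e 2 = 0 := by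
    unfold frame₂
    split_ifs with h
    · simp [h.1]
    · have hpos : 0 < e 0 ^ 2 + e 1 ^ 2 := by
        rcases not_and_or.mp h with h | h <;> positivity
      have hs := Real.sq_sqrt hpos.le
      have hs0 : Real.sqrt (e 0 ^ 2 + e 1 ^ 2) ≠ 0 := (Real.sqrt_pos.mpr hpos).ne'
      simp only [PiLp.smul_apply, smul_eq_mul, Matrix.cons_val_zero, Matrix.cons_val_one,
        Matrix.cons_val]
      constructor
      · field_simp
        rw [hs]; ring
      · ring
  obtain ⟨k1, k2⟩ := key
  have g0 : frame₃ e 0 = e 1 * frame₂ e 2 - e 2 * frame₂ e 1 := rfl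
  have g1 : frame₃ e 1 = e 2 * frame₂ e 0 - e 0 * frame₂ e 2 := rfl
  have g2 : frame₃ e 2 = e 0 * frame₂ e 1 - e 1 * frame₂ e 0 := rfl
  have n3 : frame₃ e 0 ^ 2 + frame₃ e 1 ^ 2 + frame₃ e 2 ^ 2 = 1 := by
    have : frame₃ e 0 ^ 2 + frame₃ e 1 ^ 2 + frame₃ e 2 ^ 2 =
        (e 0 ^ 2 + e 1 ^ 2 + e 2 ^ 2) * (frame₂ e 0 ^ 2 + frame₂ e 1 ^ 2 + frame₂ e 2 ^ 2)
          - (e 0 * frame₂ e 0 + e 1 * frame₂ e 1 + e 2 * frame₂ e 2) ^ 2 := by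
      rw [g0, g1, g2]; ring
    rw [this, h1, k1, k2]; norm_num
  have hin : ∀ a b : E3, inner ℝ a b = a 0 * b 0 + a 1 * b 1 + a 2 * b 2 := by
    intro a b
    simp [PiLp.inner_apply, Fin.sum_univ_three, mul_comm]
  have a00 : inner ℝ e e = 1 := by rw [hin]; linarith
  have a11 : inner ℝ (frame₂ e) (frame₂ e) = 1 := by rw [hin]; linarith
  have a22 : inner ℝ (frame₃ e) (frame₃ e) = 1 := by rw [hin]; linarith
  have a01 : inner ℝ e (frame₂ e) = 0 := by rw [hin]; linarith
  have a02 : inner ℝ e (frame₃ e) = 0 := by rw [hin, g0, g1, g2]; ring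
  have a12 : inner ℝ (frame₂ e) (frame₃ e) = 0 := by rw [hin, g0, g1, g2]; ring
  have a10 : inner ℝ (frame₂ e) e = 0 := by rw [real_inner_comm]; exact a01
  have a20 : inner ℝ (frame₃ e) e = 0 := by rw [real_inner_comm]; exact a02
  have a21 : inner ℝ (frame₃ e) (frame₂ e) = 0 := by rw [real_inner_comm]; exact a12
  rw [orthonormal_iff_ite]
  intro i j
  fin_cases i <;> fin_cases j
  · exact a00
  · exact a01
  · exact a02
  · exact a10
  · exact a11
  · exact a12
  · exact a20
  · exact a21
  · exact a22

/-- The unit vector `α = cos θ e₁ + sin θ cos ε e₂ + sin θ sin ε e₃`, where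
`e₁ = (vs - v) / |vs - v|` and `(e₁, e₂, e₃)` is an orthonormal basis. -/
def scatterDir (v vs : E3) (ε θ : ℝ) : E3 :=
  let e₁ : E3 := ‖vs - v‖⁻¹ • (vs - v)
  Real.cos θ • e₁ + (Real.sin θ * Real.cos ε) • frame₂ e₁ + (Real.sin θ * Real.sin ε) • frame₃ e₁

/-- The post-collisional velocity `v' = v + ((vs - v) · α) α`. -/
def postV (v vs : E3) (ε θ : ℝ) : E3 :=
  v + (inner ℝ (vs - v) (scatterDir v vs ε θ)) • scatterDir v vs ε θ

/-- The post-collisional velocity `vs' = vs - ((vs - v) · α) α`. -/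
def postVs (v vs : E3) (ε θ : ℝ) : E3 :=
  vs - (inner ℝ (vs - v) (scatterDir v vs ε θ)) • scatterDir v vs ε θ

/-- The range of `(vs, ε, θ)` in the collision integral. -/
def collisionDomain : Set (E3 × ℝ × ℝ) :=
  univ ×ˢ Ioc 0 (2 * Real.pi) ×ˢ Ioc 0 (Real.pi / 2)

/-- The collision operator `Q(F, G)` with cross-section `B(|v - vs|, θ)`. -/
def collisionQ (B : ℝ → ℝ → ℝ) (F G : E3 → ℝ) (v : E3) : ℝ :=
  ∫ p in collisionDomain,
    (F (postV v p.1 p.2.1 p.2.2) * G (postVs v p.1 p.2.1 p.2.2) - F v * G p.1)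
      * B ‖v - p.1‖ p.2.2

/-- The standard Maxwellian `M(v) = π^(-3/2) exp(-|v|²)`. -/
def maxwellian (v : E3) : ℝ := Real.pi ^ (-(3 / 2) : ℝ) * Real.exp (-‖v‖ ^ 2)

/-- The linearized collision operator
`L f = M^(-1/2) (Q(M, M^(1/2) f) + Q(M^(1/2) f, M))`. -/
def linearizedL (B : ℝ → ℝ → ℝ) (f : E3 → ℝ) (v : E3) : ℝ :=
  (Real.sqrt (maxwellian v))⁻¹ *
    (collisionQ B maxwellian (fun w => Real.sqrt (maxwellian w) * f w) v
      + collisionQ B (fun w => Real.sqrt (maxwellian w) * f w) maxwellian v)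

/-- The collision frequency `ν(v) = ∫∫∫ M(vs) B(|v - vs|, θ) dθ dε dvs`. -/
def collisionFreq (B : ℝ → ℝ → ℝ) (v : E3) : ℝ :=
  ∫ p in collisionDomain, maxwellian p.1 * B ‖v - p.1‖ p.2.2

/-- The integral part `K` of `L = -ν + K`, acting on functions of the velocity. -/
def opKv (B : ℝ → ℝ → ℝ) (f : E3 → ℝ) (v : E3) : ℝ :=
  linearizedL B f v + collisionFreq B v * f v

/-- The operator `K` on functions of `(x, v)`; the position `x` is a parameter. -/
def opK (B : ℝ → ℝ → ℝ) (f : E3 × E3 → ℝ) (z : E3 × E3) : ℝ :=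
  opKv B (fun w => f (z.1, w)) z.2

/-! ### The transport operator of a domain -/

/-- The backward exit time `τ₋(x, v) = inf {t > 0 : x - t v ∉ Ω}`. For bounded `Ω` and `v ≠ 0`
the set is non-empty; the value at `v = 0` is irrelevant (a null set of velocities). -/
def exitTime (Ω : Set E3) (x v : E3) : ℝ := sInf {t : ℝ | 0 < t ∧ x - t • v ∉ Ω}

/-- `(S_Ω f)(x, v) = ∫₀^{τ₋(x, v)} exp(-ν(v) s) f(x - s v, v) ds`. -/
def opS (B : ℝ → ℝ → ℝ) (Ω : Set E3) (f : E3 × E3 → ℝ) (z : E3 × E3) : ℝ :=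
  ∫ s in (0 : ℝ)..exitTime Ω z.1 z.2,
    Real.exp (-collisionFreq B z.2 * s) * f (z.1 - s • z.2, z.2)

/-! ### Function spaces -/

/-- Lebesgue measure on `Ω × ℝ³`. -/
def phaseMeasure (Ω : Set E3) : Measure (E3 × E3) :=
  (volume.restrict Ω).prod volume

/-- The square of the Slobodeckij semi-norm in `x` of order `s`, integrated over `v`. -/
def slobodeckijSq (Ω : Set E3) (s : ℝ) (f : E3 × E3 → ℝ) : ℝ≥0∞ :=
  ∫⁻ v : E3, ∫⁻ x in Ω, ∫⁻ y in Ω,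
    ENNReal.ofReal (|f (x, v) - f (y, v)| ^ 2 / ‖x - y‖ ^ (3 + 2 * s))

/-- Membership in `L²_v(ℝ³; H^s_x(Ω))`. -/
def MemL2Hs (Ω : Set E3) (s : ℝ) (f : E3 × E3 → ℝ) : Prop :=
  MemLp f 2 (phaseMeasure Ω) ∧ slobodeckijSq Ω s f < ∞

/-- The norm of `L²_v(ℝ³; H^s_x(Ω))`, with values in `[0, ∞]`. -/
def l2HsNorm (Ω : Set E3) (s : ℝ) (f : E3 × E3 → ℝ) : ℝ≥0∞ :=
  (eLpNorm f 2 (phaseMeasure Ω) ^ 2 + slobodeckijSq Ω s f) ^ (1 / 2 : ℝ)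

/-! ### Geometry of the domain -/

/-- `ρ` is a `C²` defining function of `Ω` near `p`. -/
def IsLocalDefiningFun (Ω : Set E3) (p : E3) (ρ : E3 → ℝ) : Prop :=
  ContDiffAt ℝ 2 ρ p ∧ gradient ρ p ≠ 0 ∧ ∀ᶠ x in 𝓝 p, (x ∈ Ω ↔ ρ x < 0)

/-- The unit normal field `∇ρ / |∇ρ|` of the level sets of `ρ`. -/
def unitNormal (ρ : E3 → ℝ) (x : E3) : E3 := ‖gradient ρ x‖⁻¹ • gradient ρ x

/-- The Gaussian curvature at `p` of the level set of `ρ` through `p`: the determinant of the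
differential of the Gauss map (the Weingarten map), an endomorphism of the tangent plane
`(∇ρ(p))^⊥`. -/
def gaussCurvature (ρ : E3 → ℝ) (p : E3) : ℝ :=
  LinearMap.det
    (((ℝ ∙ gradient ρ p)ᗮ.orthogonalProjectionOnto ∘L fderiv ℝ (unitNormal ρ) p ∘L
      (ℝ ∙ gradient ρ p)ᗮ.subtypeL : (ℝ ∙ gradient ρ p)ᗮ →L[ℝ] (ℝ ∙ gradient ρ p)ᗮ) :
      (ℝ ∙ gradient ρ p)ᗮ →ₗ[ℝ] (ℝ ∙ gradient ρ p)ᗮ)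

/-- `Ω` is a bounded convex domain with `C²` boundary of positive Gaussian curvature. (The
curvature does not depend on the choice of the local defining function.) -/
structure IsPosCurvedConvexDomain (Ω : Set E3) : Prop where
  isOpen : IsOpen Ω
  convex : Convex ℝ Ω
  bounded : Bornology.IsBounded Ω
  posCurvature : ∀ p ∈ frontier Ω, ∃ ρ : E3 → ℝ,
    IsLocalDefiningFun Ω p ρ ∧ 0 < gaussCurvature ρ p

end LinBoltzmann

end

noncomputable section

namespace LinBoltzmann

/-! ### Operators bounded on `L²` -/

/-! On `Ω`, the operator `S_Ω` is the whole-space resolvent `R` of `ν + v · ∇` applied to the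
extension by zero: in a convex set a backward ray never re-enters (`opS_eq_resolvent`). With `P` the
multiplication by the indicator of `Ω` and `A = K R`, the seven-fold product is `A P A P A P K`.
Here `A` is bounded on `L²` and commutes with translations in `x`. The two outer copies of `A`
supply the regularity; the inner block `P A P K` only has to be bounded.

Kernel. `K` is the sum of two gain terms and a loss term, each dominated in velocity by convolution
with `maj`, that is `(|w - v| (1 + |w - v|))⁻²`. For the gain terms, exchange the relative velocity
and the scattering direction and integrate a Gaussian over the plane orthogonal to that direction
(`lintegral_gain_le`). In dimension three `maj` is integrable, which gives Schur bounds, and its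
translates are Hölder in `L¹` of every order `θ < 1` (`exists_integral_maj_sub_le`).

Velocity averaging. One copy of `A` gains `σ = θ/2 < 1/2` derivatives, without Fourier analysis. By
duality the squared norm of a difference of `A h` is paired with `h`, and the transport moves to the
other factor. What remains is a mean along rays of a difference, whose squared norm is an
autocorrelation evaluated at `(t - s) w`. The increment `a` there becomes a translation of `maj` by
`a / (t - s)`, worth `|a|^θ |t - s|^(-θ)`, and this is integrable in the times because `θ < 1`
(`exists_lintegral_maj_rayMean_le`, `exists_eLpNorm_diffX_velOp_raySol_le`). A resolvent identity
reduces the absorption `ν(v)` to the constant `1`.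

Iteration. For `σ < 1/2`, truncation to `Ω` preserves differences of order `σ`, since the mass in a
boundary strip of width `t` is controlled by a dyadic recursion (`l2norm_strip_le`). Hence second
differences of `A P A h` are of order `2σ`, and since `2σ < 1` so are first differences
(`AvgOp.exists_l2norm_diffX_le`). Taking `2σ = 1 - ε/2 > 1 - ε` makes the Slobodeckij integral
converge. -/

theorem eLpNorm_two_sq {Z : Type*} [MeasurableSpace Z] (μ : Measure Z) (f : Z → ℝ) :
    eLpNorm f 2 μ ^ 2 = ∫⁻ z, ‖f z‖ₑ ^ 2 ∂μ := by
  have := eLpNorm_nnreal_pow_eq_lintegral (f := f) (μ := μ) (p := 2) (by norm_num)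
  simpa using this

theorem eLpNorm_two_le_iff {Z Y : Type*} [MeasurableSpace Z] [MeasurableSpace Y] {μ : Measure Z}
    {ν : Measure Y} {f : Z → ℝ} {g : Y → ℝ} {C : ℝ≥0∞} :
    eLpNorm f 2 μ ≤ C * eLpNorm g 2 ν ↔
      ∫⁻ z, ‖f z‖ₑ ^ 2 ∂μ ≤ C ^ 2 * ∫⁻ z, ‖g z‖ₑ ^ 2 ∂ν := by
  rw [← eLpNorm_two_sq, ← eLpNorm_two_sq, ← mul_pow,
    ENNReal.pow_le_pow_left_iff two_ne_zero]

theorem lintegral_sq_lt_top {Z : Type*} [MeasurableSpace Z] {μ : Measure Z} {f : Z → ℝ}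
    (hf : MemLp f 2 μ) : ∫⁻ z, ‖f z‖ₑ ^ 2 ∂μ < ∞ := by
  rw [← eLpNorm_two_sq]
  exact ENNReal.pow_lt_top hf.2

/-- The (nonlinear a priori) map `A` on functions induces a bounded linear operator on `L²(μ)`. -/
structure L2Op {Z : Type*} [MeasurableSpace Z] (μ : Measure Z) (A : (Z → ℝ) → Z → ℝ) : Prop where
  bound : ∃ C : ℝ≥0, ∀ f, MemLp f 2 μ → MemLp (A f) 2 μ ∧ eLpNorm (A f) 2 μ ≤ C * eLpNorm f 2 μ
  congr : ∀ f g, MemLp f 2 μ → f =ᵐ[μ] g → A f =ᵐ[μ] A g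
  add : ∀ f g, MemLp f 2 μ → MemLp g 2 μ → A (f + g) =ᵐ[μ] A f + A g
  smul : ∀ (c : ℝ) f, MemLp f 2 μ → A (c • f) =ᵐ[μ] c • A f

namespace L2Op

variable {Z : Type*} [MeasurableSpace Z] {μ : Measure Z} {A A' : (Z → ℝ) → Z → ℝ}

theorem memLp (hA : L2Op μ A) {f : Z → ℝ} (hf : MemLp f 2 μ) : MemLp (A f) 2 μ :=
  let ⟨_, h⟩ := hA.bound
  (h f hf).1

theorem comp (hA : L2Op μ A) (hA' : L2Op μ A') : L2Op μ (fun f => A (A' f)) where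
  bound := by
    obtain ⟨C, hC⟩ := hA.bound
    obtain ⟨C', hC'⟩ := hA'.bound
    refine ⟨C * C', fun f hf => ⟨(hC _ (hC' f hf).1).1, ?_⟩⟩
    calc _ ≤ C * eLpNorm (A' f) 2 μ := (hC _ (hC' f hf).1).2
      _ ≤ C * (C' * eLpNorm f 2 μ) := by gcongr; exact (hC' f hf).2
      _ = _ := by push_cast; ring
  congr f g hf hfg := hA.congr _ _ (hA'.memLp hf) (hA'.congr _ _ hf hfg)
  add f g hf hg := (hA.congr _ _ (hA'.memLp (hf.add hg)) (hA'.add f g hf hg)).trans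
    (hA.add _ _ (hA'.memLp hf) (hA'.memLp hg))
  smul c f hf := (hA.congr _ _ (hA'.memLp (hf.const_smul c)) (hA'.smul c f hf)).trans
    (hA.smul c _ (hA'.memLp hf))

theorem add_op (hA : L2Op μ A) (hA' : L2Op μ A') : L2Op μ (fun f => A f + A' f) where
  bound := by
    obtain ⟨C, hC⟩ := hA.bound
    obtain ⟨C', hC'⟩ := hA'.bound
    refine ⟨C + C', fun f hf => ⟨(hC f hf).1.add (hC' f hf).1, ?_⟩⟩
    calc _ ≤ eLpNorm (A f) 2 μ + eLpNorm (A' f) 2 μ :=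
          eLpNorm_add_le (hC f hf).1.1 (hC' f hf).1.1 one_le_two
      _ ≤ C * eLpNorm f 2 μ + C' * eLpNorm f 2 μ := add_le_add (hC f hf).2 (hC' f hf).2
      _ = _ := by push_cast; ring
  congr f g hf hfg := (hA.congr _ _ hf hfg).add (hA'.congr _ _ hf hfg)
  add f g hf hg := by
    filter_upwards [hA.add f g hf hg, hA'.add f g hf hg] with z h1 h2
    simp only [Pi.add_apply] at *
    rw [h1, h2]; ring
  smul c f hf := by
    filter_upwards [hA.smul c f hf, hA'.smul c f hf] with z h1 h2
    simp only [Pi.add_apply, Pi.smul_apply, smul_eq_mul] at *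
    rw [h1, h2]; ring

theorem neg_op (hA : L2Op μ A) : L2Op μ (fun f => -A f) where
  bound := by
    obtain ⟨C, hC⟩ := hA.bound
    exact ⟨C, fun f hf => ⟨(hC f hf).1.neg, by rw [eLpNorm_neg]; exact (hC f hf).2⟩⟩
  congr f g hf hfg := (hA.congr _ _ hf hfg).neg
  add f g hf hg := by
    filter_upwards [hA.add f g hf hg] with z h1
    simp only [Pi.add_apply, Pi.neg_apply] at *
    rw [h1]; ring
  smul c f hf := by
    filter_upwards [hA.smul c f hf] with z h1
    simp only [Pi.neg_apply, Pi.smul_apply, smul_eq_mul] at *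
    rw [h1]; ring

theorem sub (hA : L2Op μ A) {f g : Z → ℝ} (hf : MemLp f 2 μ) (hg : MemLp g 2 μ) :
    A (f - g) =ᵐ[μ] A f - A g := by
  have h1 := hA.add f ((-1 : ℝ) • g) hf (hg.const_smul _)
  have h2 := hA.smul (-1) g hg
  have h3 : f - g = f + (-1 : ℝ) • g := by ext z; simp [sub_eq_add_neg]
  rw [h3]
  filter_upwards [h1, h2] with z h1 h2
  simp only [Pi.add_apply, Pi.smul_apply, smul_eq_mul, Pi.sub_apply] at *
  rw [h1, h2]; ring

theorem indicator {s : Set Z} (hs : MeasurableSet s) : L2Op μ (fun f => s.indicator f) where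
  bound := ⟨1, fun f hf => ⟨hf.indicator hs, by simpa using eLpNorm_indicator_le f⟩⟩
  congr f g _ hfg := by
    filter_upwards [hfg] with z hz
    simp only [Set.indicator]
    rw [hz]
  add f g _ _ := by rw [Set.indicator_add']
  smul c f _ := by
    refine Eventually.of_forall fun z => ?_
    by_cases hz : z ∈ s <;> simp [hz]

end L2Op

/-! ### Integral operators over a parameter space -/

section ParamOp

variable {Z P : Type*} [MeasurableSpace Z] [MeasurableSpace P]

/-- The operator `f ↦ ∫ b(z, p) f(Φ(z, p)) dρ(p)`. -/
def paramOp (ρ : Measure P) (b : Z → P → ℝ) (Φ : Z → P → Z) (f : Z → ℝ) (z : Z) : ℝ :=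
  ∫ p, b z p * f (Φ z p) ∂ρ

/-- Schur's condition for the boundedness of `paramOp ρ b Φ` on `L²(μ)`. -/
structure SchurBound (μ : Measure Z) (ρ : Measure P) (b : Z → P → ℝ) (Φ : Z → P → Z)
    (C : ℝ≥0) : Prop where
  meas_b : Measurable (Function.uncurry b)
  meas_Φ : Measurable (Function.uncurry Φ)
  row : ∀ z, ∫⁻ p, ‖b z p‖ₑ ∂ρ ≤ C
  col : ∀ g : Z → ℝ≥0∞, Measurable g →
    ∫⁻ z, ∫⁻ p, ‖b z p‖ₑ * g (Φ z p) ∂ρ ∂μ ≤ C * ∫⁻ z, g z ∂μ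

variable {μ : Measure Z} {ρ : Measure P} {b : Z → P → ℝ} {Φ : Z → P → Z} {C : ℝ≥0}

namespace SchurBound

/-- Testing the column bound on the indicator of a null set shows that the image under `Φ` of the
weighted measure does not charge null sets. This is what makes the operator well defined on classes
of functions. -/
theorem ae_comp [SFinite ρ] (h : SchurBound μ ρ b Φ C) {q : Z → Prop} (hq : ∀ᵐ z ∂μ, q z) :
    ∀ᵐ z ∂μ, ∀ᵐ p ∂ρ, b z p ≠ 0 → q (Φ z p) := by
  obtain ⟨s, hs, hsm, hs0⟩ := exists_measurable_superset_of_null (ae_iff.1 hq)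
  have hm : Measurable (Function.uncurry fun z p =>
      ‖b z p‖ₑ * s.indicator (fun _ => (1 : ℝ≥0∞)) (Φ z p)) :=
    h.meas_b.enorm.mul ((measurable_const.indicator hsm).comp h.meas_Φ)
  have h1 := h.col (s.indicator fun _ => 1) (measurable_const.indicator hsm)
  rw [lintegral_indicator hsm, lintegral_one, Measure.restrict_apply_univ, hs0, mul_zero,
    nonpos_iff_eq_zero] at h1
  replace h1 := (lintegral_eq_zero_iff hm.lintegral_prod_right').1 h1
  filter_upwards [h1] with z hz
  simp only [Pi.zero_apply] at hz
  replace hz := (lintegral_eq_zero_iff (hm.comp measurable_prodMk_left)).1 hz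
  filter_upwards [hz] with p hp hb
  by_contra hcon
  have : Φ z p ∈ s := hs hcon
  simp [this, hb] at hp

theorem ae_mul_eq [SFinite ρ] (h : SchurBound μ ρ b Φ C) {f g : Z → ℝ} (hfg : f =ᵐ[μ] g) :
    ∀ᵐ z ∂μ, (fun p => b z p * f (Φ z p)) =ᵐ[ρ] fun p => b z p * g (Φ z p) := by
  filter_upwards [h.ae_comp hfg] with z hz
  filter_upwards [hz] with p hp
  by_cases hb : b z p = 0
  · simp [hb]
  · rw [hp hb]

theorem congr [SFinite ρ] (h : SchurBound μ ρ b Φ C) {f g : Z → ℝ} (hfg : f =ᵐ[μ] g) :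
    paramOp ρ b Φ f =ᵐ[μ] paramOp ρ b Φ g := by
  filter_upwards [h.ae_mul_eq hfg] with z hz
  exact integral_congr_ae hz

/-- Schur's test: split `|b|` as `|b|^(1/2) |b|^(1/2)` in Cauchy–Schwarz. The row bound controls one
factor; the column bound, applied after integration in `z`, controls the other. -/
theorem sq_lintegral_le (h : SchurBound μ ρ b Φ C) {f : Z → ℝ} (hf : Measurable f) (z : Z) :
    (∫⁻ p, ‖b z p * f (Φ z p)‖ₑ ∂ρ) ^ 2 ≤ C * ∫⁻ p, ‖b z p‖ₑ * ‖f (Φ z p)‖ₑ ^ 2 ∂ρ := by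
  have mb : Measurable fun p => ‖b z p‖ₑ := (h.meas_b.comp measurable_prodMk_left).enorm
  have mf : Measurable fun p => ‖f (Φ z p)‖ₑ :=
    (hf.comp (h.meas_Φ.comp measurable_prodMk_left)).enorm
  have hH := ENNReal.lintegral_mul_le_Lp_mul_Lq ρ Real.HolderConjugate.two_two
    (f := fun p => ‖b z p‖ₑ ^ (1 / 2 : ℝ)) (g := fun p => ‖b z p‖ₑ ^ (1 / 2 : ℝ) * ‖f (Φ z p)‖ₑ)
    (mb.pow_const _).aemeasurable ((mb.pow_const _).mul mf).aemeasurable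
  have e1 : ∀ a : ℝ≥0∞, a ^ (1 / 2 : ℝ) * a ^ (1 / 2 : ℝ) = a := fun a => by
    rw [← ENNReal.rpow_add_of_nonneg _ _ (by norm_num) (by norm_num)]; norm_num
  have e2 : ∀ a : ℝ≥0∞, (a ^ (1 / 2 : ℝ)) ^ (2 : ℝ) = a := fun a => by
    rw [← ENNReal.rpow_mul]; norm_num
  have e3 : ∀ a : ℝ≥0∞, (a ^ (1 / 2 : ℝ)) ^ 2 = a := fun a => by rw [pow_two, e1]
  simp only [Pi.mul_apply, ← mul_assoc, e1, e2, ENNReal.mul_rpow_of_nonneg _ _ zero_le_two] at hH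
  simp only [enorm_mul]
  calc _ ≤ ((∫⁻ p, ‖b z p‖ₑ ∂ρ) ^ (1 / 2 : ℝ) *
        (∫⁻ p, ‖b z p‖ₑ * ‖f (Φ z p)‖ₑ ^ (2 : ℝ) ∂ρ) ^ (1 / 2 : ℝ)) ^ 2 := by gcongr
    _ = (∫⁻ p, ‖b z p‖ₑ ∂ρ) * ∫⁻ p, ‖b z p‖ₑ * ‖f (Φ z p)‖ₑ ^ 2 ∂ρ := by
      rw [mul_pow, e3, e3]; simp only [ENNReal.rpow_ofNat]
    _ ≤ _ := by gcongr; exact h.row z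

theorem lintegral_sq_le (h : SchurBound μ ρ b Φ C) {f : Z → ℝ} (hf : Measurable f) :
    ∫⁻ z, (∫⁻ p, ‖b z p * f (Φ z p)‖ₑ ∂ρ) ^ 2 ∂μ ≤ C ^ 2 * ∫⁻ z, ‖f z‖ₑ ^ 2 ∂μ :=
  calc _ ≤ ∫⁻ z, C * ∫⁻ p, ‖b z p‖ₑ * ‖f (Φ z p)‖ₑ ^ 2 ∂ρ ∂μ :=
        lintegral_mono fun z => h.sq_lintegral_le hf z
    _ = C * ∫⁻ z, ∫⁻ p, ‖b z p‖ₑ * ‖f (Φ z p)‖ₑ ^ 2 ∂ρ ∂μ :=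
        lintegral_const_mul' _ _ ENNReal.coe_ne_top
    _ ≤ C * (C * ∫⁻ z, ‖f z‖ₑ ^ 2 ∂μ) := by
        gcongr
        exact h.col (fun z => ‖f z‖ₑ ^ 2) (hf.enorm.pow_const 2)
    _ = _ := by ring

theorem integrable_of_measurable [SFinite ρ] (h : SchurBound μ ρ b Φ C) {f : Z → ℝ}
    (hm : Measurable f) (hf : MemLp f 2 μ) :
    ∀ᵐ z ∂μ, Integrable (fun p => b z p * f (Φ z p)) ρ := by
  have m2 : Measurable (Function.uncurry fun z p => b z p * f (Φ z p)) :=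
    h.meas_b.mul (hm.comp h.meas_Φ)
  have h1 : ∫⁻ z, (∫⁻ p, ‖b z p * f (Φ z p)‖ₑ ∂ρ) ^ 2 ∂μ ≠ ∞ :=
    ((h.lintegral_sq_le hm).trans_lt
      (ENNReal.mul_lt_top (by simp) (lintegral_sq_lt_top hf))).ne
  have h2 := ae_lt_top (m2.enorm.lintegral_prod_right'.pow_const 2) h1
  filter_upwards [h2] with z hz
  refine ⟨(m2.comp measurable_prodMk_left).aestronglyMeasurable, ?_⟩
  rw [ENNReal.pow_lt_top_iff] at hz
  exact hz.resolve_right two_ne_zero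

theorem integrable [SFinite ρ] (h : SchurBound μ ρ b Φ C) {f : Z → ℝ} (hf : MemLp f 2 μ) :
    ∀ᵐ z ∂μ, Integrable (fun p => b z p * f (Φ z p)) ρ := by
  have e := hf.1.aemeasurable.ae_eq_mk
  filter_upwards [h.integrable_of_measurable hf.1.aemeasurable.measurable_mk (hf.ae_eq e),
    h.ae_mul_eq e] with z h1 h2
  exact h1.congr h2.symm

theorem measurable_paramOp [SFinite ρ] (h : SchurBound μ ρ b Φ C) {f : Z → ℝ}
    (hm : Measurable f) : Measurable (paramOp ρ b Φ f) := by
  have m2 : Measurable (Function.uncurry fun z p => b z p * f (Φ z p)) :=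
    h.meas_b.mul (hm.comp h.meas_Φ)
  exact m2.stronglyMeasurable.integral_prod_right.measurable

theorem eLpNorm_paramOp_le [SFinite ρ] (h : SchurBound μ ρ b Φ C) {f : Z → ℝ}
    (hf : MemLp f 2 μ) :
    MemLp (paramOp ρ b Φ f) 2 μ ∧ eLpNorm (paramOp ρ b Φ f) 2 μ ≤ C * eLpNorm f 2 μ := by
  have e := hf.1.aemeasurable.ae_eq_mk
  have hm := hf.1.aemeasurable.measurable_mk
  set g := hf.1.aemeasurable.mk f
  have hg := hf.ae_eq e
  have key : ∫⁻ z, ‖paramOp ρ b Φ g z‖ₑ ^ 2 ∂μ ≤ C ^ 2 * ∫⁻ z, ‖g z‖ₑ ^ 2 ∂μ :=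
    (lintegral_mono fun z => by gcongr; exact enorm_integral_le_lintegral_enorm _).trans
      (h.lintegral_sq_le hm)
  have hle : eLpNorm (paramOp ρ b Φ g) 2 μ ≤ C * eLpNorm g 2 μ := eLpNorm_two_le_iff.2 key
  have hmem : MemLp (paramOp ρ b Φ g) 2 μ :=
    ⟨(h.measurable_paramOp hm).aestronglyMeasurable,
      hle.trans_lt (ENNReal.mul_lt_top (by simp) hg.2)⟩
  refine ⟨hmem.ae_eq (h.congr e).symm, ?_⟩
  rw [eLpNorm_congr_ae (h.congr e), eLpNorm_congr_ae e]
  exact hle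

theorem l2Op [SFinite ρ] (h : SchurBound μ ρ b Φ C) : L2Op μ (paramOp ρ b Φ) where
  bound := ⟨C, fun _ hf => h.eLpNorm_paramOp_le hf⟩
  congr _ _ _ hfg := h.congr hfg
  add f g hf hg := by
    filter_upwards [h.integrable hf, h.integrable hg] with z h1 h2
    simp only [paramOp, Pi.add_apply, mul_add]
    exact integral_add h1 h2
  smul c f hf := by
    refine Eventually.of_forall fun z => ?_
    simp only [paramOp, Pi.smul_apply, smul_eq_mul, ← integral_const_mul]
    exact integral_congr_ae (Eventually.of_forall fun p => by ring)

end SchurBound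

end ParamOp

/-! ### A radial majorant of the kernel of `K` and its modulus of continuity in `L¹` -/

/-- The radial profile `r ↦ (r (1 + r))⁻²`. -/
def profile (r : ℝ) : ℝ := ((r * (1 + r))⁻¹) ^ 2

/-- The radial majorant `w ↦ (|w| (1 + |w|))⁻²`. -/
def maj (w : E3) : ℝ := profile ‖w‖

theorem profile_nonneg (r : ℝ) : 0 ≤ profile r := sq_nonneg _

theorem maj_nonneg (w : E3) : 0 ≤ maj w := profile_nonneg _

theorem measurable_profile : Measurable profile := by unfold profile; fun_prop

theorem measurable_maj : Measurable maj := measurable_profile.comp measurable_norm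

/-- The relative increment `x = (s - r) / s` bounds the relative change of the profile up to a
constant. As `0 ≤ x ≤ 1`, it may be weakened to `x ^ θ`, so Hölder order `θ` costs only the extra
singularity `r ^ (-θ)`. -/
theorem profile_sub_le {θ r s : ℝ} (hθ0 : 0 ≤ θ) (hθ1 : θ ≤ 1) (hr : 0 < r) (hrs : r ≤ s) :
    |profile s - profile r| ≤ 4 * |s - r| ^ θ * (profile r * r ^ (-θ)) := by
  have hs : 0 < s := hr.trans_le hrs
  set p := (r * (1 + r))⁻¹ with hp
  set q := (s * (1 + s))⁻¹ with hq
  have hp0 : 0 < p := by positivity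
  have hq0 : 0 < q := by positivity
  have hqp : q ≤ p := by rw [hp, hq]; gcongr
  set x := (s - r) / s with hx
  have hx0 : 0 ≤ x := div_nonneg (by linarith) hs.le
  have hx1 : x ≤ 1 := by rw [hx, div_le_one hs]; linarith
  have h1 : p - q ≤ 2 * p * x := by
    have : p - q = p * x * ((1 + r + s) / (1 + s)) := by
      rw [hp, hq, hx]; field_simp; ring
    rw [this]
    have h2 : (1 + r + s) / (1 + s) ≤ 2 := by rw [div_le_iff₀ (by linarith)]; linarith
    nlinarith [mul_nonneg hp0.le hx0]
  have h2 : x ≤ (s - r) ^ θ * r ^ (-θ) := by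
    calc x ≤ x ^ θ := Real.self_le_rpow_of_le_one hx0 hx1 hθ1
      _ = (s - r) ^ θ * s ^ (-θ) := by
        rw [hx, Real.div_rpow (by linarith) hs.le, Real.rpow_neg hs.le]; rfl
      _ ≤ _ := by
        refine mul_le_mul_of_nonneg_left ?_ (Real.rpow_nonneg (by linarith) _)
        exact Real.rpow_le_rpow_of_nonpos hr hrs (by linarith)
  have e1 : profile s - profile r = -((p - q) * (p + q)) := by
    simp only [profile, ← hp, ← hq]; ring
  rw [e1, abs_neg, abs_of_nonneg (mul_nonneg (by linarith) (by linarith)),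
    abs_of_nonneg (by linarith : 0 ≤ s - r)]
  calc (p - q) * (p + q) ≤ (2 * p * x) * (2 * p) := by
        refine mul_le_mul h1 (by linarith) (by linarith) (by positivity)
    _ = 4 * p ^ 2 * x := by ring
    _ ≤ 4 * p ^ 2 * ((s - r) ^ θ * r ^ (-θ)) := by gcongr
    _ = _ := by simp only [profile, ← hp]; ring

theorem maj_sub_le {θ : ℝ} (hθ0 : 0 ≤ θ) (hθ1 : θ ≤ 1) {u w : E3} (hu : u ≠ 0) (hw : w ≠ 0) :
    |maj u - maj w| ≤
      4 * ‖u - w‖ ^ θ * (profile ‖u‖ * ‖u‖ ^ (-θ) + profile ‖w‖ * ‖w‖ ^ (-θ)) := by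
  have hd : |‖u‖ - ‖w‖| ^ θ ≤ ‖u - w‖ ^ θ :=
    Real.rpow_le_rpow (abs_nonneg _) (abs_norm_sub_norm_le u w) hθ0
  have hu' : 0 ≤ profile ‖u‖ * ‖u‖ ^ (-θ) := mul_nonneg (profile_nonneg _) (by positivity)
  have hw' : 0 ≤ profile ‖w‖ * ‖w‖ ^ (-θ) := mul_nonneg (profile_nonneg _) (by positivity)
  rcases le_total ‖w‖ ‖u‖ with h | h
  · refine (profile_sub_le hθ0 hθ1 (norm_pos_iff.2 hw) h).trans ?_
    gcongr
    linarith
  · have := profile_sub_le hθ0 hθ1 (norm_pos_iff.2 hu) h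
    rw [abs_sub_comm, abs_sub_comm ‖w‖] at this
    refine this.trans ?_
    gcongr
    linarith

/-- The polar Jacobian `r²` cancels the singularity of the profile and leaves `(1 + r)⁻² r ^ (-θ)`:
integrable at `0` because `θ < 1`, and at infinity thanks to `(1 + r)⁻²`. -/
theorem integrable_profile_rpow {θ : ℝ} (hθ0 : 0 ≤ θ) (hθ1 : θ < 1) :
    Integrable (fun w : E3 => profile ‖w‖ * ‖w‖ ^ (-θ)) := by
  rw [integrable_fun_norm_addHaar volume (f := fun r => profile r * r ^ (-θ))]
  have hd : Module.finrank ℝ E3 - 1 = 2 := by simp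
  rw [hd]
  have hm : AEStronglyMeasurable (fun y : ℝ => y ^ 2 • (profile y * y ^ (-θ)))
      (volume.restrict (Ioi 0)) := by
    have := measurable_profile
    exact Measurable.aestronglyMeasurable (by simp only [smul_eq_mul]; fun_prop)
  have hform : ∀ y : ℝ, 0 < y →
      y ^ 2 • (profile y * y ^ (-θ)) = ((1 + y)⁻¹) ^ 2 * y ^ (-θ) := by
    intro y hy
    simp only [profile, smul_eq_mul, mul_inv, mul_pow]
    field_simp
  have hle : ∀ y : ℝ, 0 < y → ((1 + y)⁻¹) ^ 2 ≤ 1 := fun y hy => by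
    apply pow_le_one₀ (by positivity)
    exact inv_le_one_of_one_le₀ (by linarith)
  rw [← Ioc_union_Ioi_eq_Ioi (zero_le_one (α := ℝ))]
  refine IntegrableOn.union ?_ ?_
  · have h0 : IntegrableOn (fun y : ℝ => y ^ (-θ)) (Ioc 0 1) := by
      rw [← intervalIntegrable_iff_integrableOn_Ioc_of_le zero_le_one]
      exact intervalIntegral.intervalIntegrable_rpow' (by linarith)
    refine h0.mono' (hm.mono_measure (Measure.restrict_mono Ioc_subset_Ioi_self le_rfl)) ?_
    filter_upwards [ae_restrict_mem measurableSet_Ioc] with y hy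
    have hy0 : 0 < y := hy.1
    rw [hform y hy0, Real.norm_of_nonneg (by positivity)]
    exact mul_le_of_le_one_left (by positivity) (hle y hy0)
  · have h0 : IntegrableOn (fun y : ℝ => y ^ (-2 : ℝ)) (Ioi 1) :=
      integrableOn_Ioi_rpow_of_lt (by norm_num) one_pos
    refine h0.mono' (hm.mono_measure
      (Measure.restrict_mono (Ioi_subset_Ioi zero_le_one) le_rfl)) ?_
    filter_upwards [ae_restrict_mem measurableSet_Ioi] with y hy
    have hy1 : 1 < y := hy
    have hy0 : 0 < y := by linarith
    rw [hform y hy0, Real.norm_of_nonneg (by positivity), Real.rpow_neg hy0.le 2]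
    have h1 : y ^ (-θ) ≤ 1 := Real.rpow_le_one_of_one_le_of_nonpos hy1.le (by linarith)
    have h2 : ((1 + y)⁻¹) ^ 2 ≤ (y ^ (2 : ℝ))⁻¹ := by
      rw [inv_pow, Real.rpow_two]
      gcongr
      linarith
    calc _ ≤ (y ^ (2 : ℝ))⁻¹ * 1 := by gcongr
      _ = _ := mul_one _

theorem integrable_maj : Integrable maj := by
  have h := integrable_profile_rpow (θ := 0) le_rfl one_pos
  simp only [neg_zero, Real.rpow_zero, mul_one] at h
  exact h

/-- The `L¹` modulus of continuity of the majorant is Hölder of every order less than one. -/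
theorem exists_integral_maj_sub_le {θ : ℝ} (hθ0 : 0 ≤ θ) (hθ1 : θ < 1) :
    ∃ C : ℝ, 0 ≤ C ∧ ∀ c : E3, ∫ w, |maj (w + c) - maj w| ≤ C * ‖c‖ ^ θ := by
  have hI := integrable_profile_rpow hθ0 hθ1
  set G : E3 → ℝ := fun w => profile ‖w‖ * ‖w‖ ^ (-θ) with hG
  have hG0 : ∀ w, 0 ≤ G w := fun w => mul_nonneg (profile_nonneg _) (by positivity)
  refine ⟨8 * ∫ w, G w, mul_nonneg (by norm_num) (integral_nonneg hG0), fun c => ?_⟩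
  have h1 : ∀ᵐ w : E3, |maj (w + c) - maj w| ≤ 4 * ‖c‖ ^ θ * (G (w + c) + G w) := by
    have h2 : ∀ x : E3, ∀ᵐ w : E3, w ≠ x := fun x => by
      simp [ae_iff]
    filter_upwards [h2 0, h2 (-c)] with w hw hwc
    have := maj_sub_le hθ0 hθ1.le (u := w + c) (w := w)
      (fun h => hwc (eq_neg_of_add_eq_zero_left h)) hw
    simpa [hG] using this
  calc _ ≤ ∫ w, 4 * ‖c‖ ^ θ * (G (w + c) + G w) := by
        refine integral_mono_ae ((integrable_maj.comp_add_right c).sub integrable_maj).abs ?_ h1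
        exact ((hI.comp_add_right c).add hI).const_mul _
    _ = _ := by
        rw [integral_const_mul, integral_add (hI.comp_add_right c) hI,
          integral_add_right_eq_self G c]
        ring

/-! ### The exponential law on the half-line -/

/-- The exponential law `exp(-s) ds` on `(0, ∞)`. -/
def expLaw : Measure ℝ :=
  (volume.restrict (Ioi 0)).withDensity fun s => ENNReal.ofReal (Real.exp (-s))

theorem lintegral_expLaw (f : ℝ → ℝ≥0∞) :
    ∫⁻ s, f s ∂expLaw = ∫⁻ s in Ioi 0, ENNReal.ofReal (Real.exp (-s)) * f s := by
  rw [expLaw, lintegral_withDensity_eq_lintegral_mul_non_measurable]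
  · rfl
  · fun_prop
  · simp

instance : IsProbabilityMeasure expLaw where
  measure_univ := by
    rw [← lintegral_one, lintegral_expLaw]
    simp only [mul_one]
    rw [← ofReal_integral_eq_lintegral_ofReal (integrableOn_exp_neg_Ioi 0)
      (Eventually.of_forall fun s => (Real.exp_pos _).le), integral_exp_neg_Ioi_zero]
    simp

theorem integral_expLaw (f : ℝ → ℝ) :
    ∫ s, f s ∂expLaw = ∫ s in Ioi 0, Real.exp (-s) * f s := by
  rw [expLaw, integral_withDensity_eq_integral_toReal_smul (by fun_prop) (by simp)]
  simp [ENNReal.toReal_ofReal, (Real.exp_pos _).le]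

theorem expLaw_absolutelyContinuous : expLaw ≪ volume :=
  (withDensity_absolutelyContinuous _ _).trans Measure.restrict_le_self.absolutelyContinuous

theorem lintegral_expLaw_le (f : ℝ → ℝ≥0∞) : ∫⁻ s, f s ∂expLaw ≤ ∫⁻ s, f s := by
  rw [lintegral_expLaw]
  refine (lintegral_mono_ae ?_).trans (setLIntegral_le_lintegral (Ioi 0) f)
  filter_upwards [ae_restrict_mem measurableSet_Ioi] with s hs
  refine mul_le_of_le_one_left' ?_
  rw [← ENNReal.ofReal_one]
  exact ENNReal.ofReal_le_ofReal (Real.exp_le_one_iff.2 (by simpa using (le_of_lt hs)))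

/-- The exponential density is at most `1` and its total mass is `1`. The part `|t - s| ≤ 1` is
therefore bounded by a Lebesgue integral independent of `s`, and elsewhere the integrand is at most
`1`. -/
theorem exists_lintegral_expLaw_rpow_le {θ : ℝ} (hθ0 : 0 ≤ θ) (hθ1 : θ < 1) :
    ∃ C : ℝ≥0, ∀ s : ℝ, ∫⁻ t, ENNReal.ofReal (|t - s| ^ (-θ)) ∂expLaw ≤ C := by
  set g : ℝ → ℝ≥0∞ := (Icc (-1) 1).indicator fun u => ENNReal.ofReal (|u| ^ (-θ)) with hg
  have hgm : Measurable g := Measurable.indicator (by fun_prop) measurableSet_Icc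
  have h1 : IntegrableOn (fun u : ℝ => |u| ^ (-θ)) (Icc (-1) 1) := by
    have h0 : IntervalIntegrable (fun u : ℝ => |u| ^ (-θ)) volume 0 1 := by
      refine (intervalIntegral.intervalIntegrable_rpow' (r := -θ) (by linarith)).congr ?_
      intro u hu
      rw [uIoc_of_le zero_le_one] at hu
      simp [abs_of_pos hu.1]
    have h0' : IntervalIntegrable (fun u : ℝ => |u| ^ (-θ)) volume (-1) 0 := by
      have := h0.comp_mul_left (c := -1)
      simp only [neg_mul, one_mul, abs_neg] at this
      simpa using this.symm
    rw [integrableOn_Icc_iff_integrableOn_Ioc,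
      ← intervalIntegrable_iff_integrableOn_Ioc_of_le (by norm_num)]
    exact h0'.trans h0
  have h2 : ∫⁻ u, g u < ∞ := by
    rw [hg, lintegral_indicator measurableSet_Icc]
    exact h1.lintegral_lt_top
  refine ⟨(∫⁻ u, g u).toNNReal + 1, fun s => ?_⟩
  rw [ENNReal.coe_add, ENNReal.coe_toNNReal h2.ne, ENNReal.coe_one]
  have h3 : ∀ t, ENNReal.ofReal (|t - s| ^ (-θ)) ≤ g (t - s) + 1 := by
    intro t
    by_cases ht : t - s ∈ Icc (-1 : ℝ) 1
    · rw [hg, indicator_of_mem ht]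
      exact le_self_add
    · refine le_add_left ?_
      rw [← ENNReal.ofReal_one]
      refine ENNReal.ofReal_le_ofReal (Real.rpow_le_one_of_one_le_of_nonpos ?_ (by linarith))
      rw [mem_Icc, ← abs_le] at ht
      exact (not_le.1 ht).le
  calc _ ≤ ∫⁻ t, (g (t - s) + 1) ∂expLaw := lintegral_mono h3
    _ = (∫⁻ t, g (t - s) ∂expLaw) + 1 := by
      rw [lintegral_add_right _ measurable_const]; simp
    _ ≤ (∫⁻ t, g (t - s)) + 1 := add_le_add (lintegral_expLaw_le _) le_rfl
    _ = _ := by rw [lintegral_sub_right_eq_self g s]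

/-! ### Autocorrelation -/

/-- The autocorrelation function of `φ`. -/
def autocorr (φ : E3 → ℝ) (z : E3) : ℝ := ∫ x, φ x * φ (x + z)

section Autocorr

variable {φ : E3 → ℝ}

theorem memLp_comp_add (hφ : MemLp φ 2) (z : E3) : MemLp (fun x => φ (x + z)) 2 :=
  hφ.comp_measurePreserving (measurePreserving_add_right volume z)

theorem integrable_mul_shift (hφ : MemLp φ 2) (y z : E3) :
    Integrable fun x => φ (x + y) * φ (x + z) :=
  (memLp_comp_add hφ y).integrable_mul (memLp_comp_add hφ z)

theorem integral_mul_shift (y z : E3) :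
    ∫ x, φ (x + y) * φ (x + z) = autocorr φ (z - y) := by
  rw [autocorr, ← integral_add_right_eq_self (fun x => φ x * φ (x + (z - y))) y]
  simp [add_assoc]

theorem integral_abs_mul_shift_le (hφ : MemLp φ 2) (y z : E3) :
    ∫ x, |φ (x + y) * φ (x + z)| ≤ ∫ x, φ x ^ 2 := by
  have h1 : ∀ y : E3, Integrable fun x => φ (x + y) ^ 2 := fun y =>
    (memLp_comp_add hφ y).integrable_sq
  have h2 : ∀ y : E3, ∫ x, φ (x + y) ^ 2 = ∫ x, φ x ^ 2 := fun y =>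
    integral_add_right_eq_self (fun x => φ x ^ 2) y
  calc _ ≤ ∫ x, (φ (x + y) ^ 2 + φ (x + z) ^ 2) / 2 := by
        refine integral_mono (integrable_mul_shift hφ y z).abs
          (((h1 y).add (h1 z)).div_const 2) fun x => ?_
        simp only [abs_mul]
        nlinarith [sq_nonneg (|φ (x + y)| - |φ (x + z)|), sq_abs (φ (x + y)), sq_abs (φ (x + z))]
    _ = _ := by rw [integral_div, integral_add (h1 y) (h1 z), h2, h2]; ring

theorem abs_autocorr_le (hφ : MemLp φ 2) (z : E3) : |autocorr φ z| ≤ ∫ x, φ x ^ 2 := by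
  have h := integral_abs_mul_shift_le hφ 0 z
  have h' := abs_integral_le_integral_abs (μ := (volume : Measure E3)) (f := fun x => φ x * φ (x + z))
  simp only [add_zero] at h
  exact h'.trans h

theorem measurable_autocorr (hm : Measurable φ) : Measurable (autocorr φ) := by
  have : Measurable (Function.uncurry fun z x : E3 => φ x * φ (x + z)) := by
    unfold Function.uncurry; fun_prop
  exact this.stronglyMeasurable.integral_prod_right.measurable

/-- The autocorrelation of a first difference is minus a second difference of the autocorrelation.
Writing this as two first differences, with increments `a` and `-a`, lets each be treated by the
same substitution. -/
theorem autocorr_diff (hφ : MemLp φ 2) (a z : E3) :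
    autocorr (fun x => φ (x - a) - φ x) z =
      (autocorr φ z - autocorr φ (z + a)) + (autocorr φ z - autocorr φ (z + -a)) := by
  have e : ∀ x, (φ (x - a) - φ x) * (φ (x + z - a) - φ (x + z)) =
      (φ (x + -a) * φ (x + (z - a)) - φ (x + -a) * φ (x + z))
        - (φ (x + 0) * φ (x + (z - a)) - φ (x + 0) * φ (x + z)) := fun x => by
    rw [← sub_eq_add_neg, ← add_sub_assoc, add_zero]; ring
  have I := integrable_mul_shift hφ
  have h1 : ∀ x y z w : E3, Integrable fun t => φ (t + x) * φ (t + y) - φ (t + z) * φ (t + w) :=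
    fun x y z w => (I x y).sub (I z w)
  rw [autocorr]
  simp_rw [e]
  rw [integral_sub (h1 _ _ _ _) (h1 _ _ _ _), integral_sub (I _ _) (I _ _),
    integral_sub (I _ _) (I _ _)]
  simp only [integral_mul_shift]
  simp only [sub_neg_eq_add, sub_zero, sub_add_cancel, ← sub_eq_add_neg]
  ring

/-- The autocorrelation is merely bounded, so the increment has to be absorbed elsewhere: the
translation `w ↦ w - r⁻¹ a` moves it onto `maj`, whose `L¹` modulus yields `(|a| / |r|) ^ θ`. -/
theorem abs_integral_maj_autocorr_le {θ C : ℝ}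
    (hC : ∀ c : E3, ∫ w, |maj (w + c) - maj w| ≤ C * ‖c‖ ^ θ)
    (hm : Measurable φ) (hφ : MemLp φ 2) (a v : E3) {r : ℝ} (hr : r ≠ 0) :
    |∫ w, maj (w - v) * (autocorr φ (r • w) - autocorr φ (r • w + a))| ≤
      (∫ x, φ x ^ 2) * (C * ‖a‖ ^ θ * |r| ^ (-θ)) := by
  set N := ∫ x, φ x ^ 2
  set A := autocorr φ
  have hA : Measurable A := measurable_autocorr hm
  set c : E3 := -(r⁻¹ • a) with hc
  have hint : ∀ (y : E3) (f : E3 → E3), Measurable f →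
      Integrable fun w => maj (w - y) * A (f w) := by
    intro y f hf
    refine (integrable_maj.comp_sub_right y).mul_bdd (c := N) ?_ ?_
    · exact (hA.comp hf).aestronglyMeasurable
    · exact Eventually.of_forall fun w => abs_autocorr_le hφ _
  have h1 : ∫ w, maj (w - v) * A (r • w + a) = ∫ w, maj (w - v + c) * A (r • w) := by
    rw [← integral_add_right_eq_self _ c]
    refine integral_congr_ae (Eventually.of_forall fun w => ?_)
    simp only
    congr 2
    · abel
    · rw [hc, smul_add, smul_neg, smul_inv_smul₀ hr]; abel
  have h2 : ∫ w, maj (w - v) * (A (r • w) - A (r • w + a)) =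
      ∫ w, (maj (w - v) - maj (w - v + c)) * A (r • w) := by
    simp only [mul_sub, sub_mul]
    rw [integral_sub (hint _ _ (by fun_prop)) (hint _ _ (by fun_prop)), h1, integral_sub]
    · exact hint _ _ (by fun_prop)
    · have := hint (v - c) (fun w => r • w) (by fun_prop)
      simpa [sub_sub_eq_add_sub, sub_add_eq_add_sub, add_sub_assoc] using this
  rw [h2]
  have hd : Integrable fun w => |maj (w - v + c) - maj (w - v)| := by
    have := ((integrable_maj.comp_add_right c).sub integrable_maj).abs
    exact this.comp_sub_right v
  calc _ ≤ ∫ w, |(maj (w - v) - maj (w - v + c)) * A (r • w)| := abs_integral_le_integral_abs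
    _ ≤ ∫ w, |maj (w - v + c) - maj (w - v)| * N := by
      refine integral_mono_of_nonneg (Eventually.of_forall fun _ => abs_nonneg _)
        (hd.mul_const N) (Eventually.of_forall fun w => ?_)
      simp only [abs_mul]
      rw [abs_sub_comm]
      gcongr
      exact abs_autocorr_le hφ _
    _ = (∫ w, |maj (w + c) - maj w|) * N := by
      rw [integral_mul_const, integral_sub_right_eq_self (fun w => |maj (w + c) - maj w|) v]
    _ ≤ C * ‖c‖ ^ θ * N := by
      exact mul_le_mul_of_nonneg_right (hC c) (integral_nonneg fun x => sq_nonneg (φ x))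
    _ = _ := by
      rw [hc, norm_neg, norm_smul, Real.mul_rpow (by positivity) (by positivity), norm_inv,
        Real.norm_eq_abs, Real.inv_rpow (abs_nonneg _), Real.rpow_neg (abs_nonneg _)]
      ring

/-- The mean of `φ` along the ray from `x` in direction `w`. -/
def rayMean (φ : E3 → ℝ) (w x : E3) : ℝ := ∫ s, φ (x + s • w) ∂expLaw

theorem integrable_ray_prod (hm : Measurable φ) (hφ : MemLp φ 2) (w : E3) :
    Integrable (fun q : E3 × ℝ × ℝ => φ (q.1 + q.2.1 • w) * φ (q.1 + q.2.2 • w))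
      (volume.prod (expLaw.prod expLaw)) := by
  have hM : Measurable fun q : E3 × ℝ × ℝ => φ (q.1 + q.2.1 • w) * φ (q.1 + q.2.2 • w) := by
    fun_prop
  have hN : StronglyMeasurable fun p : ℝ × ℝ =>
      ∫ x, ‖φ (x + p.1 • w) * φ (x + p.2 • w)‖ :=
    hM.norm.stronglyMeasurable.integral_prod_left'
  refine (integrable_prod_iff' hM.aestronglyMeasurable).2
    ⟨Eventually.of_forall fun p => integrable_mul_shift hφ (p.1 • w) (p.2 • w), ?_⟩
  refine Integrable.of_bound (C := ∫ x, φ x ^ 2) hN.aestronglyMeasurable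
    (Eventually.of_forall fun p => ?_)
  rw [Real.norm_of_nonneg (integral_nonneg fun x => norm_nonneg _)]
  exact integral_abs_mul_shift_le hφ (p.1 • w) (p.2 • w)

theorem rayMean_sq (w x : E3) :
    rayMean φ w x ^ 2 = ∫ p, φ (x + p.1 • w) * φ (x + p.2 • w) ∂(expLaw.prod expLaw) := by
  rw [integral_prod_mul (fun s : ℝ => φ (x + s • w)) (fun s : ℝ => φ (x + s • w)), pow_two]
  rfl

theorem integrable_rayMean_sq (hm : Measurable φ) (hφ : MemLp φ 2) (w : E3) :
    Integrable fun x => rayMean φ w x ^ 2 := by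
  simp_rw [rayMean_sq]
  exact (integrable_ray_prod hm hφ w).integral_prod_left

/-- The square of a mean over times is a double mean over pairs of times. Integrating in `x` first
leaves only the time difference. -/
theorem integral_rayMean_sq (hm : Measurable φ) (hφ : MemLp φ 2) (w : E3) :
    ∫ x, rayMean φ w x ^ 2 = ∫ p, autocorr φ ((p.2 - p.1) • w) ∂(expLaw.prod expLaw) := by
  simp_rw [rayMean_sq]
  rw [integral_integral_swap (integrable_ray_prod hm hφ w)]
  simp only [integral_mul_shift, ← sub_smul]

theorem integral_maj_rayMean_sq (hm : Measurable φ) (hφ : MemLp φ 2) (v : E3) :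
    Integrable (fun w => maj (w - v) * ∫ x, rayMean φ w x ^ 2) ∧
    ∫ w, maj (w - v) * ∫ x, rayMean φ w x ^ 2 =
      ∫ p, (∫ w, maj (w - v) * autocorr φ ((p.2 - p.1) • w)) ∂(expLaw.prod expLaw) := by
  simp_rw [integral_rayMean_sq hm hφ, ← integral_const_mul]
  have hA := measurable_autocorr hm
  have hi : Integrable (Function.uncurry fun (w : E3) (p : ℝ × ℝ) =>
      maj (w - v) * autocorr φ ((p.2 - p.1) • w)) (volume.prod (expLaw.prod expLaw)) := by
    have h1 : Integrable (fun q : E3 × ℝ × ℝ => maj (q.1 - v))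
        (volume.prod (expLaw.prod expLaw)) :=
      (integrable_maj.comp_sub_right v).comp_fst _
    refine h1.mul_bdd (c := ∫ x, φ x ^ 2) ?_ (Eventually.of_forall fun q => abs_autocorr_le hφ _)
    exact Measurable.aestronglyMeasurable (by fun_prop)
  exact ⟨hi.integral_prod_left, integral_integral_swap hi⟩

end Autocorr

/-- Averages of differences along rays, with weight `maj`, gain Hölder regularity. -/
theorem exists_lintegral_maj_rayMean_le {θ : ℝ} (hθ0 : 0 ≤ θ) (hθ1 : θ < 1) :
    ∃ C : ℝ≥0, ∀ φ : E3 → ℝ, Measurable φ → MemLp φ 2 → ∀ a v : E3,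
      ∫⁻ w, ENNReal.ofReal (maj (w - v)) *
          ∫⁻ x, ‖rayMean (fun x => φ (x - a) - φ x) w x‖ₑ ^ 2
        ≤ C * ENNReal.ofReal (‖a‖ ^ θ) * ∫⁻ x, ‖φ x‖ₑ ^ 2 := by
  obtain ⟨C, hC0, hC⟩ := exists_integral_maj_sub_le hθ0 hθ1
  obtain ⟨D, hD⟩ := exists_lintegral_expLaw_rpow_le hθ0 hθ1
  refine ⟨(2 * C).toNNReal * D, fun φ hm hφ a v => ?_⟩
  set ψ : E3 → ℝ := fun x => φ (x - a) - φ x with hψdef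
  have hψm : Measurable ψ := by fun_prop
  have hψ : MemLp ψ 2 := by
    have := memLp_comp_add hφ (-a)
    simp only [← sub_eq_add_neg] at this
    exact this.sub hφ
  set N := ∫ x, φ x ^ 2 with hN
  have hN0 : 0 ≤ N := integral_nonneg fun x => sq_nonneg _
  have hNe : ∫⁻ x, ‖φ x‖ₑ ^ 2 = ENNReal.ofReal N := by
    rw [hN, ofReal_integral_eq_lintegral_ofReal hφ.integrable_sq
      (Eventually.of_forall fun x => sq_nonneg _)]
    refine lintegral_congr fun x => ?_
    rw [← sq_abs, ENNReal.ofReal_pow (abs_nonneg _), ← Real.norm_eq_abs, ofReal_norm]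
  obtain ⟨hI, hE⟩ := integral_maj_rayMean_sq hψm hψ v
  have h1 : ∫⁻ w, ENNReal.ofReal (maj (w - v)) * ∫⁻ x, ‖rayMean ψ w x‖ₑ ^ 2 =
      ENNReal.ofReal (∫ w, maj (w - v) * ∫ x, rayMean ψ w x ^ 2) := by
    rw [ofReal_integral_eq_lintegral_ofReal hI (Eventually.of_forall fun w =>
      mul_nonneg (maj_nonneg _) (integral_nonneg fun x => sq_nonneg _))]
    refine lintegral_congr fun w => ?_
    rw [ENNReal.ofReal_mul (maj_nonneg _), ofReal_integral_eq_lintegral_ofReal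
      (integrable_rayMean_sq hψm hψ w) (Eventually.of_forall fun x => sq_nonneg _)]
    congr 1
    refine lintegral_congr fun x => ?_
    rw [← sq_abs, ENNReal.ofReal_pow (abs_nonneg _), ← Real.norm_eq_abs, ofReal_norm]
  rw [h1, hE, hNe]
  set G : ℝ × ℝ → ℝ := fun p => ∫ w, maj (w - v) * autocorr ψ ((p.2 - p.1) • w) with hG
  have hA := measurable_autocorr hm
  -- The two terms of `autocorr_diff` have increments of the same length `‖a‖`, whence the factor
  -- `2`.
  have hGle : ∀ p : ℝ × ℝ, p.1 ≠ p.2 →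
      ‖G p‖ ≤ (2 * C * ‖a‖ ^ θ * N) * |p.2 - p.1| ^ (-θ) := by
    intro p hp
    have hr : p.2 - p.1 ≠ 0 := sub_ne_zero.2 hp.symm
    have k1 := abs_integral_maj_autocorr_le hC hm hφ a v hr
    have k2 := abs_integral_maj_autocorr_le hC hm hφ (-a) v hr
    have hint : ∀ a : E3, Integrable fun w => maj (w - v) *
        (autocorr φ ((p.2 - p.1) • w) - autocorr φ ((p.2 - p.1) • w + a)) := by
      intro a
      refine (integrable_maj.comp_sub_right v).mul_bdd (c := N + N) ?_ ?_
      · exact Measurable.aestronglyMeasurable (by fun_prop)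
      · refine Eventually.of_forall fun w => (norm_sub_le _ _).trans ?_
        exact add_le_add (abs_autocorr_le hφ _) (abs_autocorr_le hφ _)
    rw [hG]
    simp only [hψdef, autocorr_diff hφ, mul_add]
    rw [integral_add (hint a) (hint (-a)), Real.norm_eq_abs]
    rw [norm_neg] at k2
    refine (abs_add_le _ _).trans ((add_le_add k1 k2).trans (le_of_eq ?_))
    ring
  -- On the diagonal the velocity no longer enters the argument of the autocorrelation and the bound
  -- degenerates. The diagonal is null because the exponential law has a density.
  have hae : ∀ᵐ p ∂(expLaw.prod expLaw), p.1 ≠ p.2 := by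
    refine (Measure.ae_prod_iff_ae_ae (p := fun p : ℝ × ℝ => p.1 ≠ p.2)
      (measurableSet_eq_fun measurable_fst measurable_snd).compl).2 ?_
    refine Eventually.of_forall fun s => ?_
    have : ∀ᵐ t : ℝ, t ≠ s := by simp [ae_iff]
    filter_upwards [expLaw_absolutelyContinuous.ae_le this] with t ht using ht.symm
  have hcn : 0 ≤ 2 * C * ‖a‖ ^ θ * N := by positivity
  have hMt : Measurable fun p : ℝ × ℝ => ENNReal.ofReal (|p.2 - p.1| ^ (-θ)) := by fun_prop
  calc ENNReal.ofReal (∫ p, G p ∂(expLaw.prod expLaw))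
      ≤ ‖∫ p, G p ∂(expLaw.prod expLaw)‖ₑ := Real.ofReal_le_enorm _
    _ ≤ ∫⁻ p, ‖G p‖ₑ ∂(expLaw.prod expLaw) := enorm_integral_le_lintegral_enorm _
    _ ≤ ∫⁻ p, ENNReal.ofReal (2 * C * ‖a‖ ^ θ * N) * ENNReal.ofReal (|p.2 - p.1| ^ (-θ))
          ∂(expLaw.prod expLaw) := by
        refine lintegral_mono_ae ?_
        filter_upwards [hae] with p hp
        rw [← ENNReal.ofReal_mul hcn, ← ofReal_norm]
        exact ENNReal.ofReal_le_ofReal (hGle p hp)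
    _ = ENNReal.ofReal (2 * C * ‖a‖ ^ θ * N) *
          ∫⁻ s, ∫⁻ t, ENNReal.ofReal (|t - s| ^ (-θ)) ∂expLaw ∂expLaw := by
        rw [lintegral_const_mul _ hMt, lintegral_prod _ hMt.aemeasurable]
    _ ≤ ENNReal.ofReal (2 * C * ‖a‖ ^ θ * N) * ∫⁻ s, D ∂expLaw := by
        gcongr with s
        exact hD s
    _ = _ := by
        rw [lintegral_const, measure_univ, mul_one, ENNReal.ofReal_mul (by positivity),
          ENNReal.ofReal_mul (by positivity), ENNReal.coe_mul]
        rw [show ((2 * C).toNNReal : ℝ≥0∞) = ENNReal.ofReal (2 * C) from rfl]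
        ring

/-! ### Differences in the position variable -/

/-- The translate of `f` by `a` in the position variable. -/
def shiftX (a : E3) (f : E3 × E3 → ℝ) (z : E3 × E3) : ℝ := f (z.1 + a, z.2)

/-- The difference of `f` with increment `a` in the position variable. -/
def diffX (a : E3) (f : E3 × E3 → ℝ) : E3 × E3 → ℝ := shiftX a f - f

theorem measurePreserving_shiftX (a : E3) :
    MeasurePreserving (fun z : E3 × E3 => (z.1 + a, z.2)) :=
  (measurePreserving_add_right volume a).prod (MeasurePreserving.id volume)

theorem measurable_shiftX {f : E3 × E3 → ℝ} (hf : Measurable f) (a : E3) :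
    Measurable (shiftX a f) := by
  unfold shiftX; fun_prop

theorem measurable_diffX {f : E3 × E3 → ℝ} (hf : Measurable f) (a : E3) :
    Measurable (diffX a f) := (measurable_shiftX hf a).sub hf

theorem memLp_shiftX {f : E3 × E3 → ℝ} (hf : MemLp f 2) (a : E3) : MemLp (shiftX a f) 2 :=
  hf.comp_measurePreserving (measurePreserving_shiftX a)

theorem memLp_diffX {f : E3 × E3 → ℝ} (hf : MemLp f 2) (a : E3) : MemLp (diffX a f) 2 :=
  (memLp_shiftX hf a).sub hf

theorem eLpNorm_shiftX {f : E3 × E3 → ℝ} (hf : AEStronglyMeasurable f volume) (a : E3) :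
    eLpNorm (shiftX a f) 2 volume = eLpNorm f 2 volume :=
  eLpNorm_comp_measurePreserving hf (measurePreserving_shiftX a)

theorem shiftX_congr {f g : E3 × E3 → ℝ} (h : f =ᵐ[volume] g) (a : E3) :
    shiftX a f =ᵐ[volume] shiftX a g :=
  (measurePreserving_shiftX a).quasiMeasurePreserving.ae_eq_comp h

theorem diffX_congr {f g : E3 × E3 → ℝ} (h : f =ᵐ[volume] g) (a : E3) :
    diffX a f =ᵐ[volume] diffX a g := (shiftX_congr h a).sub h

/-! ### Integral operators in the velocity variable -/

section VelKernel

variable {P : Type*} [MeasurableSpace P]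

/-- The family of weighted measures `b(v, p) dρ(p)`, pushed forward by `W(v, ·)`, is dominated by
a multiple of `maj(w - v) dw`. -/
structure VelKernel (ρ : Measure P) (b : E3 → P → ℝ) (W : E3 → P → E3) (C : ℝ≥0) : Prop where
  meas_b : Measurable (Function.uncurry b)
  meas_W : Measurable (Function.uncurry W)
  majorant : ∀ (v : E3) (g : E3 → ℝ≥0∞), Measurable g →
    ∫⁻ p, ‖b v p‖ₑ * g (W v p) ∂ρ ≤ C * ∫⁻ w, ENNReal.ofReal (maj (w - v)) * g w

/-- The operator in the velocity variable defined by the weight `b` and the velocity map `W`. -/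
def velOp (ρ : Measure P) (b : E3 → P → ℝ) (W : E3 → P → E3) : (E3 × E3 → ℝ) → E3 × E3 → ℝ :=
  paramOp ρ (fun z p => b z.2 p) (fun z p => (z.1, W z.2 p))

theorem lintegral_maj_lt_top : ∫⁻ w, ENNReal.ofReal (maj w) < ∞ :=
  integrable_maj.lintegral_lt_top

/-- The mass of the majorant. -/
def majMass : ℝ≥0 := (∫⁻ w, ENNReal.ofReal (maj w)).toNNReal

theorem coe_majMass : (majMass : ℝ≥0∞) = ∫⁻ w, ENNReal.ofReal (maj w) :=
  ENNReal.coe_toNNReal lintegral_maj_lt_top.ne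

theorem lintegral_maj_sub (v : E3) : ∫⁻ w, ENNReal.ofReal (maj (w - v)) = majMass := by
  rw [coe_majMass, lintegral_sub_right_eq_self (fun w => ENNReal.ofReal (maj w)) v]

theorem lintegral_maj_sub' (w : E3) : ∫⁻ v, ENNReal.ofReal (maj (w - v)) = majMass := by
  rw [coe_majMass, lintegral_sub_left_eq_self (fun w => ENNReal.ofReal (maj w)) w]

theorem lintegral_lintegral_maj {g : E3 → ℝ≥0∞} (hg : Measurable g) :
    ∫⁻ v, ∫⁻ w, ENNReal.ofReal (maj (w - v)) * g w = majMass * ∫⁻ w, g w := by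
  have hmaj := measurable_maj
  rw [lintegral_lintegral_swap (by unfold Function.uncurry; fun_prop), ← lintegral_const_mul _ hg]
  refine lintegral_congr fun w => ?_
  rw [lintegral_mul_const _ (by fun_prop), lintegral_maj_sub']

variable {ρ : Measure P} {b : E3 → P → ℝ} {W : E3 → P → E3} {C : ℝ≥0}

namespace VelKernel

theorem row (h : VelKernel ρ b W C) (v : E3) : ∫⁻ p, ‖b v p‖ₑ ∂ρ ≤ (C * majMass : ℝ≥0) := by
  have := h.majorant v (fun _ => 1) measurable_const
  simpa [lintegral_maj_sub] using this

theorem lintegral_lintegral_le (h : VelKernel ρ b W C) {g : E3 → ℝ≥0∞} (hg : Measurable g) :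
    ∫⁻ v, ∫⁻ p, ‖b v p‖ₑ * g (W v p) ∂ρ ≤ (C * majMass : ℝ≥0) * ∫⁻ w, g w :=
  calc _ ≤ ∫⁻ v, C * ∫⁻ w, ENNReal.ofReal (maj (w - v)) * g w :=
        lintegral_mono fun v => h.majorant v g hg
    _ = _ := by
        rw [lintegral_const_mul' _ _ ENNReal.coe_ne_top, lintegral_lintegral_maj hg,
          ENNReal.coe_mul, mul_assoc]

/-- The majorant depends on `w - v` only, so rows and columns have the same mass. The position is a
spectator. -/
theorem schurBound [SFinite ρ] (h : VelKernel ρ b W C) :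
    SchurBound (volume : Measure (E3 × E3)) ρ (fun z p => b z.2 p) (fun z p => (z.1, W z.2 p))
      (C * majMass) where
  meas_b := h.meas_b.comp (measurable_fst.snd.prodMk measurable_snd)
  meas_Φ := measurable_fst.fst.prodMk (h.meas_W.comp (measurable_fst.snd.prodMk measurable_snd))
  row z := h.row z.2
  col g hg := by
    have hb := h.meas_b
    have hW := h.meas_W
    have m1 : Measurable fun q : (E3 × E3) × P => ‖b q.1.2 q.2‖ₑ * g (q.1.1, W q.1.2 q.2) :=
      (hb.comp (measurable_fst.snd.prodMk measurable_snd)).enorm.mul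
        (hg.comp (measurable_fst.fst.prodMk (hW.comp (measurable_fst.snd.prodMk measurable_snd))))
    rw [Measure.volume_eq_prod, lintegral_prod _ m1.lintegral_prod_right'.aemeasurable,
      lintegral_prod _ hg.aemeasurable, ← lintegral_const_mul' _ _ ENNReal.coe_ne_top]
    exact lintegral_mono fun x =>
      h.lintegral_lintegral_le (g := fun w => g (x, w)) (hg.comp measurable_prodMk_left)

theorem l2Op [SFinite ρ] (h : VelKernel ρ b W C) : L2Op volume (velOp ρ b W) := h.schurBound.l2Op

end VelKernel

end VelKernel

/-! ### The transport resolvent with unit absorption -/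

/-- The solution operator of `f + v · ∇f = h` on the whole space. -/
def raySol : (E3 × E3 → ℝ) → E3 × E3 → ℝ :=
  paramOp expLaw (fun _ _ => 1) (fun z s => (z.1 - s • z.2, z.2))

theorem lintegral_shear (g : E3 × E3 → ℝ≥0∞) (hg : Measurable g) (s : ℝ) :
    ∫⁻ z : E3 × E3, g (z.1 - s • z.2, z.2) = ∫⁻ z, g z := by
  rw [Measure.volume_eq_prod, lintegral_prod_symm _ (by fun_prop),
    lintegral_prod_symm _ (by fun_prop)]
  refine lintegral_congr fun v => ?_
  exact lintegral_sub_right_eq_self (fun x => g (x, v)) (s • v)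

theorem raySol_schurBound : SchurBound (volume : Measure (E3 × E3)) expLaw (fun _ _ => 1)
    (fun z s => (z.1 - s • z.2, z.2)) 1 where
  meas_b := measurable_const
  meas_Φ := by unfold Function.uncurry; fun_prop
  row z := by simp
  col g hg := by
    have m1 : Measurable fun q : (E3 × E3) × ℝ => g (q.1.1 - q.2 • q.1.2, q.1.2) := by fun_prop
    simp only [enorm_one, one_mul, ENNReal.coe_one]
    rw [lintegral_lintegral_swap m1.aemeasurable]
    simp_rw [lintegral_shear g hg]
    simp

theorem raySol_l2Op : L2Op volume raySol := raySol_schurBound.l2Op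

/-! ### Velocity averaging -/

section Averaging

variable {P : Type*} [MeasurableSpace P] {ρ : Measure P} [SFinite ρ] {b : E3 → P → ℝ}
  {W : E3 → P → E3} {C : ℝ≥0}

theorem integral_iterate (H : E3 × E3 × P × ℝ → ℝ)
    (hH : Integrable H ((volume : Measure E3).prod ((volume : Measure E3).prod (ρ.prod expLaw)))) :
    ∫ q, H q ∂((volume : Measure E3).prod ((volume : Measure E3).prod (ρ.prod expLaw))) =
      ∫ x, ∫ v, ∫ p, ∫ s, H (x, v, p, s) ∂expLaw ∂ρ := by
  rw [integral_prod _ hH]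
  refine integral_congr_ae ?_
  filter_upwards [hH.prod_right_ae] with x hx
  rw [integral_prod _ hx]
  refine integral_congr_ae ?_
  filter_upwards [hx.prod_right_ae] with v hv
  rw [integral_prod _ hv]

theorem enorm_mul_le_sq (x y : ℝ) : ‖x * y‖ₑ ≤ ‖x‖ₑ ^ 2 + ‖y‖ₑ ^ 2 := by
  rw [enorm_mul]
  rcases le_total ‖x‖ₑ ‖y‖ₑ with h | h
  · calc _ ≤ ‖y‖ₑ * ‖y‖ₑ := by gcongr
      _ ≤ _ := by rw [← pow_two]; exact le_add_self
  · calc _ ≤ ‖x‖ₑ * ‖x‖ₑ := by gcongr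
      _ ≤ _ := by rw [← pow_two]; exact le_self_add

/-- The parameters `c`, `d` let one statement justify Fubini on both sides of the duality: `(0, -1)`
has the transport on `h`, `(1, 0)` has it on `G`. After the bound `|G h| ≤ G² + h²`, the integral in
`x` removes all shifts, and only the row and column bounds in velocity remain. -/
theorem integrable_pairing (hk : VelKernel ρ b W C) {G h : E3 × E3 → ℝ} (hGm : Measurable G)
    (hhm : Measurable h) (hG : MemLp G 2) (hh : MemLp h 2) (c d : ℝ) :
    Integrable (fun q : E3 × E3 × P × ℝ =>
      b q.2.1 q.2.2.1 * (G (q.1 + (c * q.2.2.2) • W q.2.1 q.2.2.1, q.2.1) *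
        h (q.1 + (d * q.2.2.2) • W q.2.1 q.2.2.1, W q.2.1 q.2.2.1)))
      ((volume : Measure E3).prod ((volume : Measure E3).prod (ρ.prod expLaw))) := by
  have hb : Measurable fun q : E3 × E3 × P × ℝ => b q.2.1 q.2.2.1 :=
    hk.meas_b.comp (measurable_snd.fst.prodMk measurable_snd.snd.fst)
  have hW : Measurable fun q : E3 × E3 × P × ℝ => W q.2.1 q.2.2.1 :=
    hk.meas_W.comp (measurable_snd.fst.prodMk measurable_snd.snd.fst)
  have hb1 : Measurable fun q : E3 × P => b q.1 q.2 := hk.meas_b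
  have hW1 : Measurable fun q : E3 × P => W q.1 q.2 := hk.meas_W
  have hm : Measurable (fun q : E3 × E3 × P × ℝ =>
      b q.2.1 q.2.2.1 * (G (q.1 + (c * q.2.2.2) • W q.2.1 q.2.2.1, q.2.1) *
        h (q.1 + (d * q.2.2.2) • W q.2.1 q.2.2.1, W q.2.1 q.2.2.1))) := by fun_prop
  refine ⟨hm.aestronglyMeasurable, ?_⟩
  rw [hasFiniteIntegral_iff_enorm, lintegral_prod_symm _ hm.enorm.aemeasurable]
  set g₁ : E3 → ℝ≥0∞ := fun v => ∫⁻ x, ‖G (x, v)‖ₑ ^ 2 with hg₁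
  set g₂ : E3 → ℝ≥0∞ := fun v => ∫⁻ x, ‖h (x, v)‖ₑ ^ 2 with hg₂
  have mg₁ : Measurable g₁ := (hGm.enorm.pow_const 2).lintegral_prod_left'
  have mg₂ : Measurable g₂ := (hhm.enorm.pow_const 2).lintegral_prod_left'
  have e₁ : ∫⁻ v, g₁ v = ∫⁻ z, ‖G z‖ₑ ^ 2 := by
    rw [Measure.volume_eq_prod, lintegral_prod_symm _ (hGm.enorm.pow_const 2).aemeasurable]
  have e₂ : ∫⁻ v, g₂ v = ∫⁻ z, ‖h z‖ₑ ^ 2 := by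
    rw [Measure.volume_eq_prod, lintegral_prod_symm _ (hhm.enorm.pow_const 2).aemeasurable]
  have key : ∀ q : E3 × P × ℝ, (∫⁻ x, ‖b q.1 q.2.1 * (G (x + (c * q.2.2) • W q.1 q.2.1, q.1) *
      h (x + (d * q.2.2) • W q.1 q.2.1, W q.1 q.2.1))‖ₑ) ≤
      ‖b q.1 q.2.1‖ₑ * (g₁ q.1 + g₂ (W q.1 q.2.1)) := by
    intro q
    calc _ ≤ ∫⁻ x, ‖b q.1 q.2.1‖ₑ * (‖G (x + (c * q.2.2) • W q.1 q.2.1, q.1)‖ₑ ^ 2 +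
          ‖h (x + (d * q.2.2) • W q.1 q.2.1, W q.1 q.2.1)‖ₑ ^ 2) := by
          refine lintegral_mono fun x => ?_
          rw [enorm_mul]
          gcongr
          exact enorm_mul_le_sq _ _
      _ = _ := by
          rw [lintegral_const_mul' _ _ enorm_ne_top, lintegral_add_left (by fun_prop)]
          congr 2
          · exact lintegral_add_right_eq_self (fun x => ‖G (x, q.1)‖ₑ ^ 2) _
          · exact lintegral_add_right_eq_self (fun x => ‖h (x, W q.1 q.2.1)‖ₑ ^ 2) _
  have m3 : Measurable fun q : E3 × P × ℝ => ‖b q.1 q.2.1‖ₑ * (g₁ q.1 + g₂ (W q.1 q.2.1)) := by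
    have : Measurable fun q : E3 × P × ℝ => b q.1 q.2.1 :=
      hb1.comp (measurable_fst.prodMk measurable_snd.fst)
    have : Measurable fun q : E3 × P × ℝ => W q.1 q.2.1 :=
      hW1.comp (measurable_fst.prodMk measurable_snd.fst)
    fun_prop
  calc _ ≤ ∫⁻ q, ‖b q.1 q.2.1‖ₑ * (g₁ q.1 + g₂ (W q.1 q.2.1))
        ∂((volume : Measure E3).prod (ρ.prod expLaw)) := lintegral_mono key
    _ = ∫⁻ v, ∫⁻ p, ‖b v p‖ₑ * (g₁ v + g₂ (W v p)) ∂ρ := by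
        rw [lintegral_prod _ m3.aemeasurable]
        refine lintegral_congr fun v => ?_
        refine (lintegral_prod _ (m3.comp measurable_prodMk_left).aemeasurable).trans ?_
        simp
    _ = (∫⁻ v, ∫⁻ p, ‖b v p‖ₑ * g₁ v ∂ρ) + ∫⁻ v, ∫⁻ p, ‖b v p‖ₑ * g₂ (W v p) ∂ρ := by
        have k1 : Measurable fun q : E3 × P => ‖b q.1 q.2‖ₑ * g₁ q.1 := by fun_prop
        simp_rw [mul_add]
        rw [← lintegral_add_left k1.lintegral_prod_right']
        refine lintegral_congr fun v => ?_
        exact lintegral_add_left (k1.comp measurable_prodMk_left) _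
    _ ≤ (C * majMass : ℝ≥0) * (∫⁻ v, g₁ v) + (C * majMass : ℝ≥0) * ∫⁻ v, g₂ v := by
        refine add_le_add ?_ (hk.lintegral_lintegral_le mg₂)
        rw [← lintegral_const_mul _ mg₁]
        refine lintegral_mono fun v => ?_
        refine (lintegral_mul_const _ (hb1.comp measurable_prodMk_left).enorm).trans_le ?_
        gcongr
        exact hk.row v
    _ < ∞ := by
        rw [e₁, e₂]
        exact ENNReal.add_lt_top.2 ⟨ENNReal.mul_lt_top ENNReal.coe_lt_top (lintegral_sq_lt_top hG),
          ENNReal.mul_lt_top ENNReal.coe_lt_top (lintegral_sq_lt_top hh)⟩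

/-- Duality for the operator `velOp ∘ raySol`. -/
theorem integral_mul_velOp_raySol (hk : VelKernel ρ b W C) {G h : E3 × E3 → ℝ}
    (hGm : Measurable G) (hhm : Measurable h) (hG : MemLp G 2) (hh : MemLp h 2) :
    ∫ z, G z * velOp ρ b W (raySol h) z =
      ∫ x, ∫ v, ∫ p, b v p * (h (x, W v p) * rayMean (fun y => G (y, v)) (W v p) x) ∂ρ := by
  have I1 := integrable_pairing hk hGm hhm hG hh 0 (-1)
  have I2 := integrable_pairing hk hGm hhm hG hh 1 0
  have e1 := integral_iterate _ I1
  have e2 := integral_iterate _ I2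
  have hmem := hk.l2Op.memLp (raySol_l2Op.memLp hh)
  rw [Measure.volume_eq_prod, integral_prod _ (by
    rw [← Measure.volume_eq_prod]; exact hG.integrable_mul hmem)]
  simp only [zero_mul, zero_smul, add_zero, one_mul, neg_mul, neg_smul] at e1 e2 I1 I2
  have l1 : ∀ x v, G (x, v) * velOp ρ b W (raySol h) (x, v) =
      ∫ p, ∫ s, b v p * (G (x, v) * h (x + -(s • W v p), W v p)) ∂expLaw ∂ρ := by
    intro x v
    simp only [velOp, paramOp, raySol, one_mul]
    rw [← integral_const_mul]
    refine integral_congr_ae (Eventually.of_forall fun p => ?_)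
    simp only
    rw [integral_const_mul, integral_const_mul]
    simp only [sub_eq_add_neg]
    ring
  have l2 : ∀ x v p, b v p * (h (x, W v p) * rayMean (fun y => G (y, v)) (W v p) x) =
      ∫ s, b v p * (G (x + s • W v p, v) * h (x, W v p)) ∂expLaw := by
    intro x v p
    rw [integral_const_mul, integral_mul_const, rayMean, mul_comm (h _)]
  simp_rw [l1, l2]
  rw [← e1, ← e2, integral_prod_symm _ I1, integral_prod_symm _ I2]
  refine integral_congr_ae (Eventually.of_forall fun q => ?_)
  simp only
  -- Translating `x` by `s • W`, with the velocities and the time frozen, carries the transport from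
  -- `h` to `G`.
  rw [← integral_add_right_eq_self _ (q.2.2 • W q.1 q.2.1)]
  simp

/-- Cauchy–Schwarz for the measure `|b| dρ dv dx`. The factor with `h` is absorbed by the column
bound; the other keeps its weight `|b|`, so that the majorant can still be applied for each fixed
`v`. -/
theorem enorm_integral_mul_velOp_raySol_le (hk : VelKernel ρ b W C) {G h : E3 × E3 → ℝ}
    (hGm : Measurable G) (hhm : Measurable h) (hG : MemLp G 2) (hh : MemLp h 2) :
    ‖∫ z, G z * velOp ρ b W (raySol h) z‖ₑ ^ 2 ≤
      ((C * majMass : ℝ≥0) * ∫⁻ z, ‖h z‖ₑ ^ 2) *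
      ∫⁻ v, ∫⁻ p, ‖b v p‖ₑ * (∫⁻ x, ‖rayMean (fun y => G (y, v)) (W v p) x‖ₑ ^ 2) ∂ρ := by
  set R : E3 → E3 → E3 → ℝ := fun v w x => rayMean (fun y => G (y, v)) w x with hR
  have hRm : Measurable fun q : E3 × E3 × E3 => R q.1 q.2.1 q.2.2 := by
    have : Measurable fun q : (E3 × E3 × E3) × ℝ => G (q.1.2.2 + q.2 • q.1.2.1, q.1.1) := by
      fun_prop
    exact this.stronglyMeasurable.integral_prod_right'.measurable
  have hb1 : Measurable fun q : E3 × P => b q.1 q.2 := hk.meas_b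
  have hW1 : Measurable fun q : E3 × P => W q.1 q.2 := hk.meas_W
  have hb : Measurable fun q : E3 × E3 × P => b q.2.1 q.2.2 := hb1.comp measurable_snd
  have hW : Measurable fun q : E3 × E3 × P => W q.2.1 q.2.2 := hW1.comp measurable_snd
  have hRW : Measurable fun q : E3 × E3 × P => R q.2.1 (W q.2.1 q.2.2) q.1 :=
    hRm.comp (measurable_snd.fst.prodMk (hW.prodMk measurable_fst))
  have hhW : Measurable fun q : E3 × E3 × P => h (q.1, W q.2.1 q.2.2) :=
    hhm.comp (measurable_fst.prodMk hW)
  set m := (volume : Measure E3).prod ((volume : Measure E3).prod ρ) with hm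
  have mA : Measurable fun q : E3 × E3 × P =>
    ‖b q.2.1 q.2.2‖ₑ * ‖h (q.1, W q.2.1 q.2.2)‖ₑ ^ 2 := hb.enorm.mul (hhW.enorm.pow_const 2)
  have mB : Measurable fun q : E3 × E3 × P =>
    ‖b q.2.1 q.2.2‖ₑ * ‖R q.2.1 (W q.2.1 q.2.2) q.1‖ₑ ^ 2 :=
    hb.enorm.mul (hRW.enorm.pow_const 2)
  have mC : Measurable fun q : E3 × E3 × P => ‖b q.2.1 q.2.2 *
      (h (q.1, W q.2.1 q.2.2) * R q.2.1 (W q.2.1 q.2.2) q.1)‖ₑ := (hb.mul (hhW.mul hRW)).enorm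
  have s1 : ‖∫ z, G z * velOp ρ b W (raySol h) z‖ₑ ≤ ∫⁻ q, ‖b q.2.1 q.2.2 *
      (h (q.1, W q.2.1 q.2.2) * R q.2.1 (W q.2.1 q.2.2) q.1)‖ₑ ∂m := by
    rw [integral_mul_velOp_raySol hk hGm hhm hG hh, hm, lintegral_prod _ mC.aemeasurable]
    refine (enorm_integral_le_lintegral_enorm _).trans (lintegral_mono fun x => ?_)
    refine le_trans ?_ (lintegral_prod _ (mC.comp measurable_prodMk_left).aemeasurable).ge
    refine (enorm_integral_le_lintegral_enorm _).trans (lintegral_mono fun v => ?_)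
    exact enorm_integral_le_lintegral_enorm _
  have hH := ENNReal.lintegral_mul_le_Lp_mul_Lq m Real.HolderConjugate.two_two
    (f := fun q => ‖b q.2.1 q.2.2‖ₑ ^ (1 / 2 : ℝ) * ‖h (q.1, W q.2.1 q.2.2)‖ₑ)
    (g := fun q => ‖b q.2.1 q.2.2‖ₑ ^ (1 / 2 : ℝ) * ‖R q.2.1 (W q.2.1 q.2.2) q.1‖ₑ)
    ((hb.enorm.pow_const _).mul hhW.enorm).aemeasurable
    ((hb.enorm.pow_const _).mul hRW.enorm).aemeasurable
  have e1 : ∀ a : ℝ≥0∞, a ^ (1 / 2 : ℝ) * a ^ (1 / 2 : ℝ) = a := fun a => by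
    rw [← ENNReal.rpow_add_of_nonneg _ _ (by norm_num) (by norm_num)]; norm_num
  have e2 : ∀ a : ℝ≥0∞, (a ^ (1 / 2 : ℝ)) ^ (2 : ℝ) = a := fun a => by
    rw [← ENNReal.rpow_mul]; norm_num
  have e3 : ∀ a : ℝ≥0∞, (a ^ (1 / 2 : ℝ)) ^ 2 = a := fun a => by rw [pow_two, e1]
  have e4 : ∀ a x y : ℝ≥0∞, a ^ (1 / 2 : ℝ) * x * (a ^ (1 / 2 : ℝ) * y) = a * (x * y) :=
    fun a x y => by
      calc _ = (a ^ (1 / 2 : ℝ) * a ^ (1 / 2 : ℝ)) * (x * y) := by ring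
        _ = _ := by rw [e1]
  simp only [Pi.mul_apply, e2, e4, ENNReal.mul_rpow_of_nonneg _ _ zero_le_two,
    ENNReal.rpow_ofNat] at hH
  have s2 : ∫⁻ q, ‖b q.2.1 q.2.2‖ₑ * ‖h (q.1, W q.2.1 q.2.2)‖ₑ ^ 2 ∂m ≤
      (C * majMass : ℝ≥0) * ∫⁻ z, ‖h z‖ₑ ^ 2 := by
    rw [hm, lintegral_prod _ mA.aemeasurable, Measure.volume_eq_prod,
      lintegral_prod _ (hhm.enorm.pow_const 2).aemeasurable,
      ← lintegral_const_mul' _ _ ENNReal.coe_ne_top]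
    refine lintegral_mono fun x => ?_
    refine (lintegral_prod _ (mA.comp measurable_prodMk_left).aemeasurable).trans_le ?_
    exact hk.lintegral_lintegral_le (g := fun w => ‖h (x, w)‖ₑ ^ 2) (by fun_prop)
  have s3 : ∫⁻ q, ‖b q.2.1 q.2.2‖ₑ * ‖R q.2.1 (W q.2.1 q.2.2) q.1‖ₑ ^ 2 ∂m =
      ∫⁻ v, ∫⁻ p, ‖b v p‖ₑ * (∫⁻ x, ‖R v (W v p) x‖ₑ ^ 2) ∂ρ := by
    rw [hm, lintegral_prod_symm _ mB.aemeasurable, lintegral_prod _ mB.lintegral_prod_left'.aemeasurable]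
    refine lintegral_congr fun v => lintegral_congr fun p => ?_
    exact lintegral_const_mul' ‖b v p‖ₑ _ enorm_ne_top
  calc _ ≤ (∫⁻ q, ‖b q.2.1 q.2.2 *
      (h (q.1, W q.2.1 q.2.2) * R q.2.1 (W q.2.1 q.2.2) q.1)‖ₑ ∂m) ^ 2 := by gcongr
    _ ≤ _ := by
      simp only [enorm_mul]
      refine (pow_le_pow_left' hH 2).trans ?_
      rw [mul_pow, e3, e3, s3]
      gcongr

/-- The velocity averaging lemma: averages in velocity of solutions of the transport equation
have Hölder regularity of every order less than `1/2` in `L²`. -/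
theorem exists_eLpNorm_diffX_velOp_raySol_le (hk : VelKernel ρ b W C) {θ : ℝ} (hθ0 : 0 ≤ θ)
    (hθ1 : θ < 1) :
    ∃ D : ℝ≥0, ∀ h : E3 × E3 → ℝ, MemLp h 2 → ∀ a : E3,
      eLpNorm (diffX a (velOp ρ b W (raySol h))) 2 volume ≤
        D * ENNReal.ofReal (‖a‖ ^ (θ / 2)) * eLpNorm h 2 volume := by
  obtain ⟨Q, hQ⟩ := exists_lintegral_maj_rayMean_le hθ0 hθ1
  have main : ∀ h : E3 × E3 → ℝ, Measurable h → MemLp h 2 → ∀ a : E3,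
      ∫⁻ z, ‖diffX a (velOp ρ b W (raySol h)) z‖ₑ ^ 2 ≤
        ((C * majMass : ℝ≥0) * (C * Q * ENNReal.ofReal (‖a‖ ^ θ))) * ∫⁻ z, ‖h z‖ₑ ^ 2 := by
    intro h hhm hh a
    set F := velOp ρ b W (raySol h) with hF
    have hFm : Measurable F :=
      hk.schurBound.measurable_paramOp (raySol_schurBound.measurable_paramOp hhm)
    have hFL : MemLp F 2 := hk.l2Op.memLp (raySol_l2Op.memLp hh)
    set U := diffX a F with hU
    have hUm : Measurable U := measurable_diffX hFm a
    have hUL : MemLp U 2 := memLp_diffX hFL a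
    -- `diffX (-a)` is the adjoint of `diffX a`, so the squared norm of `U = diffX a F` equals the
    -- pairing of `G` with `F`.
    set G := diffX (-a) U with hG
    have hGm : Measurable G := measurable_diffX hUm _
    have hGL : MemLp G 2 := memLp_diffX hUL _
    set N := ∫⁻ z, ‖U z‖ₑ ^ 2 with hN
    have hNtop : N < ∞ := lintegral_sq_lt_top hUL
    have e1 : ∫ z, U z ^ 2 = ∫ z, G z * F z := by
      have i1 : Integrable fun z => U z * shiftX a F z := hUL.integrable_mul (memLp_shiftX hFL a)
      have i2 : Integrable fun z => U z * F z := hUL.integrable_mul hFL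
      have i3 : Integrable fun z => shiftX (-a) U z * F z :=
        (memLp_shiftX hUL (-a)).integrable_mul hFL
      have e : ∫ z, U z * shiftX a F z = ∫ z, shiftX (-a) U z * F z := by
        rw [← (measurePreserving_shiftX a).integral_comp'
          (f := (MeasurableEquiv.addRight a).prodCongr (MeasurableEquiv.refl E3))
          (fun z => shiftX (-a) U z * F z)]
        refine integral_congr_ae (Eventually.of_forall fun z => ?_)
        have : ((MeasurableEquiv.addRight a).prodCongr (MeasurableEquiv.refl E3)) z =
          (z.1 + a, z.2) := rfl
        simp [shiftX, this]
      calc ∫ z, U z ^ 2 = ∫ z, (U z * shiftX a F z - U z * F z) := by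
            refine integral_congr_ae (Eventually.of_forall fun z => ?_)
            simp only [hU, diffX, Pi.sub_apply]; ring
        _ = ∫ z, (shiftX (-a) U z * F z - U z * F z) := by
            rw [integral_sub i1 i2, e, integral_sub i3 i2]
        _ = _ := by
            refine integral_congr_ae (Eventually.of_forall fun z => ?_)
            simp only [hG, diffX, Pi.sub_apply]; ring
    have e2 : N = ‖∫ z, G z * F z‖ₑ := by
      rw [← e1, Real.enorm_of_nonneg (integral_nonneg fun z => sq_nonneg _),
        ofReal_integral_eq_lintegral_ofReal hUL.integrable_sq
          (Eventually.of_forall fun z => sq_nonneg _)]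
      refine lintegral_congr fun z => ?_
      rw [← sq_abs, ENNReal.ofReal_pow (abs_nonneg _), ← Real.norm_eq_abs, ofReal_norm]
    have hGv : ∀ v, (fun y => G (y, v)) = fun y => U (y - a, v) - U (y, v) := by
      intro v
      ext y
      simp [hG, diffX, shiftX, sub_eq_add_neg]
    -- For frozen `v` the function `G(·, v)` is a difference of `U(·, v)`, so the ray-mean estimate
    -- returns `‖U(·, v)‖²` times `‖a‖ ^ θ`. The difference already inside `U` is not used again.
    have e3 : ∫⁻ v, ∫⁻ p, ‖b v p‖ₑ * (∫⁻ x, ‖rayMean (fun y => G (y, v)) (W v p) x‖ₑ ^ 2) ∂ρ ≤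
        (C * Q * ENNReal.ofReal (‖a‖ ^ θ)) * N := by
      have hUv : ∀ᵐ v : E3, MemLp (fun y => U (y, v)) 2 := by
        have hs := hUL.integrable_sq
        rw [Measure.volume_eq_prod] at hs
        filter_upwards [hs.prod_left_ae] with v hv
        exact (memLp_two_iff_integrable_sq
          (hUm.comp measurable_prodMk_right).aestronglyMeasurable).2 hv
      have hNe : N = ∫⁻ v, ∫⁻ x, ‖U (x, v)‖ₑ ^ 2 := by
        rw [hN, Measure.volume_eq_prod, lintegral_prod_symm _ (by fun_prop)]
      rw [hNe, ← lintegral_const_mul' _ _ (by finiteness)]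
      refine lintegral_mono_ae ?_
      filter_upwards [hUv] with v hv
      have hgm : Measurable fun w => ∫⁻ x, ‖rayMean (fun y => G (y, v)) w x‖ₑ ^ 2 := by
        have m1 : Measurable fun q : (E3 × E3) × ℝ => G (q.1.2 + q.2 • q.1.1, v) := by fun_prop
        exact (m1.stronglyMeasurable.integral_prod_right'.measurable.enorm.pow_const
          2).lintegral_prod_right'
      refine (hk.majorant v _ hgm).trans ?_
      rw [hGv v, mul_assoc, mul_assoc]
      gcongr
      rw [← mul_assoc]
      exact hQ (fun y => U (y, v)) (by fun_prop) hv a v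
    have e4 : N ^ 2 ≤ ((C * majMass : ℝ≥0) * ∫⁻ z, ‖h z‖ₑ ^ 2) *
        ((C * Q * ENNReal.ofReal (‖a‖ ^ θ)) * N) := by
      rw [e2, ← e2]
      nth_rewrite 1 [e2]
      exact (enorm_integral_mul_velOp_raySol_le hk hGm hhm hGL hh).trans (by gcongr)
    -- `N = ‖U‖²` occurs squared on the left and once on the right. Being finite it can be
    -- cancelled, and the gain is `θ` for the squared norm, hence `θ / 2` for the norm.
    by_cases hN0 : N = 0
    · rw [hN0]; exact zero_le
    · have : N * N ≤ (((C * majMass : ℝ≥0) * (C * Q * ENNReal.ofReal (‖a‖ ^ θ))) *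
          ∫⁻ z, ‖h z‖ₑ ^ 2) * N := by
        rw [← pow_two]
        refine e4.trans (le_of_eq ?_)
        ring
      exact (ENNReal.mul_le_mul_iff_left hN0 hNtop.ne).1 this
  set D := NNReal.sqrt (C * majMass * (C * Q)) with hD
  have hop : L2Op volume fun h => velOp ρ b W (raySol h) := hk.l2Op.comp raySol_l2Op
  refine ⟨D, fun h hh a => ?_⟩
  obtain ⟨h', hm, e⟩ : ∃ h', Measurable h' ∧ h =ᵐ[volume] h' :=
    ⟨_, hh.1.aemeasurable.measurable_mk, hh.1.aemeasurable.ae_eq_mk⟩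
  rw [eLpNorm_congr_ae (diffX_congr (hop.congr _ _ hh e) a), eLpNorm_congr_ae e]
  refine eLpNorm_two_le_iff.2 ((main _ hm (hh.ae_eq e) a).trans (le_of_eq ?_))
  congr 1
  rw [mul_pow, ← ENNReal.coe_pow, hD, NNReal.sq_sqrt, ← ENNReal.ofReal_pow (by positivity),
    ← Real.rpow_natCast, ← Real.rpow_mul (norm_nonneg _)]
  norm_num
  ring

end Averaging

/-! ### Orthonormal and spherical coordinates in `E3` -/

/-- The point with coordinates `(x, y, z)` in the frame `a`. -/
def frameSum (a : Fin 3 → E3) (x y z : ℝ) : E3 := x • a 0 + y • a 1 + z • a 2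

theorem lintegral_frameSum {a : Fin 3 → E3} (ha : Orthonormal ℝ a) {F : E3 → ℝ≥0∞}
    (hF : Measurable F) :
    ∫⁻ V, F V = ∫⁻ x : ℝ, ∫⁻ q : ℝ × ℝ, F (frameSum a x q.1 q.2) := by
  have hcard : Fintype.card (Fin 3) = Module.finrank ℝ E3 := by simp
  set bs := OrthonormalBasis.mk ha
    (by rw [ha.linearIndependent.span_eq_top_of_card_eq_finrank hcard]) with hbs
  have m1 : MeasurePreserving fun u : Fin 3 → ℝ => bs.repr.symm (WithLp.toLp 2 u) :=
    bs.measurePreserving_repr_symm.comp (PiLp.volume_preserving_toLp (Fin 3))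
  have m2 := (volume_preserving_piFinSuccAbove (fun _ : Fin 3 => ℝ) 0).symm
  have m3 := (volume_preserving_finTwoArrow ℝ).symm
  have m4 := (MeasurePreserving.id (volume : Measure ℝ)).prod m3
  have m5 := (m1.comp m2).comp m4
  have e : ∀ q : ℝ × ℝ × ℝ, ((fun u : Fin 3 → ℝ => bs.repr.symm (WithLp.toLp 2 u)) ∘
      (MeasurableEquiv.piFinSuccAbove (fun _ : Fin 3 => ℝ) 0).symm) 
      (Prod.map id (MeasurableEquiv.finTwoArrow (α := ℝ)).symm q) =
        frameSum a q.1 q.2.1 q.2.2 := by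
    rintro ⟨x, y, z⟩
    simp only [Function.comp_apply, Prod.map_apply, id]
    have h1 : (MeasurableEquiv.piFinSuccAbove (fun _ : Fin 3 => ℝ) 0).symm
        (x, (MeasurableEquiv.finTwoArrow (α := ℝ)).symm (y, z)) = ![x, y, z] := by
      ext i
      fin_cases i <;> rfl
    rw [h1, ← bs.sum_repr (bs.repr.symm _), Fin.sum_univ_three]
    simp [frameSum, hbs]
  have hm : Measurable fun q : ℝ × ℝ × ℝ => F (frameSum a q.1 q.2.1 q.2.2) := by
    unfold frameSum; fun_prop
  rw [← lintegral_prod _ hm.aemeasurable, ← m5.lintegral_comp hF]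
  exact lintegral_congr fun q => congrArg F (e q)

theorem lintegral_polar {F : E3 → ℝ≥0∞} (hF : Measurable F) :
    ∫⁻ V, F V = ∫⁻ α : Metric.sphere (0 : E3) 1, ∫⁻ r in Ioi (0 : ℝ),
      ENNReal.ofReal (r ^ 2) * F (r • (α : E3)) ∂volume ∂(volume : Measure E3).toSphere := by
  have hd : Module.finrank ℝ E3 - 1 = 2 := by simp
  have mp := (volume : Measure E3).measurePreserving_homeomorphUnitSphereProd
  rw [hd] at mp
  have hm : Measurable fun q : Metric.sphere (0 : E3) 1 × Ioi (0 : ℝ) =>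
      F ((q.2 : ℝ) • (q.1 : E3)) := by fun_prop
  calc ∫⁻ V, F V = ∫⁻ V : ({(0 : E3)}ᶜ : Set E3), F V ∂((volume : Measure E3).comap (↑)) := by
        rw [lintegral_subtype_comap (measurableSet_singleton _).compl F, restrict_compl_singleton]
    _ = ∫⁻ q : Metric.sphere (0 : E3) 1 × Ioi (0 : ℝ), F ((q.2 : ℝ) • (q.1 : E3))
          ∂((volume : Measure E3).toSphere.prod (Measure.volumeIoiPow 2)) := by
        rw [← mp.lintegral_comp hm]
        refine lintegral_congr fun V => ?_
        congr 1
        have hV : ‖(V : E3)‖ ≠ 0 := norm_ne_zero_iff.2 V.2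
        simp [smul_smul, hV]
    _ = _ := by
        rw [lintegral_prod _ hm.aemeasurable]
        refine lintegral_congr fun α => ?_
        rw [Measure.volumeIoiPow, lintegral_withDensity_eq_lintegral_mul_non_measurable _
          (by fun_prop) (by simp)]
        exact lintegral_subtype_comap measurableSet_Ioi
          (fun r : ℝ => ENNReal.ofReal (r ^ 2) * F (r • (α : E3)))

/-- The unit vector with polar angle `θ` and azimuth `ε` in the frame `a`. -/
def frameDir (a : Fin 3 → E3) (ε θ : ℝ) : E3 :=
  frameSum a (Real.cos θ) (Real.sin θ * Real.cos ε) (Real.sin θ * Real.sin ε)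

theorem norm_frameSum_sq {a : Fin 3 → E3} (ha : Orthonormal ℝ a) (x y z : ℝ) :
    ‖frameSum a x y z‖ ^ 2 = x ^ 2 + y ^ 2 + z ^ 2 := by
  have h := orthonormal_iff_ite.1 ha
  rw [← real_inner_self_eq_norm_sq]
  simp only [frameSum, inner_add_left, inner_add_right, real_inner_smul_left,
    real_inner_smul_right, h]
  simp
  ring

theorem inner_frameSum {a : Fin 3 → E3} (ha : Orthonormal ℝ a) (x y z : ℝ) :
    inner ℝ (a 0) (frameSum a x y z) = x := by
  have h := orthonormal_iff_ite.1 ha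
  simp [frameSum, inner_add_right, real_inner_smul_right, h, ha.1 0]

theorem norm_frameDir {a : Fin 3 → E3} (ha : Orthonormal ℝ a) (ε θ : ℝ) :
    ‖frameDir a ε θ‖ = 1 := by
  have h : ‖frameDir a ε θ‖ ^ 2 = 1 := by
    rw [frameDir, norm_frameSum_sq ha]
    nlinarith [Real.sin_sq_add_cos_sq θ, Real.sin_sq_add_cos_sq ε]
  exact (pow_eq_one_iff_of_nonneg (norm_nonneg _) two_ne_zero).1 h

/-- Spherical coordinates as two successive planar polar changes: first in the plane of the last two
coordinates, with radius `ρ`, then in the half-plane of the axis and `ρ`. The Jacobians multiply to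
`ρ r = r² sin θ`. Inequality suffices, since only the hemisphere `θ < π/2` is kept. -/
theorem lintegral_spherical_le {a : Fin 3 → E3} (ha : Orthonormal ℝ a) {F : E3 → ℝ≥0∞}
    (hF : Measurable F) :
    ∫⁻ ε in Ioo (-Real.pi) Real.pi, ∫⁻ r in Ioi (0 : ℝ), ∫⁻ θ in Ioo 0 (Real.pi / 2),
      ENNReal.ofReal (r ^ 2 * Real.sin θ) * F (r • frameDir a ε θ) ≤ ∫⁻ V, F V := by
  rw [lintegral_frameSum ha hF]
  have hm : Measurable fun q : ℝ × ℝ × ℝ => F (frameSum a q.1 q.2.1 q.2.2) := by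
    unfold frameSum; fun_prop
  have hm1 : Measurable fun q : ℝ × ℝ × ℝ => ENNReal.ofReal q.2.1 *
      F (frameSum a q.1 (q.2.1 * Real.cos q.2.2) (q.2.1 * Real.sin q.2.2)) := by
    have : Measurable fun q : ℝ × ℝ × ℝ => (q.1, q.2.1 * Real.cos q.2.2, q.2.1 * Real.sin q.2.2) := by
      fun_prop
    exact Measurable.mul (by fun_prop) (hm.comp this)
  have e1 : ∀ x : ℝ, ∫⁻ q : ℝ × ℝ, F (frameSum a x q.1 q.2) =
      ∫⁻ ε in Ioo (-Real.pi) Real.pi, ∫⁻ ρ in Ioi (0 : ℝ), ENNReal.ofReal ρ *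
        F (frameSum a x (ρ * Real.cos ε) (ρ * Real.sin ε)) := by
    intro x
    rw [← lintegral_comp_polarCoord_symm]
    simp only [polarCoord_target, polarCoord_symm_apply, smul_eq_mul]
    rw [Measure.volume_eq_prod, ← Measure.prod_restrict]
    exact lintegral_prod_symm _ (hm1.comp measurable_prodMk_left).aemeasurable
  simp_rw [e1]
  have hm2 : Measurable fun q : (ℝ × ℝ) × ℝ => ENNReal.ofReal q.2 *
      F (frameSum a q.1.1 (q.2 * Real.cos q.1.2) (q.2 * Real.sin q.1.2)) := by
    have : Measurable fun q : (ℝ × ℝ) × ℝ => (q.1.1, q.2, q.1.2) := by fun_prop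
    exact hm1.comp this
  refine le_trans ?_ (lintegral_lintegral_swap hm2.lintegral_prod_right'.aemeasurable).ge
  refine lintegral_mono fun ε => ?_
  have hm3 : Measurable fun q : ℝ × ℝ => (Ioi (0 : ℝ)).indicator (fun ρ => ENNReal.ofReal ρ *
      F (frameSum a q.1 (ρ * Real.cos ε) (ρ * Real.sin ε))) q.2 := by
    have h1 : Measurable fun q : ℝ × ℝ => ENNReal.ofReal q.2 *
        F (frameSum a q.1 (q.2 * Real.cos ε) (q.2 * Real.sin ε)) := by
      have : Measurable fun q : ℝ × ℝ => (q.1, q.2, ε) := by fun_prop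
      exact hm1.comp this
    exact h1.indicator (measurableSet_Ioi.preimage measurable_snd)
  simp_rw [← lintegral_indicator measurableSet_Ioi]
  rw [← lintegral_prod _ hm3.aemeasurable, ← Measure.volume_eq_prod,
    ← lintegral_comp_polarCoord_symm]
  simp only [polarCoord_target, polarCoord_symm_apply, smul_eq_mul]
  rw [Measure.volume_eq_prod, ← Measure.prod_restrict, lintegral_prod]
  · rw [← lintegral_indicator measurableSet_Ioi]
    refine lintegral_mono fun r => ?_
    by_cases hr : r ∈ Ioi (0 : ℝ)
    · have hr' : 0 < r := hr
      simp only [indicator_of_mem hr]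
      have hsub : Ioo 0 (Real.pi / 2) ⊆ Ioo (-Real.pi) Real.pi :=
        Ioo_subset_Ioo (by linarith [Real.pi_pos]) (by linarith [Real.pi_pos])
      refine le_trans ?_ (lintegral_mono_set hsub)
      refine setLIntegral_mono' measurableSet_Ioo fun θ hθ => le_of_eq ?_
      have hs : 0 < Real.sin θ := Real.sin_pos_of_pos_of_lt_pi hθ.1 (by linarith [hθ.2, Real.pi_pos])
      have hmem : r * Real.sin θ ∈ Ioi (0 : ℝ) := mul_pos hr' hs
      rw [indicator_of_mem hmem, ← mul_assoc, ← ENNReal.ofReal_mul hr'.le]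
      congr 2
      · ring
      · simp only [frameDir, frameSum, smul_add, smul_smul, mul_assoc]
    · simp [indicator_of_notMem hr]
  · refine Measurable.aemeasurable ?_
    have : Measurable fun q : ℝ × ℝ => (q.1 * Real.cos q.2, q.1 * Real.sin q.2) := by fun_prop
    exact Measurable.mul (by fun_prop) (hm3.comp this)

theorem lintegral_Ioc_two_pi {f : ℝ → ℝ≥0∞} (hf : Function.Periodic f (2 * Real.pi)) :
    ∫⁻ ε in Ioc 0 (2 * Real.pi), f ε = ∫⁻ ε in Ioo (-Real.pi) Real.pi, f ε := by
  have hp := Real.pi_pos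
  have h1 : ∫⁻ ε in Ioc Real.pi (2 * Real.pi), f ε = ∫⁻ ε in Ioc (-Real.pi) 0, f ε := by
    rw [← lintegral_indicator measurableSet_Ioc, ← lintegral_indicator measurableSet_Ioc,
      ← lintegral_add_right_eq_self _ (2 * Real.pi)]
    refine lintegral_congr fun x => ?_
    simp only [indicator, mem_Ioc]
    rw [hf x]
    congr 1
    apply propext
    constructor <;> rintro ⟨h1, h2⟩ <;> constructor <;> linarith
  rw [setLIntegral_congr Ioo_ae_eq_Ioc,
    ← Ioc_union_Ioc_eq_Ioc (show -Real.pi ≤ 0 by linarith) hp.le,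
    lintegral_union measurableSet_Ioc (Ioc_disjoint_Ioc_of_le le_rfl), ← h1,
    ← Ioc_union_Ioc_eq_Ioc hp.le (show Real.pi ≤ 2 * Real.pi by linarith),
    lintegral_union measurableSet_Ioc (Ioc_disjoint_Ioc_of_le le_rfl), add_comm]

/-- Integration over a hemisphere in polar angle and azimuth. -/
theorem lintegral_hemisphere_le {a : Fin 3 → E3} (ha : Orthonormal ℝ a) {Φ : E3 → ℝ≥0∞}
    (hΦ : Measurable Φ) :
    ∫⁻ ε in Ioc 0 (2 * Real.pi), ∫⁻ θ in Ioc 0 (Real.pi / 2),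
      ENNReal.ofReal (Real.sin θ) * Φ (frameDir a ε θ) ≤
    ∫⁻ α : Metric.sphere (0 : E3) 1, {w : E3 | 0 < inner ℝ (a 0) w}.indicator Φ α
      ∂(volume : Measure E3).toSphere := by
  rw [lintegral_Ioc_two_pi (f := fun ε => ∫⁻ θ in Ioc 0 (Real.pi / 2),
      ENNReal.ofReal (Real.sin θ) * Φ (frameDir a ε θ))
    (fun ε => by simp only [frameDir, Real.cos_add_two_pi, Real.sin_add_two_pi])]
  simp_rw [setLIntegral_congr (Ioo_ae_eq_Ioc (a := (0 : ℝ)) (b := Real.pi / 2)).symm]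
  set H : Set E3 := {w : E3 | 0 < inner ℝ (a 0) w} with hH
  have hHm : MeasurableSet H := measurableSet_lt measurable_const (by fun_prop)
  -- Extended by homogeneity of degree zero and cut to the unit ball, the spherical function gives
  -- on both sides of the spherical-coordinate inequality the same radial factor `c`, which is
  -- positive and finite and cancels.
  set F : E3 → ℝ≥0∞ := fun u =>
    (Metric.ball (0 : E3) 1).indicator 1 u * H.indicator Φ (‖u‖⁻¹ • u) with hF
  have hFm : Measurable F := by
    refine Measurable.mul (measurable_one.indicator Metric.isOpen_ball.measurableSet) ?_
    exact (hΦ.indicator hHm).comp (by fun_prop)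
  have hFr : ∀ {r : ℝ} {u : E3}, 0 < r → ‖u‖ = 1 →
      F (r • u) = (Iio (1 : ℝ)).indicator 1 r * H.indicator Φ u := by
    intro r u hr hu
    have hn : ‖r • u‖ = r := by rw [norm_smul, hu, mul_one, Real.norm_of_nonneg hr.le]
    simp only [hF, indicator, hn, Metric.mem_ball, dist_zero_right, mem_Iio, Pi.one_apply,
      smul_smul, inv_mul_cancel₀ hr.ne', one_smul]
  set c : ℝ≥0∞ := ∫⁻ r in Ioi (0 : ℝ), ENNReal.ofReal (r ^ 2) * (Iio (1 : ℝ)).indicator 1 r with hc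
  have hcm : Measurable fun r : ℝ => ENNReal.ofReal (r ^ 2) * (Iio (1 : ℝ)).indicator 1 r :=
    Measurable.mul (by fun_prop) (measurable_one.indicator measurableSet_Iio)
  have hc0 : c ≠ 0 := by
    intro h0
    rw [hc, setLIntegral_eq_zero_iff measurableSet_Ioi hcm] at h0
    have h1 : volume (Ioo (0 : ℝ) 1) = 0 := by
      refine measure_mono_null ?_ (ae_iff.1 h0)
      rintro r ⟨hr0, hr1⟩
      simp [hr0, hr1, hr0.ne']
    simp at h1
  have hc1 : c ≠ ∞ := by
    have h1 : c ≤ ∫⁻ r in Ioi (0 : ℝ), (Ioo (0 : ℝ) 1).indicator 1 r := by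
      refine setLIntegral_mono' measurableSet_Ioi fun r hr => ?_
      by_cases h : r < 1
      · rw [indicator_of_mem (show r ∈ Iio (1 : ℝ) from h),
          indicator_of_mem (show r ∈ Ioo (0 : ℝ) 1 from ⟨hr, h⟩)]
        simp only [Pi.one_apply, mul_one]
        rw [← ENNReal.ofReal_one]
        exact ENNReal.ofReal_le_ofReal (pow_le_one₀ (le_of_lt hr) h.le)
      · simp [h]
    refine (h1.trans_lt ?_).ne
    refine (setLIntegral_le_lintegral _ _).trans_lt ?_
    rw [lintegral_indicator_one measurableSet_Ioo]
    simp
  have key := lintegral_spherical_le ha hFm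
  rw [lintegral_polar hFm] at key
  have eL : ∫⁻ ε in Ioo (-Real.pi) Real.pi, ∫⁻ r in Ioi (0 : ℝ), ∫⁻ θ in Ioo 0 (Real.pi / 2),
      ENNReal.ofReal (r ^ 2 * Real.sin θ) * F (r • frameDir a ε θ) =
      c * ∫⁻ ε in Ioo (-Real.pi) Real.pi, ∫⁻ θ in Ioo 0 (Real.pi / 2),
        ENNReal.ofReal (Real.sin θ) * Φ (frameDir a ε θ) := by
    rw [← lintegral_const_mul' _ _ hc1]
    refine lintegral_congr fun ε => ?_
    rw [hc, ← lintegral_mul_const _ hcm]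
    refine setLIntegral_congr_fun measurableSet_Ioi fun r hr => ?_
    rw [← lintegral_const_mul']
    · refine setLIntegral_congr_fun measurableSet_Ioo fun θ hθ => ?_
      have hmem : frameDir a ε θ ∈ H := by
        simp only [hH, mem_ofPred_eq, frameDir, inner_frameSum ha]
        exact Real.cos_pos_of_mem_Ioo ⟨by linarith [hθ.1, Real.pi_pos], hθ.2⟩
      rw [hFr hr (norm_frameDir ha ε θ), indicator_of_mem hmem, ENNReal.ofReal_mul (sq_nonneg r)]
      ring
    · refine ENNReal.mul_ne_top ENNReal.ofReal_ne_top ?_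
      by_cases h : r < 1 <;> simp [h]
  have eR : ∫⁻ α : Metric.sphere (0 : E3) 1, ∫⁻ r in Ioi (0 : ℝ),
      ENNReal.ofReal (r ^ 2) * F (r • (α : E3)) ∂volume ∂(volume : Measure E3).toSphere =
      c * ∫⁻ α : Metric.sphere (0 : E3) 1, H.indicator Φ α ∂(volume : Measure E3).toSphere := by
    rw [← lintegral_const_mul' _ _ hc1]
    refine lintegral_congr fun α => ?_
    rw [hc, ← lintegral_mul_const _ hcm]
    refine setLIntegral_congr_fun measurableSet_Ioi fun r hr => ?_
    rw [hFr hr (by simp), mul_assoc]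
  rw [eL, eR] at key
  exact (ENNReal.mul_le_mul_iff_right hc0 hc1).1 key

/-! ### The change of variables in the gain term -/

/-- The geometric mean of the Maxwellian at `v` and at `w`. -/
def gaussPair (v w : E3) : ℝ := Real.sqrt (maxwellian v) * Real.sqrt (maxwellian w)

theorem measurable_maxwellian : Measurable maxwellian := by unfold maxwellian; fun_prop

theorem maxwellian_pos (v : E3) : 0 < maxwellian v :=
  mul_pos (Real.rpow_pos_of_pos Real.pi_pos _) (Real.exp_pos _)

theorem measurable_gaussPair : Measurable fun q : E3 × E3 => gaussPair q.1 q.2 := by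
  have := measurable_maxwellian
  unfold gaussPair; fun_prop

theorem gaussPair_nonneg (v w : E3) : 0 ≤ gaussPair v w := by unfold gaussPair; positivity

theorem gaussPair_eq (v w : E3) :
    gaussPair v w = Real.pi ^ (-(3 / 2) : ℝ) * Real.exp (-(‖v‖ ^ 2 + ‖w‖ ^ 2) / 2) := by
  rw [gaussPair, ← Real.sqrt_mul (maxwellian_pos v).le]
  rw [show maxwellian v * maxwellian w =
    (Real.pi ^ (-(3 / 2) : ℝ) * Real.exp (-(‖v‖ ^ 2 + ‖w‖ ^ 2) / 2)) ^ 2 by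
      unfold maxwellian
      rw [mul_pow, ← Real.exp_nat_mul]
      rw [show ((2 : ℕ) : ℝ) * (-(‖v‖ ^ 2 + ‖w‖ ^ 2) / 2) = -‖v‖ ^ 2 + -‖w‖ ^ 2 by
        push_cast; ring, Real.exp_add]
      ring]
  exact Real.sqrt_sq (by positivity)

theorem lintegral_gaussian_shift (c : ℝ) :
    ∫⁻ y : ℝ, ENNReal.ofReal (Real.exp (-(c + y) ^ 2)) = ENNReal.ofReal (Real.sqrt Real.pi) := by
  have h1 : Integrable fun y : ℝ => Real.exp (-y ^ 2) := by
    simpa using integrable_exp_neg_mul_sq (b := 1) one_pos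
  rw [lintegral_add_left_eq_self (fun y : ℝ => ENNReal.ofReal (Real.exp (-y ^ 2))) c,
    ← ofReal_integral_eq_lintegral_ofReal h1 (Eventually.of_forall fun y => (Real.exp_pos _).le)]
  congr 1
  simpa using integral_gaussian 1

/-- Since `p² profile p = (1 + p)⁻²` and `p ^ γ ≤ 1 + p`, it is enough that `(1 + p)³ ≤ 20 exp(p² /
4)`. The factor `p²` is kept because it becomes the radial Jacobian of the new velocity variable. -/
theorem rpow_mul_exp_le_profile {γ p : ℝ} (hγ0 : 0 ≤ γ) (hγ1 : γ ≤ 1) (hp : 0 < p) :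
    p ^ γ * Real.exp (-p ^ 2 / 4) ≤ 20 * (p ^ 2 * profile p) := by
  have h1 : p ^ γ ≤ 1 + p := by
    rcases le_total p 1 with h | h
    · exact (Real.rpow_le_one hp.le h hγ0).trans (by linarith)
    · calc p ^ γ ≤ p ^ (1 : ℝ) := Real.rpow_le_rpow_of_exponent_le h hγ1
        _ ≤ _ := by rw [Real.rpow_one]; linarith
  have h2 := Real.quadratic_le_exp_of_nonneg (x := p ^ 2 / 4) (by positivity)
  have h3 : (1 + p) ^ 3 ≤ 20 * Real.exp (p ^ 2 / 4) := by
    nlinarith [sq_nonneg (p - 1), sq_nonneg (p * (p - 1)), sq_nonneg (p ^ 2)]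
  have h4 : Real.exp (-p ^ 2 / 4) = (Real.exp (p ^ 2 / 4))⁻¹ := by
    rw [← Real.exp_neg]; ring_nf
  have h5 : p ^ 2 * profile p = ((1 + p) ^ 2)⁻¹ := by
    unfold profile; field_simp
  rw [h4, h5, ← div_eq_mul_inv, ← div_eq_mul_inv, div_le_div_iff₀ (Real.exp_pos _) (by positivity)]
  calc p ^ γ * (1 + p) ^ 2 ≤ (1 + p) * (1 + p) ^ 2 := by gcongr
    _ = (1 + p) ^ 3 := by ring
    _ ≤ _ := h3

/-- The two arguments of the Gaussian pair differ by `p • a 0`. Completing the square in the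
component of the second argument along `a 0` extracts `exp(-p² / 4)`, and the two orthogonal
components keep a full Gaussian. Its integral over the plane is `π` whatever `v` is, so the
resulting bound is uniform in `v`. -/
theorem gaussPair_frameSum_le {a : Fin 3 → E3} (ha : Orthonormal ℝ a) (v : E3) (p y z : ℝ) :
    gaussPair (v + frameSum a p y z) (v + frameSum a p y z - p • a 0) ≤
      Real.pi ^ (-(3 / 2) : ℝ) * (Real.exp (-p ^ 2 / 4) *
        (Real.exp (-(inner ℝ (a 1) v + y) ^ 2) * Real.exp (-(inner ℝ (a 2) v + z) ^ 2))) := by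
  have h := orthonormal_iff_ite.1 ha
  rw [gaussPair_eq, ← Real.exp_add, ← Real.exp_add]
  refine mul_le_mul_of_nonneg_left (Real.exp_le_exp.2 ?_) (by positivity)
  set X : E3 := v + frameSum a p y z - p • a 0 with hX
  have hX' : X = v + y • a 1 + z • a 2 := by rw [hX, frameSum]; abel
  have e0 : v + frameSum a p y z = X + p • a 0 := by rw [hX]; abel
  have e1 : inner ℝ (a 1) X = inner ℝ (a 1) v + y := by
    rw [hX']; simp [inner_add_right, real_inner_smul_right, h, ha.1 1]
  have e2 : inner ℝ (a 2) X = inner ℝ (a 2) v + z := by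
    rw [hX']; simp [inner_add_right, real_inner_smul_right, h, ha.1 2]
  have hB := ha.sum_inner_products_le (s := Finset.univ) X
  simp only [Fin.sum_univ_three, Real.norm_eq_abs, sq_abs, e1, e2] at hB
  have e3 : ‖X + p • a 0‖ ^ 2 = ‖X‖ ^ 2 + 2 * (p * inner ℝ (a 0) X) + p ^ 2 := by
    rw [norm_add_sq_real, real_inner_smul_right, norm_smul, ha.1 0, real_inner_comm]
    simp
  rw [e0, e3]
  nlinarith [sq_nonneg (inner ℝ (a 0) X + p / 2)]

/-- The constant in `lintegral_gain_le`. -/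
def gainConst : ℝ≥0 := (20 * (Real.pi ^ (-(3 / 2) : ℝ) * Real.pi)).toNNReal

/-- The integrand of the gain term in terms of the relative velocity and the scattering
direction. -/
def gainIntegrand (γ : ℝ) (v : E3) (g : E3 → ℝ≥0∞) (V α : E3) : ℝ≥0∞ :=
  ENNReal.ofReal (‖V‖ ^ γ * (inner ℝ V α / ‖V‖) *
    gaussPair (v + V) (v + V - (inner ℝ V α : ℝ) • α)) * g (v + (inner ℝ V α : ℝ) • α)

theorem measurable_gainIntegrand (γ : ℝ) (v : E3) {g : E3 → ℝ≥0∞} (hg : Measurable g) :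
    Measurable fun q : E3 × E3 => gainIntegrand γ v g q.1 q.2 := by
  have h1 : Measurable fun q : E3 × E3 =>
      gaussPair (v + q.1) (v + q.1 - (inner ℝ q.1 q.2 : ℝ) • q.2) :=
    measurable_gaussPair.comp
      (f := fun q : E3 × E3 => (v + q.1, v + q.1 - (inner ℝ q.1 q.2 : ℝ) • q.2)) (by fun_prop)
  unfold gainIntegrand
  fun_prop

/-- For a fixed scattering direction `α`, integration over the plane orthogonal to `α`. -/
theorem lintegral_gain_fixed_dir_le {γ : ℝ} (hγ0 : 0 ≤ γ) (hγ1 : γ ≤ 1) (v : E3)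
    {g : E3 → ℝ≥0∞} (hg : Measurable g) {α : E3} (hα : ‖α‖ = 1) :
    ∫⁻ V : E3, {V : E3 | 0 < inner ℝ V α}.indicator (fun V => gainIntegrand γ v g V α) V ≤
      ∫⁻ p in Ioi (0 : ℝ), ENNReal.ofReal (p ^ 2) *
        (gainConst * (ENNReal.ofReal (maj (p • α)) * g (v + p • α))) := by
  set a : Fin 3 → E3 := ![α, frame₂ α, frame₃ α] with ha'
  have ha : Orthonormal ℝ a := frame_orthonormal α hα
  have ha0 : a 0 = α := rfl
  have hin : ∀ p y z, inner ℝ (frameSum a p y z) α = p := fun p y z => by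
    rw [real_inner_comm, ← ha0, inner_frameSum ha]
  have hmeas : Measurable ({V : E3 | 0 < inner ℝ V α}.indicator
      fun V => gainIntegrand γ v g V α) :=
    ((measurable_gainIntegrand γ v hg).comp measurable_prodMk_right).indicator
      (measurableSet_lt measurable_const (by fun_prop))
  rw [lintegral_frameSum ha hmeas, ← lintegral_indicator measurableSet_Ioi]
  refine lintegral_mono fun p => ?_
  by_cases hp : p ∈ Ioi (0 : ℝ)
  swap
  · refine (lintegral_mono (g := fun _ => 0) fun q => le_of_eq ?_).trans (by simp)
    refine indicator_of_notMem ?_ _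
    simpa [hin] using hp
  have hp0 : 0 < p := hp
  rw [indicator_of_mem hp]
  set G : ℝ × ℝ → ℝ≥0∞ := fun q =>
    ENNReal.ofReal (Real.exp (-(inner ℝ (a 1) v + q.1) ^ 2)) *
      ENNReal.ofReal (Real.exp (-(inner ℝ (a 2) v + q.2) ^ 2)) with hG
  have hGi : ∫⁻ q, G q = ENNReal.ofReal Real.pi := by
    have h := lintegral_prod_mul (μ := (volume : Measure ℝ)) (ν := (volume : Measure ℝ))
      (f := fun y : ℝ => ENNReal.ofReal (Real.exp (-(inner ℝ (a 1) v + y) ^ 2)))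
      (g := fun y : ℝ => ENNReal.ofReal (Real.exp (-(inner ℝ (a 2) v + y) ^ 2)))
      (by fun_prop) (by fun_prop)
    rw [lintegral_gaussian_shift, lintegral_gaussian_shift, ← ENNReal.ofReal_mul (by positivity),
      Real.mul_self_sqrt Real.pi_pos.le] at h
    exact h
  set K : ℝ≥0∞ := ENNReal.ofReal (Real.pi ^ (-(3 / 2) : ℝ) * (p ^ γ * Real.exp (-p ^ 2 / 4))) *
    g (v + p • α) with hK
  have hpt : ∀ q : ℝ × ℝ, ({V : E3 | 0 < inner ℝ V α}.indicator fun V => gainIntegrand γ v g V α)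
        (frameSum a p q.1 q.2) ≤ K * G q := by
    intro q
    refine (indicator_le_self _ _ _).trans ?_
    simp only [gainIntegrand, hin]
    have hn : p ≤ ‖frameSum a p q.1 q.2‖ := by
      have := abs_real_inner_le_norm (frameSum a p q.1 q.2) α
      rw [hin, hα, mul_one] at this
      exact (le_abs_self p).trans this
    set n := ‖frameSum a p q.1 q.2‖ with hn'
    have hn0 : 0 < n := hp0.trans_le hn
    -- Here `γ ≤ 1` enters: `p ≤ n` and `γ - 1 ≤ 0`, so the kinetic factor loses its dependence on
    -- the in-plane coordinates.
    have h1 : n ^ γ * (p / n) ≤ p ^ γ := by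
      have e : n ^ γ * (p / n) = n ^ (γ - 1) * p := by
        rw [Real.rpow_sub_one hn0.ne']; ring
      have e' : p ^ γ = p ^ (γ - 1) * p := by
        rw [Real.rpow_sub_one hp0.ne']; field_simp
      rw [e, e']
      exact mul_le_mul_of_nonneg_right
        (Real.rpow_le_rpow_of_nonpos hp0 hn (by linarith)) hp0.le
    have h2 := gaussPair_frameSum_le ha v p q.1 q.2
    rw [ha0] at h2
    calc _ ≤ ENNReal.ofReal (p ^ γ * (Real.pi ^ (-(3 / 2) : ℝ) * (Real.exp (-p ^ 2 / 4) *
        (Real.exp (-(inner ℝ (a 1) v + q.1) ^ 2) * Real.exp (-(inner ℝ (a 2) v + q.2) ^ 2))))) *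
          g (v + p • α) := by
          gcongr
          exact gaussPair_nonneg _ _
      _ = _ := by
          rw [hK, hG, show ∀ A B C D E : ℝ, A * (B * (C * (D * E))) = (B * (A * C)) * (D * E) from
            fun A B C D E => by ring, ENNReal.ofReal_mul (by positivity),
            ENNReal.ofReal_mul (Real.exp_pos _).le]
          ring
  refine (lintegral_mono hpt).trans ?_
  rw [lintegral_const_mul _ (by fun_prop), hGi, hK]
  have hmaj : maj (p • α) = profile p := by
    rw [maj, norm_smul, hα, mul_one, Real.norm_of_nonneg hp0.le]
  rw [hmaj, gainConst]
  have h3 : ENNReal.ofReal (Real.pi ^ (-(3 / 2) : ℝ) * (p ^ γ * Real.exp (-p ^ 2 / 4))) *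
      ENNReal.ofReal Real.pi ≤ ENNReal.ofReal (p ^ 2) *
        (ENNReal.ofReal (20 * (Real.pi ^ (-(3 / 2) : ℝ) * Real.pi)) *
          ENNReal.ofReal (profile p)) := by
    have := Real.pi_pos
    rw [← ENNReal.ofReal_mul (by positivity), ← ENNReal.ofReal_mul (by positivity),
      ← ENNReal.ofReal_mul (by positivity)]
    refine ENNReal.ofReal_le_ofReal ?_
    have h4 := rpow_mul_exp_le_profile hγ0 hγ1 hp0
    calc _ = (Real.pi ^ (-(3 / 2) : ℝ) * Real.pi) * (p ^ γ * Real.exp (-p ^ 2 / 4)) := by ring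
      _ ≤ (Real.pi ^ (-(3 / 2) : ℝ) * Real.pi) * (20 * (p ^ 2 * profile p)) := by gcongr
      _ = _ := by ring
  calc _ = (ENNReal.ofReal (Real.pi ^ (-(3 / 2) : ℝ) * (p ^ γ * Real.exp (-p ^ 2 / 4))) *
      ENNReal.ofReal Real.pi) * g (v + p • α) := by ring
    _ ≤ _ := by
      refine (mul_le_mul_left h3 _).trans (le_of_eq ?_)
      rw [show ∀ x : ℝ, (x.toNNReal : ℝ≥0∞) = ENNReal.ofReal x from fun _ => rfl]
      ring

/-- The gain term is dominated by the majorant. -/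
theorem lintegral_gain_le {γ : ℝ} (hγ0 : 0 ≤ γ) (hγ1 : γ ≤ 1) {a : E3 → Fin 3 → E3}
    (ha : ∀ V, V ≠ 0 → Orthonormal ℝ (a V) ∧ a V 0 = ‖V‖⁻¹ • V) (v : E3)
    {g : E3 → ℝ≥0∞} (hg : Measurable g) :
    ∫⁻ V : E3, ∫⁻ ε in Ioc 0 (2 * Real.pi), ∫⁻ θ in Ioc 0 (Real.pi / 2),
      ENNReal.ofReal (‖V‖ ^ γ * Real.cos θ * Real.sin θ * gaussPair (v + V)
        (v + V - (inner ℝ V (frameDir (a V) ε θ) : ℝ) • frameDir (a V) ε θ)) *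
        g (v + (inner ℝ V (frameDir (a V) ε θ) : ℝ) • frameDir (a V) ε θ) ≤
      gainConst * ∫⁻ w, ENNReal.ofReal (maj (w - v)) * g w := by
  set Ψ : E3 → E3 → ℝ≥0∞ := fun V α =>
    {V : E3 | 0 < inner ℝ V α}.indicator (fun V => gainIntegrand γ v g V α) V with hΨ
  have hΦm := measurable_gainIntegrand γ v hg
  have hΨm : Measurable fun q : E3 × E3 => Ψ q.1 q.2 := by
    have : (fun q : E3 × E3 => Ψ q.1 q.2) =
        {q : E3 × E3 | 0 < inner ℝ q.1 q.2}.indicator fun q => gainIntegrand γ v g q.1 q.2 := by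
      ext q
      simp only [hΨ, indicator, mem_ofPred_eq]
    rw [this]
    exact hΦm.indicator (measurableSet_lt measurable_const (by fun_prop))
  have hstep : ∀ V : E3, V ≠ 0 → (∫⁻ ε in Ioc 0 (2 * Real.pi), ∫⁻ θ in Ioc 0 (Real.pi / 2),
      ENNReal.ofReal (‖V‖ ^ γ * Real.cos θ * Real.sin θ * gaussPair (v + V)
        (v + V - (inner ℝ V (frameDir (a V) ε θ) : ℝ) • frameDir (a V) ε θ)) *
        g (v + (inner ℝ V (frameDir (a V) ε θ) : ℝ) • frameDir (a V) ε θ)) ≤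
      ∫⁻ α : Metric.sphere (0 : E3) 1, Ψ V α ∂(volume : Measure E3).toSphere := by
    intro V hV
    obtain ⟨ho, h0⟩ := ha V hV
    have hn : 0 < ‖V‖ := norm_pos_iff.2 hV
    have hin : ∀ w : E3, inner ℝ (a V 0) w = inner ℝ V w / ‖V‖ := fun w => by
      rw [h0, real_inner_smul_left]; ring
    have hVm : Measurable (gainIntegrand γ v g V) :=
      (show Measurable (Function.uncurry (gainIntegrand γ v g)) from hΦm).of_uncurry_left
    refine le_trans (le_of_eq ?_) ((lintegral_hemisphere_le ho hVm).trans (le_of_eq ?_))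
    · refine lintegral_congr fun ε => setLIntegral_congr_fun measurableSet_Ioc fun θ hθ => ?_
      have hs : 0 ≤ Real.sin θ :=
        Real.sin_nonneg_of_nonneg_of_le_pi hθ.1.le (by linarith [hθ.2, Real.pi_pos])
      have hc : inner ℝ V (frameDir (a V) ε θ) / ‖V‖ = Real.cos θ := by
        rw [← hin, frameDir, inner_frameSum ho]
      simp only [gainIntegrand, hc]
      rw [← mul_assoc, ← ENNReal.ofReal_mul hs]
      congr 2
      ring
    · refine lintegral_congr fun α => ?_
      simp only [hΨ, indicator, mem_ofPred_eq, hin, div_pos_iff_of_pos_right hn]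
  have hne : ∀ᵐ V : E3, V ≠ 0 := by simp [ae_iff]
  have hPm : Measurable fun w => gainConst * (ENNReal.ofReal (maj w) * g (v + w)) := by
    have := measurable_maj
    fun_prop
  -- Fubini puts the direction `α` outside. For fixed `α` the component `p > 0` of `V` along `α`
  -- survives the planar integration, and `p² dp dα` is Lebesgue measure in `w - v = p α`.
  calc _ ≤ ∫⁻ V, ∫⁻ α : Metric.sphere (0 : E3) 1, Ψ V α ∂(volume : Measure E3).toSphere := by
        refine lintegral_mono_ae ?_
        filter_upwards [hne] with V hV using hstep V hV
    _ = ∫⁻ α : Metric.sphere (0 : E3) 1, ∫⁻ V, Ψ V α ∂volume ∂(volume : Measure E3).toSphere := by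
        refine lintegral_lintegral_swap ?_
        have : Measurable fun q : E3 × Metric.sphere (0 : E3) 1 => (q.1, (q.2 : E3)) := by fun_prop
        exact (hΨm.comp this).aemeasurable
    _ ≤ ∫⁻ α : Metric.sphere (0 : E3) 1, ∫⁻ p in Ioi (0 : ℝ), ENNReal.ofReal (p ^ 2) *
          (gainConst * (ENNReal.ofReal (maj (p • (α : E3))) * g (v + p • (α : E3))))
            ∂volume ∂(volume : Measure E3).toSphere :=
        lintegral_mono fun α => lintegral_gain_fixed_dir_le hγ0 hγ1 v hg (by simp)
    _ = ∫⁻ w, gainConst * (ENNReal.ofReal (maj w) * g (v + w)) := (lintegral_polar hPm).symm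
    _ = _ := by
        rw [lintegral_const_mul' _ _ ENNReal.coe_ne_top,
          ← lintegral_add_left_eq_self (fun w => ENNReal.ofReal (maj (w - v)) * g w) v]
        simp

/-! ### Measurability of the collision map -/

theorem measurable_toLp3 {X : Type*} [MeasurableSpace X] {f g h : X → ℝ} (hf : Measurable f)
    (hg : Measurable g) (hh : Measurable h) : Measurable fun x => (!₂[f x, g x, h x] : E3) := by
  refine (MeasurableEquiv.toLp 2 (Fin 3 → ℝ)).measurable.comp (measurable_pi_iff.2 fun i => ?_)
  fin_cases i
  · exact hf
  · exact hg
  · exact hh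

theorem measurable_coord (i : Fin 3) : Measurable fun e : E3 => e i := by fun_prop

theorem measurable_frame₂ : Measurable frame₂ := by
  unfold frame₂
  have h0 := measurable_coord 0
  have h1 := measurable_coord 1
  refine Measurable.ite ((measurableSet_eq_fun h0 measurable_const).inter
    (measurableSet_eq_fun h1 measurable_const)) measurable_const ?_
  have hs : Measurable fun e : E3 => (Real.sqrt (e 0 ^ 2 + e 1 ^ 2))⁻¹ := by fun_prop
  exact hs.smul (measurable_toLp3 h1.neg h0 measurable_const)

theorem measurable_frame₃ : Measurable frame₃ := by
  unfold frame₃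
  have h := measurable_coord
  have h' := fun i => (measurable_coord i).comp measurable_frame₂
  simp only [Function.comp_def] at h'
  exact measurable_toLp3 (((h 1).mul (h' 2)).sub ((h 2).mul (h' 1)))
    (((h 2).mul (h' 0)).sub ((h 0).mul (h' 2))) (((h 0).mul (h' 1)).sub ((h 1).mul (h' 0)))

/-- The parameters `(vs, ε, θ)` of a collision. -/
abbrev CollParam : Type := E3 × ℝ × ℝ

/-- Lebesgue measure on the set of collision parameters. -/
def collMeasure : Measure CollParam := volume.restrict collisionDomain

instance : SFinite collMeasure := by unfold collMeasure; infer_instance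

theorem measurable_scatterDir :
    Measurable fun q : E3 × CollParam => scatterDir q.1 q.2.1 q.2.2.1 q.2.2.2 := by
  unfold scatterDir
  have h2 := measurable_frame₂
  have h3 := measurable_frame₃
  fun_prop

theorem measurable_postV :
    Measurable fun q : E3 × CollParam => postV q.1 q.2.1 q.2.2.1 q.2.2.2 := by
  unfold postV
  have := measurable_scatterDir
  fun_prop

theorem measurable_postVs :
    Measurable fun q : E3 × CollParam => postVs q.1 q.2.1 q.2.2.1 q.2.2.2 := by
  unfold postVs
  have := measurable_scatterDir
  fun_prop

/-! ### Algebra of the collision map -/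

/-- The frame used in the definition of the scattering direction. -/
def relFrame (V : E3) : Fin 3 → E3 :=
  ![‖V‖⁻¹ • V, frame₂ (‖V‖⁻¹ • V), frame₃ (‖V‖⁻¹ • V)]

/-- The frame `relFrame` with the last two vectors reversed. -/
def relFrameNeg (V : E3) : Fin 3 → E3 :=
  ![‖V‖⁻¹ • V, -frame₂ (‖V‖⁻¹ • V), -frame₃ (‖V‖⁻¹ • V)]

theorem relFrame_orthonormal {V : E3} (hV : V ≠ 0) : Orthonormal ℝ (relFrame V) := by
  refine frame_orthonormal _ ?_
  rw [norm_smul, norm_inv, norm_norm, inv_mul_cancel₀ (norm_ne_zero_iff.2 hV)]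

theorem relFrameNeg_orthonormal {V : E3} (hV : V ≠ 0) : Orthonormal ℝ (relFrameNeg V) := by
  have h := orthonormal_iff_ite.1 (relFrame_orthonormal hV)
  rw [orthonormal_iff_ite]
  intro i j
  have hij := h i j
  fin_cases i <;> fin_cases j <;> simpa [relFrame, relFrameNeg] using hij

theorem scatterDir_eq (v V : E3) (ε θ : ℝ) :
    scatterDir v (v + V) ε θ = frameDir (relFrame V) ε θ := by
  simp [scatterDir, frameDir, frameSum, relFrame]

theorem postV_eq (v V : E3) (ε θ : ℝ) : postV v (v + V) ε θ =
    v + (inner ℝ V (frameDir (relFrame V) ε θ) : ℝ) • frameDir (relFrame V) ε θ := by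
  rw [postV, scatterDir_eq, add_sub_cancel_left]

theorem postVs_eq (v V : E3) (ε θ : ℝ) : postVs v (v + V) ε θ =
    v + V - (inner ℝ V (frameDir (relFrame V) ε θ) : ℝ) • frameDir (relFrame V) ε θ := by
  rw [postVs, scatterDir_eq, add_sub_cancel_left]

theorem inner_frameDir_of_head {a : Fin 3 → E3} (ha : Orthonormal ℝ a) {V : E3} (hV : V ≠ 0)
    (h0 : a 0 = ‖V‖⁻¹ • V) (ε θ : ℝ) : inner ℝ V (frameDir a ε θ) = ‖V‖ * Real.cos θ := by
  have hn : ‖V‖ ≠ 0 := norm_ne_zero_iff.2 hV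
  have h : V = ‖V‖ • a 0 := by rw [h0, smul_smul, mul_inv_cancel₀ hn, one_smul]
  nth_rewrite 1 [h]
  rw [real_inner_smul_left, frameDir, inner_frameSum ha]

/-- `V - (V · α) α` is the projection of `V` on the unit vector orthogonal to `α` in the plane of
`V` and `α`. That vector makes the angle `π/2 - θ` with `V`, on the side opposite to `α`; hence the
reversed transverse vectors. Thus exchanging `v'` and `vs'` amounts to the reflection `θ ↦ π/2 - θ`.
-/
theorem inner_smul_frameDir_compl {V : E3} (hV : V ≠ 0) (ε θ : ℝ) :
    (inner ℝ V (frameDir (relFrameNeg V) ε (Real.pi / 2 - θ)) : ℝ) •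
        frameDir (relFrameNeg V) ε (Real.pi / 2 - θ) =
      V - (inner ℝ V (frameDir (relFrame V) ε θ) : ℝ) • frameDir (relFrame V) ε θ := by
  rw [inner_frameDir_of_head (relFrameNeg_orthonormal hV) hV rfl,
    inner_frameDir_of_head (relFrame_orthonormal hV) hV rfl]
  have hn : ‖V‖ ≠ 0 := norm_ne_zero_iff.2 hV
  set e := ‖V‖⁻¹ • V with he
  have h : V = ‖V‖ • e := by rw [he, smul_smul, mul_inv_cancel₀ hn, one_smul]
  have h1 : relFrame V = ![e, frame₂ e, frame₃ e] := rfl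
  have h2 : relFrameNeg V = ![e, -frame₂ e, -frame₃ e] := rfl
  rw [h1, h2]
  set n := ‖V‖
  rw [h]
  simp only [frameDir, frameSum, Real.cos_pi_div_two_sub, Real.sin_pi_div_two_sub,
    Matrix.cons_val_zero, Matrix.cons_val_one, Matrix.cons_val]
  have hsc := Real.sin_sq_add_cos_sq θ
  have : n • e = (n * (Real.sin θ ^ 2 + Real.cos θ ^ 2)) • e := by rw [hsc, mul_one]
  rw [this]
  module

theorem norm_sq_postV_add (v vs : E3) (ε θ : ℝ) :
    ‖postV v vs ε θ‖ ^ 2 + ‖postVs v vs ε θ‖ ^ 2 = ‖v‖ ^ 2 + ‖vs‖ ^ 2 := by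
  obtain ⟨V, rfl⟩ : ∃ V, vs = v + V := ⟨vs - v, by abel⟩
  rw [postV_eq, postVs_eq]
  by_cases hV : V = 0
  · simp [hV]
  have hα := norm_frameDir (relFrame_orthonormal hV) ε θ
  set α := frameDir (relFrame V) ε θ
  rw [norm_add_sq_real, norm_sub_sq_real]
  simp only [real_inner_smul_right, norm_smul, hα, inner_add_left, mul_one, Real.norm_eq_abs,
    sq_abs]
  ring

/-- Conservation of kinetic energy in terms of Maxwellians. It is the reason why the prefactor
`M^(-1/2)` in `L` cancels and leaves a Gaussian pair in the gain weights. -/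
theorem gaussPair_post (v vs : E3) (ε θ : ℝ) :
    gaussPair (postV v vs ε θ) (postVs v vs ε θ) = gaussPair v vs := by
  rw [gaussPair_eq, gaussPair_eq, norm_sq_postV_add]

/-! ### The three parts of `K` -/

/-- Weight of the term of `K` evaluated at `vs'`. -/
def weightGainVs (B : ℝ → ℝ → ℝ) (v : E3) (p : CollParam) : ℝ :=
  gaussPair p.1 (postV v p.1 p.2.1 p.2.2) * B ‖v - p.1‖ p.2.2

/-- Weight of the term of `K` evaluated at `v'`. -/
def weightGainV (B : ℝ → ℝ → ℝ) (v : E3) (p : CollParam) : ℝ :=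
  gaussPair p.1 (postVs v p.1 p.2.1 p.2.2) * B ‖v - p.1‖ p.2.2

/-- Weight of the term of `K` evaluated at `vs`. -/
def weightLoss (B : ℝ → ℝ → ℝ) (v : E3) (p : CollParam) : ℝ :=
  gaussPair v p.1 * B ‖v - p.1‖ p.2.2

/-- The cutoff hypothesis on the cross-section. -/
def HasCutoff (γ : ℝ) (B : ℝ → ℝ → ℝ) (C₀ : ℝ≥0) : Prop :=
  ∀ r θ : ℝ, 0 < r → 0 ≤ θ → θ ≤ Real.pi / 2 →
    |B r θ| ≤ C₀ * (r ^ γ * Real.cos θ * Real.sin θ)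

/-! ### Kernel bounds for the three parts of `K` -/

theorem lintegral_collMeasure {f : CollParam → ℝ≥0∞} (hf : Measurable f) (v : E3) :
    ∫⁻ p, f p ∂collMeasure = ∫⁻ V : E3, ∫⁻ ε in Ioc 0 (2 * Real.pi),
      ∫⁻ θ in Ioc 0 (Real.pi / 2), f (v + V, ε, θ) := by
  have e : collMeasure = (volume : Measure E3).prod
      ((volume.restrict (Ioc 0 (2 * Real.pi))).prod (volume.restrict (Ioc 0 (Real.pi / 2)))) := by
    rw [collMeasure, collisionDomain, Measure.volume_eq_prod, Measure.volume_eq_prod,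
      ← Measure.prod_restrict, ← Measure.prod_restrict, Measure.restrict_univ]
  rw [e, lintegral_prod _ hf.aemeasurable, ← lintegral_add_left_eq_self _ v]
  refine lintegral_congr fun V => ?_
  exact lintegral_prod _ (hf.comp measurable_prodMk_left).aemeasurable

theorem ae_collMeasure (v : E3) : ∀ᵐ p ∂collMeasure,
    0 < ‖v - p.1‖ ∧ 0 ≤ p.2.2 ∧ p.2.2 ≤ Real.pi / 2 := by
  have hdm : MeasurableSet collisionDomain :=
    MeasurableSet.univ.prod (measurableSet_Ioc.prod measurableSet_Ioc)
  have h1 : ∀ᵐ p ∂collMeasure, p.1 ≠ v := by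
    refine ae_restrict_of_ae ?_
    have h : ∀ᵐ w : E3, w ≠ v := by simp [ae_iff]
    rw [Measure.volume_eq_prod]
    exact Measure.quasiMeasurePreserving_fst.ae h
  filter_upwards [h1, ae_restrict_mem hdm] with p hp hd
  exact ⟨norm_pos_iff.2 (sub_ne_zero.2 hp.symm), hd.2.2.1.le, hd.2.2.2⟩

section Kernels

variable {B : ℝ → ℝ → ℝ} {γ : ℝ} {C₀ : ℝ≥0}

theorem measurable_crossSection (hB : Measurable (Function.uncurry B)) :
    Measurable fun q : E3 × CollParam => B ‖q.1 - q.2.1‖ q.2.2.2 :=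
  hB.comp (f := fun q : E3 × CollParam => (‖q.1 - q.2.1‖, q.2.2.2)) (by fun_prop)

theorem measurable_gaussPair_comp {X : Type*} [MeasurableSpace X] {f g : X → E3}
    (hf : Measurable f) (hg : Measurable g) : Measurable fun x => gaussPair (f x) (g x) :=
  (measurable_maxwellian.comp hf).sqrt.mul (measurable_maxwellian.comp hg).sqrt

theorem measurable_weightGainVs (hB : Measurable (Function.uncurry B)) :
    Measurable (Function.uncurry (weightGainVs B)) :=
  (measurable_gaussPair_comp measurable_snd.fst measurable_postV).mul
    (measurable_crossSection hB)

theorem measurable_weightGainV (hB : Measurable (Function.uncurry B)) :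
    Measurable (Function.uncurry (weightGainV B)) :=
  (measurable_gaussPair_comp measurable_snd.fst measurable_postVs).mul
    (measurable_crossSection hB)

theorem measurable_weightLoss (hB : Measurable (Function.uncurry B)) :
    Measurable (Function.uncurry (weightLoss B)) :=
  (measurable_gaussPair_comp measurable_fst measurable_snd.fst).mul
    (measurable_crossSection hB)

/-- The cutoff enters here, after passing to the relative velocity `V = vs - v`. The Gaussian factor
`m` stays abstract, so that the two gain terms and the loss term share the estimate. -/
theorem lintegral_weight_le (hC : HasCutoff γ B C₀) {m : E3 → CollParam → ℝ}
    (hm : Measurable (Function.uncurry m)) (hm0 : ∀ v p, 0 ≤ m v p) (v : E3)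
    {G : CollParam → ℝ≥0∞} (hG : Measurable G) :
    ∫⁻ p, ‖m v p * B ‖v - p.1‖ p.2.2‖ₑ * G p ∂collMeasure ≤
      C₀ * ∫⁻ V : E3, ∫⁻ ε in Ioc 0 (2 * Real.pi), ∫⁻ θ in Ioc 0 (Real.pi / 2),
        ENNReal.ofReal (‖V‖ ^ γ * Real.cos θ * Real.sin θ * m v (v + V, ε, θ)) *
          G (v + V, ε, θ) := by
  have hmv : Measurable (m v) := hm.of_uncurry_left
  have hmeas : Measurable fun p : CollParam =>
      ENNReal.ofReal (‖p.1 - v‖ ^ γ * Real.cos p.2.2 * Real.sin p.2.2 * m v p) * G p := by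
    fun_prop
  have h := lintegral_collMeasure hmeas v
  simp only [add_sub_cancel_left] at h
  rw [← h, ← lintegral_const_mul' _ _ ENNReal.coe_ne_top]
  refine lintegral_mono_ae ?_
  filter_upwards [ae_collMeasure v] with p hp
  rw [← mul_assoc]
  gcongr
  have h1 := hC _ _ hp.1 hp.2.1 hp.2.2
  rw [← ofReal_norm, ← ENNReal.ofReal_coe_nnreal, ← ENNReal.ofReal_mul C₀.coe_nonneg]
  refine ENNReal.ofReal_le_ofReal ?_
  rw [norm_mul, Real.norm_of_nonneg (hm0 v p), Real.norm_eq_abs, norm_sub_rev p.1 v]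
  calc _ ≤ m v p * (C₀ * (‖v - p.1‖ ^ γ * Real.cos p.2.2 * Real.sin p.2.2)) :=
        mul_le_mul_of_nonneg_left h1 (hm0 v p)
    _ = _ := by ring

theorem velKernel_gainV (hγ0 : 0 ≤ γ) (hγ1 : γ ≤ 1) (hB : Measurable (Function.uncurry B))
    (hC : HasCutoff γ B C₀) :
    VelKernel collMeasure (weightGainV B) (fun v p => postV v p.1 p.2.1 p.2.2)
      (C₀ * gainConst) where
  meas_b := measurable_weightGainV hB
  meas_W := measurable_postV
  majorant v g hg := by
    have hW : Measurable fun p : CollParam => postV v p.1 p.2.1 p.2.2 :=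
      measurable_postV.comp measurable_prodMk_left
    have hm : Measurable (Function.uncurry fun (v : E3) (p : CollParam) =>
        gaussPair p.1 (postVs v p.1 p.2.1 p.2.2)) :=
      measurable_gaussPair_comp measurable_snd.fst measurable_postVs
    have hG : Measurable fun p : CollParam => g (postV v p.1 p.2.1 p.2.2) := hg.comp hW
    have key := lintegral_weight_le hC hm (fun _ _ => gaussPair_nonneg _ _) v hG
    simp only [postV_eq, postVs_eq] at key
    simp only [weightGainV]
    refine key.trans ?_
    rw [ENNReal.coe_mul, mul_assoc]
    refine mul_le_mul_right ?_ _
    exact lintegral_gain_le hγ0 hγ1 (fun V hV => ⟨relFrame_orthonormal hV, rfl⟩) v hg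

theorem lintegral_Ioc_reflect (f : ℝ → ℝ≥0∞) (b : ℝ) :
    ∫⁻ θ in Ioc 0 b, f (b - θ) = ∫⁻ θ in Ioc 0 b, f θ := by
  rw [setLIntegral_congr Ioo_ae_eq_Ioc.symm, setLIntegral_congr Ioo_ae_eq_Ioc.symm,
    ← lintegral_indicator measurableSet_Ioo, ← lintegral_indicator measurableSet_Ioo,
    ← lintegral_sub_left_eq_self _ b]
  refine lintegral_congr fun x => ?_
  simp only [indicator, mem_Ioo]
  congr 1
  · apply propext
    constructor <;> rintro ⟨h1, h2⟩ <;> constructor <;> linarith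
  · rw [sub_sub_cancel]

/-- The factor `cos θ sin θ` of the cutoff is symmetric under `θ ↦ π/2 - θ`. This reflection, with
the reversed frame, turns the term at `vs'` into one at `v'`, to which the general-frame gain
estimate applies. -/
theorem velKernel_gainVs (hγ0 : 0 ≤ γ) (hγ1 : γ ≤ 1) (hB : Measurable (Function.uncurry B))
    (hC : HasCutoff γ B C₀) :
    VelKernel collMeasure (weightGainVs B) (fun v p => postVs v p.1 p.2.1 p.2.2)
      (C₀ * gainConst) where
  meas_b := measurable_weightGainVs hB
  meas_W := measurable_postVs
  majorant v g hg := by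
    have hW : Measurable fun p : CollParam => postVs v p.1 p.2.1 p.2.2 :=
      measurable_postVs.comp measurable_prodMk_left
    have hm : Measurable (Function.uncurry fun (v : E3) (p : CollParam) =>
        gaussPair p.1 (postV v p.1 p.2.1 p.2.2)) :=
      measurable_gaussPair_comp measurable_snd.fst measurable_postV
    have hG : Measurable fun p : CollParam => g (postVs v p.1 p.2.1 p.2.2) := hg.comp hW
    have key := lintegral_weight_le hC hm (fun _ _ => gaussPair_nonneg _ _) v hG
    simp only [postV_eq, postVs_eq] at key
    simp only [weightGainVs]
    refine key.trans ?_
    rw [ENNReal.coe_mul, mul_assoc]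
    refine mul_le_mul_right ?_ _
    refine le_trans (le_of_eq ?_)
      (lintegral_gain_le hγ0 hγ1 (fun V hV => ⟨relFrameNeg_orthonormal hV, rfl⟩) v hg)
    refine lintegral_congr_ae ?_
    have hne : ∀ᵐ V : E3, V ≠ 0 := by simp [ae_iff]
    filter_upwards [hne] with V hV
    refine lintegral_congr fun ε => ?_
    rw [← lintegral_Ioc_reflect (fun θ => ENNReal.ofReal (‖V‖ ^ γ * Real.cos θ * Real.sin θ *
      gaussPair (v + V) (v + V - (inner ℝ V (frameDir (relFrameNeg V) ε θ) : ℝ) •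
        frameDir (relFrameNeg V) ε θ)) *
        g (v + (inner ℝ V (frameDir (relFrameNeg V) ε θ) : ℝ) • frameDir (relFrameNeg V) ε θ))]
    refine lintegral_congr fun θ => ?_
    simp only [inner_smul_frameDir_compl hV,
      Real.cos_pi_div_two_sub, Real.sin_pi_div_two_sub]
    congr 2
    · rw [mul_right_comm (‖V‖ ^ γ)]
      congr 2
      abel
    · abel

/-- No Jacobian compensates the singularity here, so the exponential is cut into two halves, each
absorbing `(1 + p)³` at the cost of `64`; `4096 = 64²`. -/
theorem rpow_mul_exp_le_const_mul_profile (hγ0 : 0 ≤ γ) (hγ1 : γ ≤ 1) {p : ℝ} (hp : 0 < p) :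
    p ^ γ * Real.exp (-p ^ 2 / 4) ≤ 4096 * profile p := by
  have h1 : p ^ γ ≤ 1 + p := by
    rcases le_total p 1 with h | h
    · exact (Real.rpow_le_one hp.le h hγ0).trans (by linarith)
    · calc p ^ γ ≤ p ^ (1 : ℝ) := Real.rpow_le_rpow_of_exponent_le h hγ1
        _ ≤ _ := by rw [Real.rpow_one]; linarith
  have h2 := Real.quadratic_le_exp_of_nonneg (x := p ^ 2 / 8) (by positivity)
  have h3 : (1 + p) ^ 3 ≤ 64 * Real.exp (p ^ 2 / 8) := by
    nlinarith [sq_nonneg (p - 1), sq_nonneg (p * (p - 1)), sq_nonneg (p ^ 2)]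
  have h4 : Real.exp (-p ^ 2 / 4) = (Real.exp (p ^ 2 / 8) ^ 2)⁻¹ := by
    rw [← Real.exp_nat_mul, ← Real.exp_neg]
    congr 1
    push_cast
    ring
  have h5 : profile p = (p ^ 2 * (1 + p) ^ 2)⁻¹ := by
    unfold profile; rw [inv_pow, mul_pow]
  rw [h4, h5, ← div_eq_mul_inv, ← div_eq_mul_inv, div_le_div_iff₀ (by positivity) (by positivity)]
  have h6 : (1 + p) ^ 2 ≤ (1 + p) ^ 3 := pow_le_pow_right₀ (by linarith) (by norm_num)
  have h7 : p ^ 2 ≤ (1 + p) ^ 2 := by gcongr; linarith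
  calc p ^ γ * (p ^ 2 * (1 + p) ^ 2) ≤ (1 + p) * ((1 + p) ^ 2 * (1 + p) ^ 3) := by gcongr
    _ = (1 + p) ^ 3 * (1 + p) ^ 3 := by ring
    _ ≤ (64 * Real.exp (p ^ 2 / 8)) * (64 * Real.exp (p ^ 2 / 8)) := by gcongr
    _ = _ := by ring

theorem gaussPair_le (v w : E3) : gaussPair v w ≤ Real.exp (-‖w - v‖ ^ 2 / 4) := by
  rw [gaussPair_eq]
  have h1 : Real.pi ^ (-(3 / 2) : ℝ) ≤ 1 :=
    Real.rpow_le_one_of_one_le_of_nonpos (by linarith [Real.pi_gt_three]) (by norm_num)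
  have h2 : ‖w - v‖ ^ 2 ≤ 2 * (‖v‖ ^ 2 + ‖w‖ ^ 2) := by
    have := norm_sub_le w v
    nlinarith [norm_nonneg (w - v), norm_nonneg v, norm_nonneg w, sq_nonneg (‖v‖ - ‖w‖)]
  calc _ ≤ 1 * Real.exp (-(‖v‖ ^ 2 + ‖w‖ ^ 2) / 2) := by gcongr
    _ ≤ _ := by
      rw [one_mul]
      exact Real.exp_le_exp.2 (by linarith)

/-- The area of the range of angles. -/
def angleArea : ℝ≥0 := (2 * Real.pi).toNNReal * (Real.pi / 2).toNNReal

theorem velKernel_loss (hγ0 : 0 ≤ γ) (hγ1 : γ ≤ 1) (hB : Measurable (Function.uncurry B))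
    (hC : HasCutoff γ B C₀) :
    VelKernel collMeasure (weightLoss B) (fun _ p => p.1) (C₀ * (4096 * angleArea)) where
  meas_b := measurable_weightLoss hB
  meas_W := measurable_snd.fst
  majorant v g hg := by
    have hm : Measurable (Function.uncurry fun (v : E3) (p : CollParam) => gaussPair v p.1) :=
      measurable_gaussPair_comp measurable_fst measurable_snd.fst
    have hG : Measurable fun p : CollParam => g p.1 := hg.comp measurable_fst
    have key := lintegral_weight_le hC hm (fun _ _ => gaussPair_nonneg _ _) v hG
    simp only [weightLoss]
    refine key.trans ?_
    rw [ENNReal.coe_mul, mul_assoc]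
    refine mul_le_mul_right ?_ _
    rw [← lintegral_const_mul' _ _ ENNReal.coe_ne_top, ← lintegral_add_left_eq_self
      (fun w => ((4096 * angleArea : ℝ≥0) : ℝ≥0∞) * (ENNReal.ofReal (maj (w - v)) * g w)) v]
    refine lintegral_mono_ae ?_
    have hne : ∀ᵐ V : E3, V ≠ 0 := by simp [ae_iff]
    filter_upwards [hne] with V hV
    have hpt : ∀ θ ∈ Ioc 0 (Real.pi / 2),
        ENNReal.ofReal (‖V‖ ^ γ * Real.cos θ * Real.sin θ * gaussPair v (v + V)) * g (v + V) ≤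
          4096 * (ENNReal.ofReal (maj V) * g (v + V)) := by
      intro θ hθ
      rw [← mul_assoc]
      gcongr
      rw [show (4096 : ℝ≥0∞) = ENNReal.ofReal 4096 by simp, ← ENNReal.ofReal_mul (by norm_num)]
      refine ENNReal.ofReal_le_ofReal ?_
      have h1 := gaussPair_le v (v + V)
      rw [add_sub_cancel_left] at h1
      have hs : 0 ≤ Real.sin θ :=
        Real.sin_nonneg_of_nonneg_of_le_pi hθ.1.le (by linarith [hθ.2, Real.pi_pos])
      have h2 : Real.cos θ * Real.sin θ ≤ 1 := by
        nlinarith [Real.cos_le_one θ, Real.sin_le_one θ]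
      have h0 := gaussPair_nonneg v (v + V)
      calc ‖V‖ ^ γ * Real.cos θ * Real.sin θ * gaussPair v (v + V)
          = (Real.cos θ * Real.sin θ) * (‖V‖ ^ γ * gaussPair v (v + V)) := by ring
        _ ≤ 1 * (‖V‖ ^ γ * gaussPair v (v + V)) := by gcongr
        _ ≤ ‖V‖ ^ γ * Real.exp (-‖V‖ ^ 2 / 4) := by rw [one_mul]; gcongr
        _ ≤ _ := rpow_mul_exp_le_const_mul_profile hγ0 hγ1 (norm_pos_iff.2 hV)
    calc _ ≤ ∫⁻ ε in Ioc 0 (2 * Real.pi), ∫⁻ θ in Ioc 0 (Real.pi / 2),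
          4096 * (ENNReal.ofReal (maj V) * g (v + V)) :=
          lintegral_mono fun ε => setLIntegral_mono' measurableSet_Ioc hpt
      _ = _ := by
          simp only [lintegral_const, Measure.restrict_apply_univ, Real.volume_Ioc, sub_zero,
            add_sub_cancel_left, angleArea, ENNReal.coe_mul]
          rw [show ∀ x : ℝ, (x.toNNReal : ℝ≥0∞) = ENNReal.ofReal x from fun _ => rfl,
            show ∀ x : ℝ, (x.toNNReal : ℝ≥0∞) = ENNReal.ofReal x from fun _ => rfl]
          push_cast
          ring

end Kernels

/-! ### The integral operator `K` -/

/-- The sum of the three parts of `K`. -/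
def intK (B : ℝ → ℝ → ℝ) (f : E3 × E3 → ℝ) : E3 × E3 → ℝ :=
  velOp collMeasure (weightGainVs B) (fun v p => postVs v p.1 p.2.1 p.2.2) f +
    velOp collMeasure (weightGainV B) (fun v p => postV v p.1 p.2.1 p.2.2) f +
    -velOp collMeasure (weightLoss B) (fun _ p => p.1) f

/-- Integrability is needed to split the Bochner integrals of differences in `Q`. Of the four
resulting terms, the one proportional to `f(v)` is `-ν f` and cancels against the `+ν f` in the
definition of `K`. -/
theorem opK_eq_of_integrable {B : ℝ → ℝ → ℝ} {f : E3 × E3 → ℝ} {z : E3 × E3}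
    (hν : Integrable (fun p : CollParam => maxwellian p.1 * B ‖z.2 - p.1‖ p.2.2) collMeasure)
    (h₁ : Integrable (fun p : CollParam =>
      weightGainVs B z.2 p * f (z.1, postVs z.2 p.1 p.2.1 p.2.2)) collMeasure)
    (h₂ : Integrable (fun p : CollParam =>
      weightGainV B z.2 p * f (z.1, postV z.2 p.1 p.2.1 p.2.2)) collMeasure)
    (h₃ : Integrable (fun p : CollParam => weightLoss B z.2 p * f (z.1, p.1)) collMeasure) :
    opK B f z = intK B f z := by
  obtain ⟨x, v⟩ := z
  simp only at *
  set m : E3 → ℝ := fun w => Real.sqrt (maxwellian w) with hm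
  have hmm : ∀ w, maxwellian w = m w * m w := fun w =>
    (Real.mul_self_sqrt (maxwellian_pos w).le).symm
  have hgp : ∀ a b, gaussPair a b = m a * m b := fun _ _ => rfl
  have hm0 : m v ≠ 0 := (Real.sqrt_pos.2 (maxwellian_pos v)).ne'
  have hpost : ∀ p : CollParam, m (postV v p.1 p.2.1 p.2.2) * m (postVs v p.1 p.2.1 p.2.2) =
      m v * m p.1 := fun p => gaussPair_post v p.1 p.2.1 p.2.2
  have e1 : collisionQ B maxwellian (fun w => m w * f (x, w)) v =
      m v * ((∫ p, weightGainVs B v p * f (x, postVs v p.1 p.2.1 p.2.2) ∂collMeasure) -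
        ∫ p, weightLoss B v p * f (x, p.1) ∂collMeasure) := by
    rw [← integral_sub h₁ h₃, ← integral_const_mul]
    refine integral_congr_ae (Eventually.of_forall fun p => ?_)
    simp only [weightGainVs, weightLoss, hgp, hmm]
    linear_combination (m (postV v p.1 p.2.1 p.2.2) * f (x, postVs v p.1 p.2.1 p.2.2) *
      B ‖v - p.1‖ p.2.2) * hpost p
  have e2 : collisionQ B (fun w => m w * f (x, w)) maxwellian v =
      m v * (∫ p, weightGainV B v p * f (x, postV v p.1 p.2.1 p.2.2) ∂collMeasure) -
        m v * f (x, v) * collisionFreq B v := by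
    have e : collisionFreq B v =
        ∫ p : CollParam, maxwellian p.1 * B ‖v - p.1‖ p.2.2 ∂collMeasure := rfl
    rw [e, ← integral_const_mul, ← integral_const_mul, ← integral_sub (h₂.const_mul _)
      (hν.const_mul _)]
    refine integral_congr_ae (Eventually.of_forall fun p => ?_)
    simp only [weightGainV, hgp, hmm]
    linear_combination (m (postVs v p.1 p.2.1 p.2.2) * f (x, postV v p.1 p.2.1 p.2.2) *
      B ‖v - p.1‖ p.2.2) * hpost p
  simp only [opK, opKv, linearizedL, intK, velOp, paramOp, Pi.add_apply, Pi.neg_apply]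
  rw [e1, e2]
  change (m v)⁻¹ * _ + _ = _
  field_simp
  ring

section Op

variable {B : ℝ → ℝ → ℝ} {γ : ℝ} {C₀ : ℝ≥0}

theorem intK_l2Op (hγ0 : 0 ≤ γ) (hγ1 : γ ≤ 1) (hB : Measurable (Function.uncurry B))
    (hC : HasCutoff γ B C₀) : L2Op volume (intK B) :=
  ((velKernel_gainVs hγ0 hγ1 hB hC).l2Op.add_op (velKernel_gainV hγ0 hγ1 hB hC).l2Op).add_op
    (velKernel_loss hγ0 hγ1 hB hC).l2Op.neg_op

theorem opK_ae_eq (hγ0 : 0 ≤ γ) (hγ1 : γ ≤ 1) (hB : Measurable (Function.uncurry B))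
    (hC : HasCutoff γ B C₀) (hν : ∀ v, 0 < collisionFreq B v) {f : E3 × E3 → ℝ}
    (hf : MemLp f 2) : opK B f =ᵐ[volume] intK B f := by
  -- A Bochner integral of a non-integrable function is `0`, so positivity of `ν(v)` already forces
  -- its integrand to be integrable.
  have hνi : ∀ v, Integrable (fun p : CollParam => maxwellian p.1 * B ‖v - p.1‖ p.2.2)
      collMeasure := by
    intro v
    by_contra h
    exact (hν v).ne' (integral_undef h)
  filter_upwards [(velKernel_gainVs hγ0 hγ1 hB hC).schurBound.integrable hf,
    (velKernel_gainV hγ0 hγ1 hB hC).schurBound.integrable hf,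
    (velKernel_loss hγ0 hγ1 hB hC).schurBound.integrable hf] with z h1 h2 h3
  exact opK_eq_of_integrable (hνi z.2) h1 h2 h3

/-- Velocity averaging for `K` composed with the transport resolvent. -/
theorem exists_eLpNorm_diffX_intK_raySol_le (hγ0 : 0 ≤ γ) (hγ1 : γ ≤ 1)
    (hB : Measurable (Function.uncurry B)) (hC : HasCutoff γ B C₀) {θ : ℝ} (hθ0 : 0 ≤ θ)
    (hθ1 : θ < 1) :
    ∃ D : ℝ≥0, ∀ h : E3 × E3 → ℝ, MemLp h 2 → ∀ a : E3,
      eLpNorm (diffX a (intK B (raySol h))) 2 volume ≤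
        D * ENNReal.ofReal (‖a‖ ^ (θ / 2)) * eLpNorm h 2 volume := by
  have k1 := velKernel_gainVs hγ0 hγ1 hB hC
  have k2 := velKernel_gainV hγ0 hγ1 hB hC
  have k3 := velKernel_loss hγ0 hγ1 hB hC
  obtain ⟨D1, hD1⟩ := exists_eLpNorm_diffX_velOp_raySol_le k1 hθ0 hθ1
  obtain ⟨D2, hD2⟩ := exists_eLpNorm_diffX_velOp_raySol_le k2 hθ0 hθ1
  obtain ⟨D3, hD3⟩ := exists_eLpNorm_diffX_velOp_raySol_le k3 hθ0 hθ1
  refine ⟨D1 + D2 + D3, fun h hh a => ?_⟩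
  have hR := raySol_l2Op.memLp hh
  set f1 := velOp collMeasure (weightGainVs B) (fun v p => postVs v p.1 p.2.1 p.2.2) (raySol h)
  set f2 := velOp collMeasure (weightGainV B) (fun v p => postV v p.1 p.2.1 p.2.2) (raySol h)
  set f3 := velOp collMeasure (weightLoss B) (fun _ p => p.1) (raySol h)
  have e : diffX a (intK B (raySol h)) = diffX a f1 + diffX a f2 + -diffX a f3 := by
    ext z
    simp only [diffX, shiftX, intK, Pi.add_apply, Pi.sub_apply, Pi.neg_apply]
    ring
  have m1 := memLp_diffX (k1.l2Op.memLp hR) a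
  have m2 := memLp_diffX (k2.l2Op.memLp hR) a
  have m3 := memLp_diffX (k3.l2Op.memLp hR) a
  rw [e]
  calc _ ≤ eLpNorm (diffX a f1 + diffX a f2) 2 volume + eLpNorm (-diffX a f3) 2 volume :=
        eLpNorm_add_le (m1.add m2).1 m3.neg.1 one_le_two
    _ ≤ eLpNorm (diffX a f1) 2 volume + eLpNorm (diffX a f2) 2 volume +
          eLpNorm (diffX a f3) 2 volume := by
        rw [eLpNorm_neg]
        gcongr
        exact eLpNorm_add_le m1.1 m2.1 one_le_two
    _ ≤ D1 * ENNReal.ofReal (‖a‖ ^ (θ / 2)) * eLpNorm h 2 volume +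
          D2 * ENNReal.ofReal (‖a‖ ^ (θ / 2)) * eLpNorm h 2 volume +
          D3 * ENNReal.ofReal (‖a‖ ^ (θ / 2)) * eLpNorm h 2 volume := by
        gcongr
        · exact hD1 h hh a
        · exact hD2 h hh a
        · exact hD3 h hh a
    _ = _ := by push_cast; ring

end Op

/-! ### The transport resolvent with velocity-dependent absorption -/

/-- Weighted integration along backward characteristics. -/
def rayOp (w : E3 → ℝ → ℝ) : (E3 × E3 → ℝ) → E3 × E3 → ℝ :=
  paramOp (volume.restrict (Ioi 0)) (fun z s => w z.2 s) (fun z s => (z.1 - s • z.2, z.2))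

theorem rayOp_schurBound {w : E3 → ℝ → ℝ} (hw : Measurable (Function.uncurry w)) {C : ℝ≥0}
    (hC : ∀ v, ∫⁻ s in Ioi 0, ‖w v s‖ₑ ≤ C) :
    SchurBound (volume : Measure (E3 × E3)) (volume.restrict (Ioi 0)) (fun z s => w z.2 s)
      (fun z s => (z.1 - s • z.2, z.2)) C where
  meas_b := hw.comp (measurable_fst.snd.prodMk measurable_snd)
  meas_Φ := by unfold Function.uncurry; fun_prop
  row z := hC z.2
  col g hg := by
    have m1 : Measurable fun q : (E3 × E3) × ℝ =>
        ‖w q.1.2 q.2‖ₑ * g (q.1.1 - q.2 • q.1.2, q.1.2) :=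
      (hw.comp (measurable_fst.snd.prodMk measurable_snd)).enorm.mul (by fun_prop)
    have m2 : ∀ v : E3, Measurable fun q : E3 × ℝ => ‖w v q.2‖ₑ * g (q.1 - q.2 • v, v) := fun v =>
      m1.comp (f := fun q : E3 × ℝ => ((q.1, v), q.2)) (by fun_prop)
    rw [Measure.volume_eq_prod, lintegral_prod_symm _ m1.lintegral_prod_right'.aemeasurable,
      lintegral_prod_symm _ hg.aemeasurable, ← lintegral_const_mul' _ _ ENNReal.coe_ne_top]
    refine lintegral_mono fun v => ?_
    simp only
    rw [lintegral_lintegral_swap (m2 v).aemeasurable]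
    calc _ = ∫⁻ s in Ioi 0, ‖w v s‖ₑ * ∫⁻ x, g (x, v) := by
          refine lintegral_congr fun s => ?_
          rw [lintegral_const_mul' _ _ enorm_ne_top]
          congr 1
          exact lintegral_sub_right_eq_self (fun x => g (x, v)) (s • v)
      _ = (∫⁻ s in Ioi 0, ‖w v s‖ₑ) * ∫⁻ x, g (x, v) :=
          lintegral_mul_const _ (hw.comp measurable_prodMk_left).enorm
      _ ≤ _ := by gcongr; exact hC v

/-- The solution operator of `ν f + v · ∇f = h` on the whole space. -/
def resolvent (ν : E3 → ℝ) : (E3 × E3 → ℝ) → E3 × E3 → ℝ :=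
  rayOp fun v s => Real.exp (-ν v * s)

theorem lintegral_exp_neg_mul_Ioi {a : ℝ} (ha : 0 < a) :
    ∫⁻ s in Ioi 0, ‖Real.exp (-a * s)‖ₑ = ENNReal.ofReal a⁻¹ := by
  have h1 := integral_exp_mul_Ioi (a := -a) (by linarith) 0
  have h2 := integrableOn_exp_mul_Ioi (a := -a) (by linarith) 0
  simp only [Real.enorm_of_nonneg (Real.exp_pos _).le]
  rw [← ofReal_integral_eq_lintegral_ofReal h2 (Eventually.of_forall fun s => (Real.exp_pos _).le),
    h1]
  simp

section Resolvent

variable {ν : E3 → ℝ} {ν₀ : ℝ}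

theorem resolvent_schurBound (hν : Measurable ν) (hν₀ : 0 < ν₀) (h : ∀ v, ν₀ ≤ ν v) :
    SchurBound (volume : Measure (E3 × E3)) (volume.restrict (Ioi 0))
      (fun z s => Real.exp (-ν z.2 * s)) (fun z s => (z.1 - s • z.2, z.2)) ν₀⁻¹.toNNReal := by
  refine rayOp_schurBound (w := fun v s => Real.exp (-ν v * s))
    (by unfold Function.uncurry; fun_prop) fun v => ?_
  rw [lintegral_exp_neg_mul_Ioi (hν₀.trans_le (h v))]
  exact ENNReal.ofReal_le_ofReal (inv_anti₀ hν₀ (h v))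

theorem resolvent_l2Op (hν : Measurable ν) (hν₀ : 0 < ν₀) (h : ∀ v, ν₀ ≤ ν v) :
    L2Op volume (resolvent ν) := (resolvent_schurBound hν hν₀ h).l2Op

/-- Even where `ν` is large the resolvent compensates: `∫ |ν - 1| exp(-ν s) ds ≤ (ν + 1) / ν ≤ 1 + 1
/ ν₀`. -/
theorem sub_one_mul_resolvent_l2Op (hν : Measurable ν) (hν₀ : 0 < ν₀) (h : ∀ v, ν₀ ≤ ν v) :
    L2Op volume fun f z => (ν z.2 - 1) * resolvent ν f z := by
  have e : (fun (f : E3 × E3 → ℝ) z => (ν z.2 - 1) * resolvent ν f z) =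
      rayOp fun v s => (ν v - 1) * Real.exp (-ν v * s) := by
    ext f z
    simp only [resolvent, rayOp, paramOp, ← integral_const_mul]
    exact integral_congr_ae (Eventually.of_forall fun s => by ring)
  rw [e]
  refine (rayOp_schurBound (w := fun v s => (ν v - 1) * Real.exp (-ν v * s))
    (C := 1 + ν₀⁻¹.toNNReal)
    (by unfold Function.uncurry; fun_prop) fun v => ?_).l2Op
  have h0 := hν₀.trans_le (h v)
  simp only [enorm_mul]
  rw [lintegral_const_mul' _ _ enorm_ne_top, lintegral_exp_neg_mul_Ioi h0, ← ofReal_norm,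
    ← ENNReal.ofReal_mul (norm_nonneg _)]
  push_cast
  rw [← ENNReal.ofReal_one, show ((ν₀⁻¹.toNNReal : ℝ≥0) : ℝ≥0∞) = ENNReal.ofReal ν₀⁻¹ from rfl,
    ← ENNReal.ofReal_add zero_le_one (by positivity)]
  refine ENNReal.ofReal_le_ofReal ?_
  have h1 : ‖ν v - 1‖ ≤ ν v + 1 := by
    rw [Real.norm_eq_abs, abs_le]; constructor <;> linarith
  calc _ ≤ (ν v + 1) * (ν v)⁻¹ := by gcongr
    _ = 1 + (ν v)⁻¹ := by field_simp
    _ ≤ _ := by have := inv_anti₀ hν₀ (h v); linarith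

/-- The resolvent identity on a half-line. -/
theorem integral_exp_resolvent {H : ℝ → ℝ} {c : ℝ}
    (h1 : IntegrableOn (fun s => Real.exp (-s) * H s) (Ioi 0))
    (hc : IntegrableOn (fun s => Real.exp (-c * s) * H s) (Ioi 0)) :
    IntegrableOn (fun s => Real.exp (-s) *
        ((c - 1) * ∫ t in Ioi 0, Real.exp (-c * t) * H (s + t))) (Ioi 0) ∧
      ∫ s in Ioi 0, Real.exp (-s) * ((c - 1) * ∫ t in Ioi 0, Real.exp (-c * t) * H (s + t)) =
        (∫ s in Ioi 0, Real.exp (-s) * H s) - ∫ s in Ioi 0, Real.exp (-c * s) * H s := by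
  set μ : Measure ℝ := volume.restrict (Ioi 0) with hμ
  -- With `σ = s + t`, the double integral lives on the triangle `s < σ` and its kernel is `k(s, σ)
  -- exp(-c σ)`. Integrating in `s` first gives `exp((c - 1) σ) - 1`, hence the difference of the
  -- two exponentials.
  set k : ℝ → ℝ → ℝ := fun s σ => (Iio σ).indicator (fun s => (c - 1) * Real.exp ((c - 1) * s)) s
    with hk
  have hkm : Measurable (Function.uncurry k) := by
    have : Function.uncurry k = {q : ℝ × ℝ | q.1 < q.2}.indicator
        fun q => (c - 1) * Real.exp ((c - 1) * q.1) := by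
      ext q; simp [k, indicator, Function.uncurry]
    rw [this]
    exact Measurable.indicator (by fun_prop) (measurableSet_lt measurable_fst measurable_snd)
  set G : ℝ × ℝ → ℝ := fun q => k q.1 q.2 * (Real.exp (-c * q.2) * H q.2) with hG
  have hkint : ∀ σ : ℝ, 0 < σ → IntegrableOn (fun s => (c - 1) * Real.exp ((c - 1) * s))
      (Ioo 0 σ) ∧ ∫ s in Ioo 0 σ, (c - 1) * Real.exp ((c - 1) * s) =
        Real.exp ((c - 1) * σ) - 1 := by
    intro σ hσ
    have hcont : Continuous fun s => (c - 1) * Real.exp ((c - 1) * s) := by fun_prop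
    refine ⟨(hcont.integrableOn_Icc).mono_set Ioo_subset_Icc_self, ?_⟩
    rw [← integral_Ioc_eq_integral_Ioo, ← intervalIntegral.integral_of_le hσ.le,
      intervalIntegral.integral_eq_sub_of_hasDerivAt (f := fun s => Real.exp ((c - 1) * s))
        (fun s _ => ?_) (hcont.intervalIntegrable _ _)]
    · simp
    · have := ((hasDerivAt_id s).const_mul (c - 1)).exp
      simpa [mul_comm] using this
  have hkμ : ∀ σ : ℝ, 0 < σ → Integrable (fun s => k s σ) μ ∧
      ∫ s, k s σ ∂μ = Real.exp ((c - 1) * σ) - 1 := by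
    intro σ hσ
    have e : Iio σ ∩ Ioi 0 = Ioo 0 σ := by rw [inter_comm]; rfl
    refine ⟨?_, ?_⟩
    · rw [hμ, integrable_indicator_iff measurableSet_Iio, IntegrableOn,
        Measure.restrict_restrict measurableSet_Iio, e]
      exact (hkint σ hσ).1
    · rw [hμ, integral_indicator measurableSet_Iio, Measure.restrict_restrict measurableSet_Iio, e]
      exact (hkint σ hσ).2
  have hexp : ∀ σ, Real.exp ((c - 1) * σ) * Real.exp (-c * σ) = Real.exp (-σ) := fun σ => by
    rw [← Real.exp_add]; congr 1; ring
  -- The kernel has the constant sign of `c - 1`, so its `L¹` norm is the modulus of its integral.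
  -- Absolute integrability on the triangle then follows from that of the difference of the two
  -- given integrands.
  have hnorm : ∀ σ : ℝ, 0 < σ → ∫ s, ‖k s σ‖ ∂μ = |Real.exp ((c - 1) * σ) - 1| := by
    intro σ hσ
    rw [← (hkμ σ hσ).2]
    rcases le_total 0 (c - 1) with h | h
    · have h0 : ∀ s, 0 ≤ k s σ := fun s =>
        indicator_nonneg (fun _ _ => mul_nonneg h (Real.exp_pos _).le) s
      rw [abs_of_nonneg (integral_nonneg h0)]
      exact integral_congr_ae (Eventually.of_forall fun s => Real.norm_of_nonneg (h0 s))
    · have h0 : ∀ s, k s σ ≤ 0 := fun s =>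
        indicator_nonpos (fun _ _ => mul_nonpos_of_nonpos_of_nonneg h (Real.exp_pos _).le) s
      rw [abs_of_nonpos (integral_nonpos h0), ← integral_neg]
      exact integral_congr_ae (Eventually.of_forall fun s => Real.norm_of_nonpos (h0 s))
  have hGint : Integrable G (μ.prod μ) := by
    refine (integrable_prod_iff' ?_).2 ⟨?_, ?_⟩
    · exact hkm.aestronglyMeasurable.mul hc.aestronglyMeasurable.comp_snd
    · filter_upwards [ae_restrict_mem measurableSet_Ioi] with σ hσ
      exact (hkμ σ hσ).1.mul_const (Real.exp (-c * σ) * H σ)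
    · refine ((h1.sub hc).norm).congr ?_
      filter_upwards [ae_restrict_mem measurableSet_Ioi] with σ hσ
      simp only [hG, norm_mul, Pi.sub_apply]
      rw [integral_mul_const, hnorm σ hσ, ← norm_mul, ← Real.norm_eq_abs, ← norm_mul, ← hexp]
      congr 1
      ring
  have hleft : ∀ s ∈ Ioi (0 : ℝ), ∫ σ, G (s, σ) ∂μ =
      Real.exp (-s) * ((c - 1) * ∫ t in Ioi 0, Real.exp (-c * t) * H (s + t)) := by
    intro s hs
    have e1 : ∀ σ, G (s, σ) = (Ioi s).indicator (fun σ => ((c - 1) * Real.exp ((c - 1) * s)) *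
        (Real.exp (-c * σ) * H σ)) σ := by
      intro σ
      by_cases h : s < σ <;> simp [G, k, h]
    simp_rw [e1]
    rw [hμ, integral_indicator measurableSet_Ioi, Measure.restrict_restrict measurableSet_Ioi,
      inter_eq_left.2 (Ioi_subset_Ioi (le_of_lt hs)), integral_const_mul]
    have e2 : ∫ σ in Ioi s, Real.exp (-c * σ) * H σ =
        Real.exp (-c * s) * ∫ t in Ioi 0, Real.exp (-c * t) * H (s + t) := by
      rw [← integral_const_mul, ← integral_indicator measurableSet_Ioi,
        ← integral_indicator measurableSet_Ioi, ← integral_add_left_eq_self _ s]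
      refine integral_congr_ae (Eventually.of_forall fun t => ?_)
      simp only [indicator, mem_Ioi, lt_add_iff_pos_right]
      split_ifs
      · rw [mul_add, Real.exp_add]; ring
      · rfl
    rw [e2, ← hexp]
    ring
  have hright : ∫ σ, ∫ s, G (s, σ) ∂μ ∂μ =
      (∫ s, Real.exp (-s) * H s ∂μ) - ∫ s, Real.exp (-c * s) * H s ∂μ := by
    rw [← integral_sub h1 hc]
    refine integral_congr_ae ?_
    filter_upwards [ae_restrict_mem measurableSet_Ioi] with σ hσ
    simp only [hG]
    rw [integral_mul_const, (hkμ σ hσ).2, ← hexp]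
    ring
  refine ⟨hGint.integral_prod_left.congr ?_, ?_⟩
  · filter_upwards [ae_restrict_mem measurableSet_Ioi] with s hs
    exact hleft s hs
  · rw [← hright, ← integral_integral_swap hGint]
    refine integral_congr_ae ?_
    filter_upwards [ae_restrict_mem measurableSet_Ioi] with s hs
    exact (hleft s hs).symm

/-- If `ν u + v · ∇u = f`, then `u + v · ∇u = f - (ν - 1) u`; the identity is checked on almost
every characteristic. It makes the law of the times independent of the velocity, as the averaging
argument requires. -/
theorem resolvent_ae_eq_raySol (hν : Measurable ν) (hν₀ : 0 < ν₀) (h : ∀ v, ν₀ ≤ ν v)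
    {f : E3 × E3 → ℝ} (hf : MemLp f 2) :
    resolvent ν f =ᵐ[volume] raySol (f - fun z => (ν z.2 - 1) * resolvent ν f z) := by
  filter_upwards [raySol_schurBound.integrable hf,
    (resolvent_schurBound hν hν₀ h).integrable hf] with z h1 h2
  obtain ⟨x, v⟩ := z
  simp only [one_mul] at h1 h2
  set H : ℝ → ℝ := fun s => f (x - s • v, v) with hH
  have h1' : IntegrableOn (fun s => Real.exp (-s) * H s) (Ioi 0) := by
    rw [expLaw, integrable_withDensity_iff_integrable_smul' (by fun_prop) (by simp)] at h1
    unfold IntegrableOn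
    simpa [ENNReal.toReal_ofReal, (Real.exp_pos _).le] using h1
  obtain ⟨h3, h4⟩ := integral_exp_resolvent h1' h2
  have e : ∀ s t : ℝ, f (x - s • v - t • v, v) = H (s + t) := fun s t => by
    simp only [hH]; rw [add_smul, sub_sub]
  simp only [raySol, paramOp, one_mul, Pi.sub_apply, integral_expLaw, resolvent, rayOp, e, mul_sub]
  have e' : ∀ s, Real.exp (-s) * f (x - s • v, v) = Real.exp (-s) * H s := fun _ => rfl
  simp only [e']
  rw [integral_sub h1' h3, h4]
  simp only [hH]
  ring

end Resolvent

/-- Velocity averaging for `K` composed with the transport resolvent. -/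
theorem exists_eLpNorm_diffX_intK_resolvent_le {B : ℝ → ℝ → ℝ} {γ : ℝ} {C₀ : ℝ≥0} (hγ0 : 0 ≤ γ)
    (hγ1 : γ ≤ 1) (hB : Measurable (Function.uncurry B)) (hC : HasCutoff γ B C₀) {ν : E3 → ℝ}
    {ν₀ : ℝ} (hν : Measurable ν) (hν₀ : 0 < ν₀) (hle : ∀ v, ν₀ ≤ ν v) {θ : ℝ} (hθ0 : 0 ≤ θ)
    (hθ1 : θ < 1) :
    ∃ D : ℝ≥0, ∀ h : E3 × E3 → ℝ, MemLp h 2 → ∀ a : E3,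
      eLpNorm (diffX a (intK B (resolvent ν h))) 2 volume ≤
        D * ENNReal.ofReal (‖a‖ ^ (θ / 2)) * eLpNorm h 2 volume := by
  obtain ⟨D, hD⟩ := exists_eLpNorm_diffX_intK_raySol_le hγ0 hγ1 hB hC hθ0 hθ1
  have hop := sub_one_mul_resolvent_l2Op hν hν₀ hle
  obtain ⟨E, hE⟩ := hop.bound
  refine ⟨D * (1 + E), fun h hh a => ?_⟩
  have h2 := hE h hh
  have hR := (resolvent_l2Op hν hν₀ hle).memLp hh
  rw [eLpNorm_congr_ae (diffX_congr ((intK_l2Op hγ0 hγ1 hB hC).congr _ _ hR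
    (resolvent_ae_eq_raySol hν hν₀ hle hh)) a)]
  refine (hD _ (hh.sub h2.1) a).trans ?_
  calc _ ≤ D * ENNReal.ofReal (‖a‖ ^ (θ / 2)) *
        (eLpNorm h 2 volume + E * eLpNorm h 2 volume) := by
        gcongr
        exact (eLpNorm_sub_le hh.1 h2.1.1 one_le_two).trans (add_le_add_right h2.2 _)
    _ = _ := by push_cast; ring

/-! ### The transport operator of a convex domain -/

theorem measurable_collisionFreq {B : ℝ → ℝ → ℝ} (hB : Measurable (Function.uncurry B)) :
    Measurable (collisionFreq B) := by
  have h : Measurable (Function.uncurry fun (v : E3) (p : CollParam) =>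
      maxwellian p.1 * B ‖v - p.1‖ p.2.2) :=
    (measurable_maxwellian.comp measurable_snd.fst).mul (measurable_crossSection hB)
  exact (h.stronglyMeasurable.integral_prod_right (ν := collMeasure)).measurable

/-- By convexity the backward ray from a point of `Ω` stays in `Ω` before the exit time and never
returns after it. Stopping the integral there is therefore the same as extending `f` by zero; the
time `s = τ` itself is negligible. -/
theorem opS_eq_resolvent {B : ℝ → ℝ → ℝ} {Ω : Set E3} (hc : Convex ℝ Ω)
    (hb : Bornology.IsBounded Ω) (f : E3 × E3 → ℝ) {x v : E3} (hx : x ∈ Ω) (hv : v ≠ 0) :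
    opS B Ω f (x, v) = resolvent (collisionFreq B) ((Ω ×ˢ univ).indicator f) (x, v) := by
  set T : Set ℝ := {t : ℝ | 0 < t ∧ x - t • v ∉ Ω} with hT
  have hTb : BddBelow T := ⟨0, fun t ht => ht.1.le⟩
  -- Boundedness of `Ω` and `v ≠ 0` are needed here: for an empty set `sInf` would be `0` and not
  -- infinity.
  have hTn : T.Nonempty := by
    obtain ⟨R, hR⟩ := hb.exists_norm_le
    have hv' := norm_pos_iff.2 hv
    have hxR := (norm_nonneg x).trans (hR x hx)
    refine ⟨(2 * R + 1) / ‖v‖, by positivity, fun hmem => ?_⟩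
    have h1 := hR _ hmem
    have h2 : ‖((2 * R + 1) / ‖v‖) • v‖ = 2 * R + 1 := by
      rw [norm_smul, Real.norm_of_nonneg (by positivity)]
      field_simp
    have h3 := norm_sub_norm_le (((2 * R + 1) / ‖v‖) • v) x
    rw [norm_sub_rev] at h3
    have h4 := hR x hx
    linarith
  set τ := exitTime Ω x v with hτ
  have hτ0 : 0 ≤ τ := Real.sInf_nonneg fun t ht => ht.1.le
  have hin : ∀ s, 0 < s → s < τ → x - s • v ∈ Ω := by
    intro s hs hst
    by_contra hcon
    exact absurd (csInf_le hTb ⟨hs, hcon⟩) (not_le.2 hst)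
  have hout : ∀ s, 0 < s → x - s • v ∈ Ω → s ≤ τ := by
    intro s hs hmem
    refine le_csInf hTn fun t ht => ?_
    by_contra hts
    rw [not_le] at hts
    refine ht.2 ?_
    have := hc hx hmem (a := 1 - t / s) (b := t / s)
      (by rw [sub_nonneg, div_le_one hs]; exact hts.le) (div_nonneg ht.1.le hs.le) (by ring)
    convert this using 1
    rw [smul_sub, smul_smul, div_mul_cancel₀ _ hs.ne', sub_smul, one_smul]
    abel
  simp only [opS, resolvent, rayOp, paramOp]
  rw [← hτ, intervalIntegral.integral_of_le hτ0, ← inter_eq_left.2 (Ioc_subset_Ioi_self :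
    Ioc 0 τ ⊆ Ioi 0), ← Measure.restrict_restrict measurableSet_Ioc,
    ← integral_indicator measurableSet_Ioc]
  refine integral_congr_ae ?_
  have hne : ∀ᵐ s : ℝ, s ≠ τ := by simp [ae_iff]
  filter_upwards [ae_restrict_mem measurableSet_Ioi, ae_restrict_of_ae hne] with s hs hsτ
  rcases lt_or_gt_of_ne hsτ with h | h
  · rw [indicator_of_mem (show s ∈ Ioc 0 τ from ⟨hs, h.le⟩),
      indicator_of_mem (show (x - s • v, v) ∈ Ω ×ˢ univ from ⟨hin s hs h, mem_univ _⟩)]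
  · rw [indicator_of_notMem (fun hm : s ∈ Ioc 0 τ => not_le.2 h hm.2),
      indicator_of_notMem (fun hm : (x - s • v, v) ∈ Ω ×ˢ univ => not_le.2 h (hout s hs hm.1)),
      mul_zero]

/-! ### The norm of `L²(ℝ³ × ℝ³)` -/

/-- The norm of `L²(ℝ³ × ℝ³)` as a real number. -/
def l2norm (f : E3 × E3 → ℝ) : ℝ := (eLpNorm f 2 volume).toReal

theorem l2norm_nonneg (f : E3 × E3 → ℝ) : 0 ≤ l2norm f := ENNReal.toReal_nonneg

theorem ofReal_l2norm {f : E3 × E3 → ℝ} (hf : MemLp f 2) :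
    ENNReal.ofReal (l2norm f) = eLpNorm f 2 volume := ENNReal.ofReal_toReal hf.2.ne

theorem l2norm_le_of_eLpNorm_le {f g : E3 × E3 → ℝ} (hg : MemLp g 2) {c : ℝ} (hc : 0 ≤ c)
    (h : eLpNorm f 2 volume ≤ ENNReal.ofReal c * eLpNorm g 2 volume) :
    l2norm f ≤ c * l2norm g := by
  rw [← ofReal_l2norm hg, ← ENNReal.ofReal_mul hc] at h
  exact ENNReal.toReal_le_of_le_ofReal (mul_nonneg hc (l2norm_nonneg g)) h

theorem l2norm_add_le {f g : E3 × E3 → ℝ} (hf : MemLp f 2) (hg : MemLp g 2) :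
    l2norm (f + g) ≤ l2norm f + l2norm g := by
  unfold l2norm
  rw [← ENNReal.toReal_add hf.2.ne hg.2.ne]
  exact ENNReal.toReal_mono (ENNReal.add_ne_top.2 ⟨hf.2.ne, hg.2.ne⟩)
    (eLpNorm_add_le hf.1 hg.1 one_le_two)

theorem l2norm_sub_le {f g : E3 × E3 → ℝ} (hf : MemLp f 2) (hg : MemLp g 2) :
    l2norm (f - g) ≤ l2norm f + l2norm g := by
  have := l2norm_add_le hf hg.neg
  rw [← sub_eq_add_neg] at this
  simpa only [l2norm, eLpNorm_neg] using this

theorem l2norm_shiftX {f : E3 × E3 → ℝ} (hf : MemLp f 2) (a : E3) :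
    l2norm (shiftX a f) = l2norm f := by rw [l2norm, eLpNorm_shiftX hf.1, l2norm]

theorem l2norm_diffX_le {f : E3 × E3 → ℝ} (hf : MemLp f 2) (a : E3) :
    l2norm (diffX a f) ≤ 2 * l2norm f := by
  have := l2norm_sub_le (memLp_shiftX hf a) hf
  rw [l2norm_shiftX hf] at this
  rw [two_mul]
  exact this

theorem l2norm_indicator_le {f : E3 × E3 → ℝ} (hf : MemLp f 2) (s : Set (E3 × E3)) :
    l2norm (s.indicator f) ≤ l2norm f :=
  ENNReal.toReal_mono hf.2.ne (eLpNorm_indicator_le f)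

theorem l2norm_indicator_mono {f : E3 × E3 → ℝ} (hf : MemLp f 2) {s t : Set (E3 × E3)}
    (hst : s ⊆ t) : l2norm (s.indicator f) ≤ l2norm (t.indicator f) := by
  have : s.indicator f = s.indicator (t.indicator f) := by
    rw [indicator_indicator, inter_eq_left.2 hst]
  rw [this]
  exact ENNReal.toReal_mono ((eLpNorm_indicator_le f).trans_lt hf.2).ne (eLpNorm_indicator_le _)

theorem l2norm_sq_indicator_add_le {f : E3 × E3 → ℝ} (hf : MemLp f 2) {s t u : Set (E3 × E3)}
    (hs : MeasurableSet s) (ht : MeasurableSet t) (hu : MeasurableSet u) (hst : Disjoint s t)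
    (hsu : s ⊆ u) (htu : t ⊆ u) :
    l2norm (s.indicator f) ^ 2 + l2norm (t.indicator f) ^ 2 ≤ l2norm (u.indicator f) ^ 2 := by
  have key : ∀ {r : Set (E3 × E3)}, MeasurableSet r →
      eLpNorm (r.indicator f) 2 volume ^ 2 = ∫⁻ z in r, ‖f z‖ₑ ^ 2 := fun {r} hr => by
    rw [eLpNorm_indicator_eq_eLpNorm_restrict hr, eLpNorm_two_sq]
  have fin : ∀ r : Set (E3 × E3), eLpNorm (r.indicator f) 2 volume ^ 2 ≠ ∞ := fun r =>
    ENNReal.pow_ne_top ((eLpNorm_indicator_le f).trans_lt hf.2).ne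
  unfold l2norm
  rw [← ENNReal.toReal_pow, ← ENNReal.toReal_pow, ← ENNReal.toReal_pow,
    ← ENNReal.toReal_add (fin s) (fin t)]
  refine ENNReal.toReal_mono (fin u) ?_
  rw [key hs, key ht, key hu, ← lintegral_union ht hst]
  exact lintegral_mono_set (union_subset hsu htu)

/-! ### Differences at dyadic scales -/

/-- Doubling `t` up to scale `1`, where the trivial bound `N` suffices, costs a factor `lam * 2 ^ s
< 1` at each step, so the errors form a convergent geometric series. The constant `K` is chosen so
that `lam * 2 ^ s * K + c ≤ K`. The recursion serves both for boundary strips (`lam = 2^(-1/2)`) and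
for second differences (`lam = 1/2`). -/
theorem le_rpow_of_dyadic {m : ℝ → ℝ} {lam c s N : ℝ} (hlam : 0 ≤ lam) (hs : 0 < s)
    (hlt : lam * 2 ^ s < 1) (hc : 0 ≤ c) (hN : 0 ≤ N) (hm : ∀ t, m t ≤ N)
    (hrec : ∀ t, 0 < t → t ≤ 1 → m t ≤ lam * m (2 * t) + c * t ^ s) {t : ℝ} (ht0 : 0 < t) :
    m t ≤ (N + c / (1 - lam * 2 ^ s)) * t ^ s := by
  set K := N + c / (1 - lam * 2 ^ s) with hK
  have h1 : 0 < 1 - lam * 2 ^ s := by linarith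
  have hNK : N ≤ K := by have := div_nonneg hc h1.le; linarith
  have hKc : lam * 2 ^ s * K + c ≤ K := by
    have : c / (1 - lam * 2 ^ s) * (1 - lam * 2 ^ s) = c := div_mul_cancel₀ _ h1.ne'
    nlinarith [mul_nonneg hN h1.le]
  have hbig : ∀ t, 1 ≤ t → m t ≤ K * t ^ s := fun t ht =>
    calc m t ≤ K * 1 := by rw [mul_one]; exact (hm t).trans hNK
      _ ≤ _ := mul_le_mul_of_nonneg_left (Real.one_le_rpow ht hs.le) (hN.trans hNK)
  have ind : ∀ n : ℕ, ∀ t : ℝ, (1 / 2) ^ n ≤ t → m t ≤ K * t ^ s := by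
    intro n
    induction n with
    | zero => intro t ht; exact hbig t (by simpa using ht)
    | succ n ih =>
      intro t ht
      rcases le_total 1 t with h | h
      · exact hbig t h
      have h0 : 0 < t := lt_of_lt_of_le (by positivity) ht
      have h2 := ih (2 * t) (by rw [pow_succ] at ht; linarith)
      rw [Real.mul_rpow (by norm_num) h0.le] at h2
      calc m t ≤ lam * m (2 * t) + c * t ^ s := hrec t h0 h
        _ ≤ lam * (K * (2 ^ s * t ^ s)) + c * t ^ s := by gcongr
        _ = (lam * 2 ^ s * K + c) * t ^ s := by ring
        _ ≤ _ := by gcongr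
  obtain ⟨n, hn⟩ := exists_pow_lt_of_lt_one ht0 (show (1 / 2 : ℝ) < 1 by norm_num)
  exact ind n t hn.le

/-! ### Truncation to a convex set -/

/-- The points of the strip of width `t` in the direction `e` along the part of the boundary of
`Ω + ℝ₋ e`. -/
def strip (Ω : Set E3) (e : E3) (t : ℝ) : Set E3 :=
  {x | (∃ s : ℝ, 0 ≤ s ∧ x + s • e ∈ Ω) ∧ ¬ ∃ s : ℝ, 0 ≤ s ∧ x + t • e + s • e ∈ Ω}

theorem measurableSet_strip {Ω : Set E3} (hΩ : IsOpen Ω) (e : E3) (t : ℝ) :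
    MeasurableSet (strip Ω e t) := by
  have h : IsOpen {x : E3 | ∃ s : ℝ, 0 ≤ s ∧ x + s • e ∈ Ω} := by
    have : {x : E3 | ∃ s : ℝ, 0 ≤ s ∧ x + s • e ∈ Ω} =
        ⋃ s : ℝ, ⋃ _ : 0 ≤ s, (fun x => x + s • e) ⁻¹' Ω := by ext x; simp
    rw [this]
    exact isOpen_iUnion fun s => isOpen_iUnion fun _ => hΩ.preimage (by fun_prop)
  have h' : IsOpen {x : E3 | ∃ s : ℝ, 0 ≤ s ∧ x + t • e + s • e ∈ Ω} :=
    h.preimage (f := fun x => x + t • e) (by fun_prop)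
  exact h.measurableSet.inter h'.measurableSet.compl

theorem strip_add_smul_iff {Ω : Set E3} {e x : E3} {t : ℝ} :
    x + t • e ∈ strip Ω e t ↔ (∃ s : ℝ, 0 ≤ s ∧ x + t • e + s • e ∈ Ω) ∧
      ¬ ∃ s : ℝ, 0 ≤ s ∧ x + (2 * t) • e + s • e ∈ Ω := by
  have : x + (2 * t) • e = x + t • e + t • e := by rw [two_mul, add_smul, add_assoc]
  rw [this]; rfl

/-- The strip of width `t` and its translate by `-t e` are disjoint and both lie in the strip of
width `2t`. Up to a difference of `g` they carry the same mass, so each has at most about half of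
the squared norm: a substitute for a fractional Hardy inequality. -/
theorem l2norm_strip_le {Ω : Set E3} (hΩ : IsOpen Ω) (e : E3) {t : ℝ} (ht : 0 < t)
    {g : E3 × E3 → ℝ} (hg : MemLp g 2) :
    l2norm ((strip Ω e t ×ˢ univ).indicator g) ≤
      (Real.sqrt 2)⁻¹ * l2norm ((strip Ω e (2 * t) ×ˢ univ).indicator g) +
        l2norm (diffX (t • e) g) := by
  set S : Set (E3 × E3) := strip Ω e t ×ˢ univ with hS
  set S' : Set (E3 × E3) := (fun z : E3 × E3 => (z.1 + t • e, z.2)) ⁻¹' S with hS'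
  set S₂ : Set (E3 × E3) := strip Ω e (2 * t) ×ˢ univ with hS₂
  have mS : MeasurableSet S := (measurableSet_strip hΩ e t).prod MeasurableSet.univ
  have mS' : MeasurableSet S' := mS.preimage (by fun_prop)
  have mS₂ : MeasurableSet S₂ := (measurableSet_strip hΩ e _).prod MeasurableSet.univ
  have hmem' : ∀ z, z ∈ S' ↔ z.1 + t • e ∈ strip Ω e t := fun z => by simp [S', S]
  have hmem : ∀ z, z ∈ S ↔ z.1 ∈ strip Ω e t := fun z => by simp [S]
  have hmem₂ : ∀ z, z ∈ S₂ ↔ z.1 ∈ strip Ω e (2 * t) := fun z => by simp [S₂]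
  have step : ∀ {x : E3} {r : ℝ}, 0 ≤ r → (∃ s : ℝ, 0 ≤ s ∧ x + r • e + s • e ∈ Ω) →
      ∃ s : ℝ, 0 ≤ s ∧ x + s • e ∈ Ω := by
    rintro x r hr ⟨s, hs, h⟩
    exact ⟨r + s, by positivity, by rwa [add_smul, ← add_assoc]⟩
  have e2 : ∀ x : E3, x + (2 * t) • e = x + t • e + t • e := fun x => by
    rw [two_mul, add_smul, add_assoc]
  have h1 := l2norm_sq_indicator_add_le hg mS mS' mS₂
    (by
      rw [Set.disjoint_left]
      intro z hz hz'
      rw [hmem'] at hz'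
      exact ((hmem z).1 hz).2 hz'.1)
    (by
      intro z hz
      rw [hmem₂]
      obtain ⟨ha, hb⟩ := (hmem z).1 hz
      refine ⟨ha, fun h => hb (step ht.le ?_)⟩
      rwa [e2] at h)
    (by
      intro z hz
      rw [hmem₂]
      rw [hmem', strip_add_smul_iff] at hz
      exact ⟨step ht.le hz.1, hz.2⟩)
  have h2 : l2norm (S.indicator g) ≤ l2norm (S'.indicator g) + l2norm (diffX (t • e) g) := by
    rw [← l2norm_shiftX (hg.indicator mS) (t • e)]
    have e3 : shiftX (t • e) (S.indicator g) =
        S'.indicator g + S'.indicator (diffX (t • e) g) := by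
      rw [← indicator_add']
      ext z
      by_cases hz : z ∈ S'
      · have hz' : (z.1 + t • e, z.2) ∈ S := hz
        simp [shiftX, diffX, hz, hz']
      · have hz' : (z.1 + t • e, z.2) ∉ S := hz
        simp [shiftX, hz, hz']
    rw [e3]
    refine (l2norm_add_le (hg.indicator mS') ((memLp_diffX hg _).indicator mS')).trans ?_
    exact add_le_add_right (l2norm_indicator_le (memLp_diffX hg _) _) _
  set p := l2norm (S.indicator g)
  set q := l2norm (S'.indicator g)
  set r := l2norm (S₂.indicator g)
  set d := l2norm (diffX (t • e) g)
  have hr : 0 ≤ r := l2norm_nonneg _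
  have hq : 0 ≤ q := l2norm_nonneg _
  have hs2 : 0 < Real.sqrt 2 := by positivity
  have hsq : Real.sqrt 2 ^ 2 = 2 := Real.sq_sqrt (by norm_num)
  have hd : 0 ≤ d := l2norm_nonneg _
  -- If `p ≤ d` the claim is trivial. Otherwise `q ≥ p - d ≥ 0`, so `2 (p - d)² ≤ p² + q² ≤ r²`.
  rcases le_total p d with h | h
  · have : 0 ≤ (Real.sqrt 2)⁻¹ * r := by positivity
    linarith
  · have h3 : (Real.sqrt 2 * (p - d)) ^ 2 ≤ r ^ 2 := by
      rw [mul_pow, hsq]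
      nlinarith
    have h4 := (pow_le_pow_iff_left₀ (mul_nonneg hs2.le (by linarith)) hr two_ne_zero).1 h3
    have h5 : p - d ≤ (Real.sqrt 2)⁻¹ * r := by
      rw [inv_mul_eq_div, le_div_iff₀ hs2]; linarith
    linarith

/-- Truncation to a convex open set preserves differences of order less than `1/2`. -/
theorem exists_l2norm_diffX_indicator_le {Ω : Set E3} (hΩ : IsOpen Ω) (hc : Convex ℝ Ω) {σ : ℝ}
    (hσ0 : 0 < σ) (hσ1 : σ < 1 / 2) :
    ∃ C : ℝ, 0 ≤ C ∧ ∀ (g : E3 × E3 → ℝ) (N : ℝ), MemLp g 2 → l2norm g ≤ N →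
      (∀ a : E3, l2norm (diffX a g) ≤ N * ‖a‖ ^ σ) → ∀ a : E3, ‖a‖ ≤ 1 →
        l2norm (diffX a ((Ω ×ˢ univ).indicator g)) ≤ C * N * ‖a‖ ^ σ := by
  set lam : ℝ := (Real.sqrt 2)⁻¹ with hlam
  -- This is where `σ < 1/2` is indispensable to the recursion.
  have hlt : lam * 2 ^ σ < 1 := by
    rw [hlam, inv_mul_eq_div, div_lt_one (by positivity), Real.sqrt_eq_rpow]
    exact Real.rpow_lt_rpow_of_exponent_lt one_lt_two hσ1
  have hpos : 0 < 1 - lam * 2 ^ σ := by linarith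
  set K : ℝ := 1 + 1 / (1 - lam * 2 ^ σ) with hK
  have hK0 : 0 ≤ K := by positivity
  refine ⟨1 + 2 * K, by positivity, fun g N hg hN hd a ha => ?_⟩
  have hN0 : 0 ≤ N := (l2norm_nonneg g).trans hN
  rcases eq_or_ne a 0 with rfl | ha0
  · have : diffX 0 ((Ω ×ˢ univ).indicator g) = 0 := by ext z; simp [diffX, shiftX]
    rw [this]
    simp only [l2norm, eLpNorm_zero, ENNReal.toReal_zero]
    positivity
  have hstrip : ∀ e : E3, ‖e‖ = 1 → ∀ t : ℝ, 0 < t →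
      l2norm ((strip Ω e t ×ˢ univ).indicator g) ≤ K * N * t ^ σ := by
    intro e he t ht0
    have := le_rpow_of_dyadic (m := fun t => l2norm ((strip Ω e t ×ˢ univ).indicator g))
      (lam := lam) (c := N) (s := σ) (N := N) (by positivity) hσ0 hlt hN0 hN0
      (fun t => (l2norm_indicator_le hg _).trans hN)
      (fun t h0 h1 => (l2norm_strip_le hΩ e h0 hg).trans (by
        gcongr
        have := hd (t • e)
        rwa [norm_smul, he, mul_one, Real.norm_of_nonneg h0.le] at this)) ht0
    refine this.trans (le_of_eq ?_)
    rw [hK]; ring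
  set E : E3 → Set (E3 × E3) := fun b => {z | z.1 ∈ Ω ∧ z.1 + b ∉ Ω} with hE
  have mE : ∀ b, MeasurableSet (E b) := fun b =>
    (hΩ.measurableSet.preimage measurable_fst).inter
      ((hΩ.measurableSet.preimage (f := fun z : E3 × E3 => z.1 + b) (by fun_prop)).compl)
  -- A point of `Ω` that leaves `Ω` under the step `b` lies in the strip of width `‖b‖` in the
  -- direction of `b`: were some point further along the ray in `Ω`, convexity would put `x + b` in
  -- `Ω` too.
  have hEle : ∀ b : E3, b ≠ 0 → ‖b‖ ≤ 1 → l2norm ((E b).indicator g) ≤ K * N * ‖b‖ ^ σ := by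
    intro b hb0 hb1
    have hb := norm_pos_iff.2 hb0
    have hbe : b = ‖b‖ • (‖b‖⁻¹ • b) := by rw [smul_smul, mul_inv_cancel₀ hb.ne', one_smul]
    refine (l2norm_indicator_mono hg ?_).trans (hstrip (‖b‖⁻¹ • b) (norm_smul_inv_norm hb0) _ hb)
    rintro ⟨x, v⟩ ⟨h1, h2⟩
    simp only at h1 h2
    refine ⟨⟨⟨0, le_rfl, by simpa using h1⟩, ?_⟩, mem_univ _⟩
    rintro ⟨s, hs, h⟩
    simp only at h
    rw [← hbe] at h
    refine h2 ?_
    have hden : 0 < ‖b‖ + s := by positivity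
    have := hc h1 h (a := s / (‖b‖ + s)) (b := ‖b‖ / (‖b‖ + s)) (by positivity) (by positivity)
      (by field_simp; ring)
    convert this using 1
    have h3 : b + s • (‖b‖⁻¹ • b) = ((‖b‖ + s) / ‖b‖) • b := by
      rw [smul_smul, add_div, div_self hb.ne', add_smul, one_smul, div_eq_mul_inv]
    rw [add_assoc, h3, smul_add, smul_smul, ← add_assoc, ← add_smul]
    congr 1
    · rw [← add_div, add_comm s, div_self hden.ne', one_smul]
    · rw [div_mul_div_cancel₀ hden.ne', div_self hb.ne', one_smul]
  set S : Set (E3 × E3) := {z | z.1 ∈ Ω ∧ z.1 + a ∈ Ω} with hS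
  have mS : MeasurableSet S := (hΩ.measurableSet.preimage measurable_fst).inter
      (hΩ.measurableSet.preimage (f := fun z : E3 × E3 => z.1 + a) (by fun_prop))
  have hid : diffX a ((Ω ×ˢ univ).indicator g) =
      S.indicator (diffX a g) - (E a).indicator g + shiftX a ((E (-a)).indicator g) := by
    ext ⟨x, v⟩
    by_cases h1 : x ∈ Ω <;> by_cases h2 : x + a ∈ Ω <;>
      simp [diffX, shiftX, S, E, indicator, h1, h2]
  have m1 := (memLp_diffX hg a).indicator mS
  have m2 := hg.indicator (mE a)
  have m3 := hg.indicator (mE (-a))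
  have k2 := hEle a ha0 ha
  have k3 := hEle (-a) (neg_ne_zero.2 ha0) (by rwa [norm_neg])
  rw [norm_neg] at k3
  have k1 := (l2norm_indicator_le (memLp_diffX hg a) S).trans (hd a)
  rw [hid]
  calc _ ≤ l2norm (S.indicator (diffX a g)) + l2norm ((E a).indicator g) +
        l2norm ((E (-a)).indicator g) := by
        refine (l2norm_add_le (m1.sub m2) (memLp_shiftX m3 a)).trans ?_
        rw [l2norm_shiftX m3]
        exact add_le_add_left (l2norm_sub_le m1 m2) _
    _ ≤ N * ‖a‖ ^ σ + K * N * ‖a‖ ^ σ + K * N * ‖a‖ ^ σ := by gcongr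
    _ = _ := by ring

/-! ### Regularity of two-fold averages -/

/-- A translation invariant operator on `L²` which gains differences of order `σ`. -/
structure AvgOp (A : (E3 × E3 → ℝ) → E3 × E3 → ℝ) (σ : ℝ) : Prop where
  l2Op : L2Op volume A
  shiftX_comm : ∀ a f, shiftX a (A f) = A (shiftX a f)
  smoothing : ∃ D : ℝ≥0, ∀ h : E3 × E3 → ℝ, MemLp h 2 → ∀ a : E3,
    eLpNorm (diffX a (A h)) 2 volume ≤ D * ENNReal.ofReal (‖a‖ ^ σ) * eLpNorm h 2 volume

/-- By translation invariance one difference passes through the outer `A` to the truncated inner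
average, where it is worth `‖b‖ ^ σ`; smoothing by the outer `A` makes a second difference worth
another `‖b‖ ^ σ`. The identity `2 D_b = D_{2b} - D_b D_b` and the dyadic recursion, valid as `2σ <
1`, convert this into a bound on first differences. -/
theorem AvgOp.exists_l2norm_diffX_le {A : (E3 × E3 → ℝ) → E3 × E3 → ℝ} {σ : ℝ} (hA : AvgOp A σ)
    (hσ0 : 0 < σ) (hσ1 : σ < 1 / 2) {Ω : Set E3} (hΩ : IsOpen Ω) (hc : Convex ℝ Ω) :
    ∃ C : ℝ, 0 ≤ C ∧ ∀ h : E3 × E3 → ℝ, MemLp h 2 → ∀ a : E3, ‖a‖ ≤ 1 →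
      l2norm (diffX a (A ((Ω ×ˢ univ).indicator (A h)))) ≤ C * ‖a‖ ^ (2 * σ) * l2norm h := by
  obtain ⟨D, hD⟩ := hA.smoothing
  obtain ⟨M, hM⟩ := hA.l2Op.bound
  obtain ⟨C, hC0, hC⟩ := exists_l2norm_diffX_indicator_le hΩ hc hσ0 hσ1
  have hD' : ∀ h : E3 × E3 → ℝ, MemLp h 2 → ∀ a : E3,
      l2norm (diffX a (A h)) ≤ D * ‖a‖ ^ σ * l2norm h := by
    intro h hh a
    refine l2norm_le_of_eLpNorm_le hh (by positivity) ?_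
    rw [ENNReal.ofReal_mul D.coe_nonneg, ENNReal.ofReal_coe_nnreal]
    exact hD h hh a
  have hM' : ∀ h : E3 × E3 → ℝ, MemLp h 2 → l2norm (A h) ≤ M * l2norm h := by
    intro h hh
    refine l2norm_le_of_eLpNorm_le hh M.coe_nonneg ?_
    rw [ENNReal.ofReal_coe_nnreal]
    exact (hM h hh).2
  have hlt : (1 / 2 : ℝ) * 2 ^ (2 * σ) < 1 := by
    have : (2 : ℝ) ^ (2 * σ) < 2 ^ (1 : ℝ) :=
      Real.rpow_lt_rpow_of_exponent_lt one_lt_two (by linarith)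
    rw [Real.rpow_one] at this
    linarith
  have hpos : 0 < 1 - (1 / 2 : ℝ) * 2 ^ (2 * σ) := by linarith
  set c₁ : ℝ := 2 * (M * M) with hc₁
  set c₂ : ℝ := D * C * (M + D) with hc₂
  refine ⟨c₁ + c₂ / (1 - 1 / 2 * 2 ^ (2 * σ)), by positivity, fun h hh a ha => ?_⟩
  have mP : MeasurableSet (Ω ×ˢ (univ : Set E3)) := hΩ.measurableSet.prod MeasurableSet.univ
  have hn := l2norm_nonneg h
  have hg := hA.l2Op.memLp hh
  set g := A h with hgdef
  have hPg := hg.indicator mP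
  set w := (Ω ×ˢ univ).indicator g with hw
  have hu := hA.l2Op.memLp hPg
  set u := A w with hudef
  have hNg : l2norm g ≤ (M + D) * l2norm h :=
    (hM' h hh).trans (by gcongr; linarith [D.coe_nonneg])
  have hwd : ∀ b : E3, ‖b‖ ≤ 1 → l2norm (diffX b w) ≤ C * ((M + D) * l2norm h) * ‖b‖ ^ σ :=
    hC g _ hg hNg fun b => (hD' h hh b).trans (by
      calc _ = D * l2norm h * ‖b‖ ^ σ := by ring
        _ ≤ _ := by gcongr; linarith [M.coe_nonneg])
  have hdu : ∀ b, diffX b u =ᵐ[volume] A (diffX b w) := by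
    intro b
    have : diffX b u = A (shiftX b w) - A w := by
      rw [diffX, hudef, hA.shiftX_comm]
    rw [this]
    exact (hA.l2Op.sub (memLp_shiftX hPg b) hPg).symm
  have hdd : ∀ b : E3, ‖b‖ ≤ 1 → l2norm (diffX b (diffX b u)) ≤
      c₂ * l2norm h * ‖b‖ ^ (2 * σ) := by
    intro b hb
    rw [l2norm, eLpNorm_congr_ae (diffX_congr (hdu b) b)]
    refine (hD' _ (memLp_diffX hPg b) b).trans ?_
    calc _ ≤ D * ‖b‖ ^ σ * (C * ((M + D) * l2norm h) * ‖b‖ ^ σ) := by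
          gcongr; exact hwd b hb
      _ = c₂ * l2norm h * (‖b‖ ^ σ * ‖b‖ ^ σ) := by rw [hc₂]; ring
      _ = _ := by
          rw [← Real.rpow_add_of_nonneg (norm_nonneg b) hσ0.le hσ0.le, two_mul]
  have hmax : ∀ b, l2norm (diffX b u) ≤ c₁ * l2norm h := by
    intro b
    refine (l2norm_diffX_le hu b).trans ?_
    have h1 := hM' w hPg
    have h2 := (l2norm_indicator_le hg (Ω ×ˢ univ)).trans (hM' h hh)
    calc 2 * l2norm u ≤ 2 * (M * (M * l2norm h)) := by
          gcongr; exact h1.trans (by gcongr)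
      _ = _ := by rw [hc₁]; ring
  rcases eq_or_ne a 0 with rfl | ha0
  · have : diffX 0 u = 0 := by ext z; simp [diffX, shiftX]
    rw [this]
    simp only [l2norm, eLpNorm_zero, ENNReal.toReal_zero]
    positivity
  have hb := norm_pos_iff.2 ha0
  set e := ‖a‖⁻¹ • a with he
  have hen : ‖e‖ = 1 := norm_smul_inv_norm ha0
  have hae : a = ‖a‖ • e := by rw [he, smul_smul, mul_inv_cancel₀ hb.ne', one_smul]
  have hrec := le_rpow_of_dyadic (m := fun t => l2norm (diffX (t • e) u)) (lam := 1 / 2)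
    (c := c₂ * l2norm h) (s := 2 * σ) (N := c₁ * l2norm h) (by norm_num) (by linarith) hlt
    (by positivity) (by positivity) (fun t => hmax _) (fun t h0 h1 => by
      have hnb : ‖t • e‖ = t := by rw [norm_smul, hen, mul_one, Real.norm_of_nonneg h0.le]
      have k := hdd (t • e) (by rw [hnb]; exact h1)
      rw [hnb] at k
      have e1 : (2 : ℝ) • diffX (t • e) u =
          diffX ((2 * t) • e) u - diffX (t • e) (diffX (t • e) u) := by
        ext ⟨x, v⟩
        have : x + t • e + t • e = x + (2 * t) • e := by rw [two_mul, add_smul, add_assoc]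
        simp only [diffX, shiftX, Pi.sub_apply, Pi.smul_apply, smul_eq_mul, this]
        ring
      have e2 : l2norm ((2 : ℝ) • diffX (t • e) u) = 2 * l2norm (diffX (t • e) u) := by
        simp [l2norm, eLpNorm_const_smul]
      have e3 := l2norm_sub_le (memLp_diffX hu ((2 * t) • e))
        (memLp_diffX (memLp_diffX hu (t • e)) (t • e))
      rw [← e1, e2] at e3
      have e4 : 0 ≤ c₂ * l2norm h * t ^ (2 * σ) := by positivity
      linarith) hb
  simp only [← hae] at hrec
  refine hrec.trans (le_of_eq ?_)
  ring

/-! ### The Slobodeckij semi-norm and differences -/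

/-- In polar coordinates the weight is `r ^ (-1 - 2s)` times `min(r ^ (2κ), 1)`: `κ > s` gives
convergence at `0` and `s > 0` at infinity. -/
theorem integrable_slobodeckij_weight {s κ : ℝ} (hs : 0 < s) (hκ : s < κ) :
    Integrable fun a : E3 => ‖a‖ ^ (-(3 + 2 * s)) * min (‖a‖ ^ (2 * κ)) 1 := by
  rw [integrable_fun_norm_addHaar volume
    (f := fun r : ℝ => r ^ (-(3 + 2 * s)) * min (r ^ (2 * κ)) 1)]
  have hd : Module.finrank ℝ E3 - 1 = 2 := by simp
  rw [hd]
  simp only [smul_eq_mul]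
  have hm : Measurable fun y : ℝ => y ^ 2 * (y ^ (-(3 + 2 * s)) * min (y ^ (2 * κ)) 1) := by
    fun_prop
  have hpow : ∀ y : ℝ, 0 < y → y ^ 2 * y ^ (-(3 + 2 * s)) = y ^ (-1 - 2 * s) := by
    intro y hy
    rw [← Real.rpow_natCast, ← Real.rpow_add hy]
    congr 1
    push_cast
    ring
  rw [← Ioc_union_Ioi_eq_Ioi (zero_le_one (α := ℝ))]
  refine IntegrableOn.union ?_ ?_
  · have h0 : IntegrableOn (fun y : ℝ => y ^ (-1 - 2 * s + 2 * κ)) (Ioc 0 1) := by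
      rw [← intervalIntegrable_iff_integrableOn_Ioc_of_le zero_le_one]
      exact intervalIntegral.intervalIntegrable_rpow' (by linarith)
    refine h0.mono' hm.aestronglyMeasurable ?_
    filter_upwards [ae_restrict_mem measurableSet_Ioc] with y hy
    have hy0 : 0 < y := hy.1
    rw [Real.norm_of_nonneg (by positivity), ← mul_assoc, hpow y hy0, Real.rpow_add hy0]
    gcongr
    exact min_le_left _ _
  · have h0 : IntegrableOn (fun y : ℝ => y ^ (-1 - 2 * s)) (Ioi 1) :=
      integrableOn_Ioi_rpow_of_lt (by linarith) one_pos
    refine h0.mono' hm.aestronglyMeasurable ?_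
    filter_upwards [ae_restrict_mem measurableSet_Ioi] with y hy
    have hy0 : 0 < y := zero_lt_one.trans hy
    rw [Real.norm_of_nonneg (by positivity), ← mul_assoc, hpow y hy0]
    exact mul_le_of_le_one_right (by positivity) (min_le_right _ _)

/-- Enlarge `Ω` to the whole space and substitute `y = x + a`; for fixed `a` the remaining integral
in `(x, v)` is the squared norm of `diffX a u`. -/
theorem slobodeckijSq_le {u : E3 × E3 → ℝ} (hu : Measurable u) (Ω : Set E3) (s : ℝ) :
    slobodeckijSq Ω s u ≤
      ∫⁻ a : E3, ENNReal.ofReal (‖a‖ ^ (-(3 + 2 * s))) * eLpNorm (diffX a u) 2 volume ^ 2 := by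
  set F : E3 → E3 → E3 → ℝ≥0∞ := fun v x a =>
    ENNReal.ofReal (‖a‖ ^ (-(3 + 2 * s))) * ‖u (x + a, v) - u (x, v)‖ₑ ^ 2 with hF
  have hFm : Measurable fun q : E3 × E3 × E3 => F q.1 q.2.1 q.2.2 := by fun_prop
  have e1 : ∀ v x a : E3,
      ENNReal.ofReal (|u (x, v) - u (x + a, v)| ^ 2 / ‖x - (x + a)‖ ^ (3 + 2 * s)) = F v x a := by
    intro v x a
    rw [hF, abs_sub_comm, sub_add_cancel_left, norm_neg, div_eq_mul_inv,
      ← Real.rpow_neg (norm_nonneg a), mul_comm, ENNReal.ofReal_mul (by positivity),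
      ENNReal.ofReal_pow (abs_nonneg _), ← Real.norm_eq_abs, ofReal_norm]
  calc slobodeckijSq Ω s u ≤ ∫⁻ v : E3, ∫⁻ x : E3, ∫⁻ y : E3,
        ENNReal.ofReal (|u (x, v) - u (y, v)| ^ 2 / ‖x - y‖ ^ (3 + 2 * s)) := by
        refine lintegral_mono fun v => (lintegral_mono fun x => ?_).trans
          (setLIntegral_le_lintegral Ω _)
        exact setLIntegral_le_lintegral Ω _
    _ = ∫⁻ v : E3, ∫⁻ x : E3, ∫⁻ a : E3, F v x a := by
        refine lintegral_congr fun v => lintegral_congr fun x => ?_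
        rw [← lintegral_add_left_eq_self _ x]
        exact lintegral_congr fun a => e1 v x a
    _ = ∫⁻ v : E3, ∫⁻ a : E3, ∫⁻ x : E3, F v x a := by
        refine lintegral_congr fun v => lintegral_lintegral_swap ?_
        exact (hFm.comp (f := fun q : E3 × E3 => (v, q.1, q.2)) (by fun_prop)).aemeasurable
    _ = ∫⁻ a : E3, ∫⁻ v : E3, ∫⁻ x : E3, F v x a := by
        refine lintegral_lintegral_swap ?_
        have : Measurable fun q : (E3 × E3) × E3 => F q.1.1 q.2 q.1.2 :=
          hFm.comp (f := fun q : (E3 × E3) × E3 => (q.1.1, q.2, q.1.2)) (by fun_prop)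
        exact this.lintegral_prod_right'.aemeasurable
    _ = _ := by
        refine lintegral_congr fun a => ?_
        rw [eLpNorm_two_sq, Measure.volume_eq_prod,
          lintegral_prod_symm _ ((measurable_diffX hu a).enorm.pow_const 2).aemeasurable,
          ← lintegral_const_mul' _ _ ENNReal.ofReal_ne_top]
        refine lintegral_congr fun v => ?_
        exact lintegral_const_mul' _ _ ENNReal.ofReal_ne_top

theorem slobodeckijSq_congr {Ω : Set E3} {f g : E3 × E3 → ℝ} (h : f =ᵐ[phaseMeasure Ω] g)
    (s : ℝ) : slobodeckijSq Ω s f = slobodeckijSq Ω s g := by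
  have h1 : ∀ᵐ q ∂(volume : Measure E3).prod (volume.restrict Ω), f q.swap = g q.swap :=
    Measure.measurePreserving_swap.quasiMeasurePreserving.ae h
  refine lintegral_congr_ae ?_
  filter_upwards [Measure.ae_ae_of_ae_prod h1] with v hv
  refine lintegral_congr_ae ?_
  filter_upwards [hv] with x hx
  refine lintegral_congr_ae ?_
  filter_upwards [hv] with y hy
  simp only [Prod.swap] at hx hy
  rw [hx, hy]

/-- Functions with differences of order `κ > s` have a finite Slobodeckij semi-norm of order `s`. -/
theorem exists_slobodeckijSq_le {s κ : ℝ} (hs : 0 < s) (hκ : s < κ) (C : ℝ) :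
    ∃ C' : ℝ≥0, ∀ (Ω : Set E3) (u : E3 × E3 → ℝ) (N : ℝ≥0∞), MemLp u 2 → N ≠ ∞ →
      (∀ a, l2norm (diffX a u) ≤ C * N.toReal) →
      (∀ a : E3, ‖a‖ ≤ 1 → l2norm (diffX a u) ≤ C * ‖a‖ ^ κ * N.toReal) →
      slobodeckijSq Ω s u ≤ C' * N ^ 2 := by
  set J := ∫⁻ a : E3, ENNReal.ofReal (‖a‖ ^ (-(3 + 2 * s)) * min (‖a‖ ^ (2 * κ)) 1) with hJ
  have hJtop : J < ∞ := (integrable_slobodeckij_weight hs hκ).lintegral_lt_top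
  refine ⟨J.toNNReal * (C ^ 2).toNNReal, fun Ω u N hu hN h1 h2 => ?_⟩
  obtain ⟨w, hw, e⟩ : ∃ w, Measurable w ∧ u =ᵐ[volume] w :=
    ⟨_, hu.1.aemeasurable.measurable_mk, hu.1.aemeasurable.ae_eq_mk⟩
  have hne : u =ᵐ[phaseMeasure Ω] w := by
    refine Measure.AbsolutelyContinuous.ae_le ?_ e
    exact Measure.restrict_le_self.absolutelyContinuous.prod Measure.AbsolutelyContinuous.rfl
  have hsq : ∀ a, l2norm (diffX a u) ^ 2 ≤ C ^ 2 * min (‖a‖ ^ (2 * κ)) 1 * N.toReal ^ 2 := by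
    intro a
    have hn := l2norm_nonneg (diffX a u)
    rcases le_total ‖a‖ 1 with ha | ha
    · have hmin : min (‖a‖ ^ (2 * κ)) 1 = (‖a‖ ^ κ) ^ 2 := by
        rw [min_eq_left (Real.rpow_le_one (norm_nonneg a) ha (by linarith)), ← Real.rpow_natCast,
          ← Real.rpow_mul (norm_nonneg a), mul_comm κ]
        norm_num
      rw [hmin, ← mul_pow, ← mul_pow]
      exact pow_le_pow_left₀ hn (h2 a ha) 2
    · rw [min_eq_right (Real.one_le_rpow ha (by linarith)), mul_one, ← mul_pow]
      exact pow_le_pow_left₀ hn (h1 a) 2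
  rw [slobodeckijSq_congr hne]
  refine (slobodeckijSq_le hw Ω s).trans ?_
  calc _ ≤ ∫⁻ a : E3, ENNReal.ofReal (‖a‖ ^ (-(3 + 2 * s)) * min (‖a‖ ^ (2 * κ)) 1) *
        (ENNReal.ofReal (C ^ 2) * N ^ 2) := by
        refine lintegral_mono fun a => ?_
        rw [← eLpNorm_congr_ae (diffX_congr e a), ← ofReal_l2norm (memLp_diffX hu a),
          ← ENNReal.ofReal_pow (l2norm_nonneg _), ← ENNReal.ofReal_toReal (ENNReal.pow_ne_top hN),
          ENNReal.toReal_pow, ← ENNReal.ofReal_mul (by positivity),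
          ← ENNReal.ofReal_mul (by positivity), ← ENNReal.ofReal_mul (by positivity)]
        refine ENNReal.ofReal_le_ofReal ?_
        calc _ ≤ ‖a‖ ^ (-(3 + 2 * s)) * (C ^ 2 * min (‖a‖ ^ (2 * κ)) 1 * N.toReal ^ 2) := by
              gcongr; exact hsq a
          _ = _ := by ring
    _ = J * (ENNReal.ofReal (C ^ 2) * N ^ 2) :=
        lintegral_mul_const' _ _ (ENNReal.mul_ne_top ENNReal.ofReal_ne_top (ENNReal.pow_ne_top hN))
    _ = _ := by
        rw [ENNReal.coe_mul, ENNReal.coe_toNNReal hJtop.ne, mul_assoc]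
        rfl

/-- Two-fold averages are bounded from `L²` to `L²_v H^s_x` for `s < 2σ`. -/
theorem AvgOp.exists_slobodeckijSq_le {A : (E3 × E3 → ℝ) → E3 × E3 → ℝ} {σ : ℝ} (hA : AvgOp A σ)
    (hσ0 : 0 < σ) (hσ1 : σ < 1 / 2) {Ω : Set E3} (hΩ : IsOpen Ω) (hc : Convex ℝ Ω) {s : ℝ}
    (hs : 0 < s) (hsσ : s < 2 * σ) :
    ∃ C : ℝ≥0, ∀ h : E3 × E3 → ℝ, MemLp h 2 →
      slobodeckijSq Ω s (A ((Ω ×ˢ univ).indicator (A h))) ≤ C * eLpNorm h 2 volume ^ 2 := by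
  have mP : MeasurableSet (Ω ×ˢ (univ : Set E3)) := hΩ.measurableSet.prod MeasurableSet.univ
  have hop := hA.l2Op.comp ((L2Op.indicator mP).comp hA.l2Op)
  obtain ⟨M, hM⟩ := hop.bound
  obtain ⟨C₁, hC₁0, hC₁⟩ := hA.exists_l2norm_diffX_le hσ0 hσ1 hΩ hc
  obtain ⟨C, hC⟩ := LinBoltzmann.exists_slobodeckijSq_le hs hsσ (max C₁ (2 * M))
  refine ⟨C, fun h hh => hC Ω _ _ (hop.memLp hh) hh.2.ne (fun a => ?_) fun a ha => ?_⟩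
  · refine (l2norm_diffX_le (hop.memLp hh) a).trans ?_
    have h1 : l2norm (A ((Ω ×ˢ univ).indicator (A h))) ≤ M * l2norm h :=
      l2norm_le_of_eLpNorm_le hh M.coe_nonneg (by rw [ENNReal.ofReal_coe_nnreal]; exact (hM h hh).2)
    calc _ ≤ 2 * (M * l2norm h) := by gcongr
      _ = 2 * M * l2norm h := by ring
      _ ≤ _ := mul_le_mul_of_nonneg_right (le_max_right _ _) (l2norm_nonneg h)
  · refine (hC₁ h hh a ha).trans ?_
    have := l2norm_nonneg h
    change _ ≤ max C₁ (2 * M) * ‖a‖ ^ (2 * σ) * l2norm h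
    gcongr
    exact le_max_left _ _

/-! ### The operators on the phase space of a domain -/

theorem phaseMeasure_eq (Ω : Set E3) : phaseMeasure Ω = volume.restrict (Ω ×ˢ univ) := by
  rw [phaseMeasure, Measure.volume_eq_prod, ← Measure.prod_restrict, Measure.restrict_univ]

section Phase

variable {Ω : Set E3}

theorem measurableSet_phase (hΩ : IsOpen Ω) : MeasurableSet (Ω ×ˢ (univ : Set E3)) :=
  hΩ.measurableSet.prod MeasurableSet.univ

theorem memLp_indicator_phase_iff (hΩ : IsOpen Ω) {f : E3 × E3 → ℝ} :
    MemLp ((Ω ×ˢ univ).indicator f) 2 ↔ MemLp f 2 (phaseMeasure Ω) := by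
  rw [phaseMeasure_eq, memLp_indicator_iff_restrict (measurableSet_phase hΩ)]

theorem eLpNorm_indicator_phase (hΩ : IsOpen Ω) (f : E3 × E3 → ℝ) :
    eLpNorm ((Ω ×ˢ univ).indicator f) 2 volume = eLpNorm f 2 (phaseMeasure Ω) := by
  rw [phaseMeasure_eq, eLpNorm_indicator_eq_eLpNorm_restrict (measurableSet_phase hΩ)]

theorem ae_eq_phase_iff (hΩ : IsOpen Ω) {f g : E3 × E3 → ℝ} :
    f =ᵐ[phaseMeasure Ω] g ↔
      (Ω ×ˢ univ).indicator f =ᵐ[volume] (Ω ×ˢ univ).indicator g := by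
  rw [phaseMeasure_eq, ae_eq_restrict_iff_indicator_ae_eq (measurableSet_phase hΩ)]

end Phase

theorem ae_phase_of_ae (Ω : Set E3) {p : E3 × E3 → Prop} (h : ∀ᵐ z, p z) :
    ∀ᵐ z ∂phaseMeasure Ω, p z := by
  rw [phaseMeasure_eq]
  exact ae_restrict_of_ae h

theorem memLp_phase {f : E3 × E3 → ℝ} (hf : MemLp f 2) (Ω : Set E3) :
    MemLp f 2 (phaseMeasure Ω) := by
  rw [phaseMeasure_eq]
  exact hf.restrict _

theorem eLpNorm_phase_le (f : E3 × E3 → ℝ) (Ω : Set E3) :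
    eLpNorm f 2 (phaseMeasure Ω) ≤ eLpNorm f 2 volume := by
  rw [phaseMeasure_eq]
  exact eLpNorm_mono_measure _ Measure.restrict_le_self

theorem opK_indicator {B : ℝ → ℝ → ℝ} {Ω : Set E3} {f : E3 × E3 → ℝ} {x v : E3} (hx : x ∈ Ω) :
    opK B ((Ω ×ˢ univ).indicator f) (x, v) = opK B f (x, v) := by
  have : (fun w => (Ω ×ˢ univ).indicator f (x, w)) = fun w => f (x, w) := by
    ext w; simp [hx]
  simp only [opK, this]

theorem intK_indicator {B : ℝ → ℝ → ℝ} {Ω : Set E3} {f : E3 × E3 → ℝ} {x v : E3} (hx : x ∈ Ω) :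
    intK B ((Ω ×ˢ univ).indicator f) (x, v) = intK B f (x, v) := by
  have : ∀ w, (Ω ×ˢ univ).indicator f (x, w) = f (x, w) := fun w => by simp [hx]
  simp only [intK, velOp, paramOp, Pi.add_apply, Pi.neg_apply, this]

/-- The iterates are known only almost everywhere on `Ω × ℝ³`. As `K` acts for each fixed `x`, their
values outside `Ω` can be set to zero without changing the result on `Ω`, and the whole-space
statements apply. -/
theorem opK_ae_eq_phase {B : ℝ → ℝ → ℝ} {γ : ℝ} {C₀ : ℝ≥0} (hγ0 : 0 ≤ γ) (hγ1 : γ ≤ 1)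
    (hB : Measurable (Function.uncurry B)) (hC : HasCutoff γ B C₀)
    (hν : ∀ v, 0 < collisionFreq B v) {Ω : Set E3} (hΩ : IsOpen Ω) {F F₀ : E3 × E3 → ℝ}
    (h : F =ᵐ[phaseMeasure Ω] F₀) (hF₀ : MemLp F₀ 2) :
    opK B F =ᵐ[phaseMeasure Ω] intK B F₀ := by
  have e := (ae_eq_phase_iff hΩ).1 h
  have m₀ := hF₀.indicator (measurableSet_phase hΩ)
  have m := m₀.ae_eq e.symm
  have h1 := (opK_ae_eq hγ0 hγ1 hB hC hν m).trans ((intK_l2Op hγ0 hγ1 hB hC).congr _ _ m e)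
  rw [phaseMeasure_eq]
  filter_upwards [ae_restrict_of_ae h1, ae_restrict_mem (measurableSet_phase hΩ)] with z hz hzΩ
  obtain ⟨x, v⟩ := z
  rwa [opK_indicator hzΩ.1, intK_indicator hzΩ.1] at hz

theorem opS_ae_eq_phase {B : ℝ → ℝ → ℝ} (hB : Measurable (Function.uncurry B)) {ν₀ : ℝ}
    (hν₀ : 0 < ν₀) (hν : ∀ v, ν₀ ≤ collisionFreq B v) {Ω : Set E3} (hΩ : IsOpen Ω)
    (hc : Convex ℝ Ω) (hb : Bornology.IsBounded Ω) {F F₀ : E3 × E3 → ℝ}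
    (h : F =ᵐ[phaseMeasure Ω] F₀) (hF₀ : MemLp F₀ 2) :
    opS B Ω F =ᵐ[phaseMeasure Ω]
      resolvent (collisionFreq B) ((Ω ×ˢ univ).indicator F₀) := by
  have e := (ae_eq_phase_iff hΩ).1 h
  have m₀ := hF₀.indicator (measurableSet_phase hΩ)
  have m := m₀.ae_eq e.symm
  have h1 := (resolvent_l2Op (measurable_collisionFreq hB) hν₀ hν).congr _ _ m e
  have h2 : ∀ᵐ z : E3 × E3, z.2 ≠ 0 := by
    have h : ∀ᵐ w : E3, w ≠ 0 := by simp [ae_iff]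
    rw [Measure.volume_eq_prod]
    exact Measure.quasiMeasurePreserving_snd.ae h
  rw [phaseMeasure_eq]
  filter_upwards [ae_restrict_of_ae h1, ae_restrict_of_ae h2,
    ae_restrict_mem (measurableSet_phase hΩ)] with z hz hz2 hzΩ
  obtain ⟨x, v⟩ := z
  rw [opS_eq_resolvent hc hb F hzΩ.1 hz2, hz]

/-- An operator on the whole phase space induces an operator on `L²(Ω × ℝ³)`. -/
theorem L2Op.exists_linearMap {V : (E3 × E3 → ℝ) → E3 × E3 → ℝ} (hV : L2Op volume V)
    {Ω : Set E3} (hΩ : IsOpen Ω) :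
    ∃ T : Lp ℝ 2 (phaseMeasure Ω) →ₗ[ℝ] Lp ℝ 2 (phaseMeasure Ω),
      ∀ (f : E3 × E3 → ℝ) (hf : MemLp f 2 (phaseMeasure Ω)),
        T (hf.toLp f) =ᵐ[phaseMeasure Ω] V ((Ω ×ˢ univ).indicator f) := by
  have mem : ∀ {f : E3 × E3 → ℝ}, MemLp f 2 (phaseMeasure Ω) →
      MemLp ((Ω ×ˢ univ).indicator f) 2 := fun hf => (memLp_indicator_phase_iff hΩ).2 hf
  have memV : ∀ φ : Lp ℝ 2 (phaseMeasure Ω),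
      MemLp (V ((Ω ×ˢ univ).indicator φ)) 2 (phaseMeasure Ω) := fun φ =>
    memLp_phase (hV.memLp (mem (Lp.memLp φ))) Ω
  have congrV : ∀ {f g : E3 × E3 → ℝ}, MemLp f 2 (phaseMeasure Ω) → f =ᵐ[phaseMeasure Ω] g →
      V ((Ω ×ˢ univ).indicator f) =ᵐ[phaseMeasure Ω] V ((Ω ×ˢ univ).indicator g) :=
    fun hf h => ae_phase_of_ae Ω (hV.congr _ _ (mem hf) ((ae_eq_phase_iff hΩ).1 h))
  refine ⟨{ toFun := fun φ => (memV φ).toLp _, map_add' := fun φ ψ => ?_,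
            map_smul' := fun c φ => ?_ }, fun f hf => ?_⟩
  · rw [← MemLp.toLp_add, MemLp.toLp_eq_toLp_iff]
    refine (congrV (Lp.memLp _) (Lp.coeFn_add φ ψ)).trans ?_
    rw [indicator_add']
    exact ae_phase_of_ae Ω (hV.add _ _ (mem (Lp.memLp φ)) (mem (Lp.memLp ψ)))
  · rw [RingHom.id_apply, ← MemLp.toLp_const_smul, MemLp.toLp_eq_toLp_iff]
    refine (congrV (Lp.memLp _) (Lp.coeFn_smul c φ)).trans ?_
    rw [show (Ω ×ˢ univ).indicator (c • (φ : E3 × E3 → ℝ)) = c • (Ω ×ˢ univ).indicator φ from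
      indicator_const_smul _ c _]
    exact ae_phase_of_ae Ω (hV.smul c _ (mem (Lp.memLp φ)))
  · exact (memV (hf.toLp f)).coeFn_toLp.trans (congrV (Lp.memLp _) hf.coeFn_toLp)

/-! ### The seven-fold composition -/

theorem avgOp_intK_resolvent {B : ℝ → ℝ → ℝ} {γ : ℝ} {C₀ : ℝ≥0} (hγ0 : 0 ≤ γ) (hγ1 : γ ≤ 1)
    (hB : Measurable (Function.uncurry B)) (hC : HasCutoff γ B C₀) {ν : E3 → ℝ} {ν₀ : ℝ}
    (hν : Measurable ν) (hν₀ : 0 < ν₀) (hle : ∀ v, ν₀ ≤ ν v) {θ : ℝ} (hθ0 : 0 ≤ θ)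
    (hθ1 : θ < 1) : AvgOp (fun h => intK B (resolvent ν h)) (θ / 2) where
  l2Op := (intK_l2Op hγ0 hγ1 hB hC).comp (resolvent_l2Op hν hν₀ hle)
  shiftX_comm a f := by
    ext ⟨x, v⟩
    simp only [shiftX, intK, velOp, resolvent, rayOp, paramOp, Pi.add_apply, Pi.neg_apply,
      add_sub_right_comm]
  smoothing := exists_eLpNorm_diffX_intK_resolvent_le hγ0 hγ1 hB hC hν hν₀ hle hθ0 hθ1

end LinBoltzmann

end

/-! ### The main theorem: assembling the seven-fold composition -/

open LinBoltzmann in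
theorem mainTheorem5
    (Ω : Set LinBoltzmann.E3) (hΩ : LinBoltzmann.IsPosCurvedConvexDomain Ω)
    (γ : ℝ) (hγ0 : 0 ≤ γ) (hγ1 : γ ≤ 1)
    (B : ℝ → ℝ → ℝ) (hBmeas : Measurable (Function.uncurry B))
    (hBcutoff : ∃ C : ℝ, ∀ r θ : ℝ, 0 < r → 0 ≤ θ → θ ≤ Real.pi / 2 →
      0 ≤ B r θ ∧ B r θ ≤ C * r ^ γ * Real.cos θ * Real.sin θ)
    (hν : ∃ ν₀ : ℝ, 0 < ν₀ ∧ ∀ v : LinBoltzmann.E3,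
      ν₀ * (1 + ‖v‖) ^ γ ≤ LinBoltzmann.collisionFreq B v)
    (ε : ℝ) (hε0 : 0 < ε) (hε1 : ε < 1 / 2) :
    ∃ (T : Lp ℝ 2 (LinBoltzmann.phaseMeasure Ω) →ₗ[ℝ] Lp ℝ 2 (LinBoltzmann.phaseMeasure Ω))
      (C : ℝ≥0),
      ∀ (f : LinBoltzmann.E3 × LinBoltzmann.E3 → ℝ)
        (hf : MemLp f 2 (LinBoltzmann.phaseMeasure Ω)),
        let K := LinBoltzmann.opK B
        let S := LinBoltzmann.opS B Ω
        let g := K (S (K (S (K (S (K f))))))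
        T (hf.toLp f) =ᵐ[LinBoltzmann.phaseMeasure Ω] g ∧
          LinBoltzmann.MemL2Hs Ω (1 - ε) g ∧
          LinBoltzmann.l2HsNorm Ω (1 - ε) g ≤ C * eLpNorm f 2 (LinBoltzmann.phaseMeasure Ω) := by
  obtain ⟨C', hC'⟩ := hBcutoff
  obtain ⟨ν₀, hν₀, hν⟩ := hν
  have hC : HasCutoff γ B C'.toNNReal := by
    intro r θ hr hθ0 hθ1
    obtain ⟨h1, h2⟩ := hC' r θ hr hθ0 hθ1
    have hc : 0 ≤ Real.cos θ := Real.cos_nonneg_of_mem_Icc ⟨by linarith, hθ1⟩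
    have hs : 0 ≤ Real.sin θ :=
      Real.sin_nonneg_of_nonneg_of_le_pi hθ0 (by linarith [Real.pi_pos])
    rw [abs_of_nonneg h1]
    calc B r θ ≤ C' * (r ^ γ * Real.cos θ * Real.sin θ) := by
          refine h2.trans (le_of_eq ?_); ring
      _ ≤ _ := by gcongr; exact Real.le_coe_toNNReal C'
  have hle : ∀ v, ν₀ ≤ collisionFreq B v := fun v => by
    refine le_trans ?_ (hν v)
    exact le_mul_of_one_le_right hν₀.le (Real.one_le_rpow (by linarith [norm_nonneg v]) hγ0)
  have hpos : ∀ v, 0 < collisionFreq B v := fun v => hν₀.trans_le (hle v)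
  have hνm := measurable_collisionFreq hBmeas
  set ν := collisionFreq B with hνdef
  have hK := intK_l2Op hγ0 hγ1 hBmeas hC
  have hR := resolvent_l2Op hνm hν₀ hle
  have hP := L2Op.indicator (μ := volume) (measurableSet_phase hΩ.isOpen)
  -- The choice `θ = 1 - ε/2` gives `σ = 1/2 - ε/4`, so that `σ < 1/2` and still `2σ = 1 - ε/2 > 1 -
  -- ε`.
  have hA := avgOp_intK_resolvent hγ0 hγ1 hBmeas hC hνm hν₀ hle (θ := 1 - ε / 2) (by linarith)
    (by linarith)
  -- The inner block `P A P K`, used only through its boundedness on `L²`; the two outer copies of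
  -- `A` give the regularity.
  have hIn := hP.comp (hA.l2Op.comp (hP.comp hK))
  have hV := hA.l2Op.comp (hP.comp (hA.l2Op.comp hIn))
  -- On functions the composition is linear only up to null sets; `T` records its linearity on
  -- classes.
  obtain ⟨T, hT⟩ := hV.exists_linearMap hΩ.isOpen
  obtain ⟨C₁, hC₁⟩ := hV.bound
  obtain ⟨C₂, hC₂⟩ := hIn.bound
  obtain ⟨C₃, hC₃⟩ := hA.exists_slobodeckijSq_le (by linarith) (by linarith) hΩ.isOpen hΩ.convex
    (s := 1 - ε) (by linarith) (by linarith)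
  -- The squared norm is a sum: `C₁²` bounds the `L²` part, and `C₃ C₂²` the Slobodeckij part after
  -- the inner block has cost `C₂`.
  refine ⟨T, NNReal.sqrt (C₁ ^ 2 + C₃ * C₂ ^ 2), fun f hf => ?_⟩
  intro K S g
  set f₀ := (Ω ×ˢ univ).indicator f with hf₀
  have hf₀m : MemLp f₀ 2 := (memLp_indicator_phase_iff hΩ.isOpen).2 hf
  have hnorm : eLpNorm f₀ 2 volume = eLpNorm f 2 (phaseMeasure Ω) :=
    eLpNorm_indicator_phase hΩ.isOpen f
  have stepK : ∀ {F F₀ : E3 × E3 → ℝ}, F =ᵐ[phaseMeasure Ω] F₀ → MemLp F₀ 2 →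
      K F =ᵐ[phaseMeasure Ω] intK B F₀ := fun h h₀ =>
    opK_ae_eq_phase hγ0 hγ1 hBmeas hC hpos hΩ.isOpen h h₀
  have stepS : ∀ {F F₀ : E3 × E3 → ℝ}, F =ᵐ[phaseMeasure Ω] F₀ → MemLp F₀ 2 →
      S F =ᵐ[phaseMeasure Ω] resolvent ν ((Ω ×ˢ univ).indicator F₀) := fun h h₀ =>
    opS_ae_eq_phase hBmeas hν₀ hle hΩ.isOpen hΩ.convex hΩ.bounded h h₀
  have stepKS : ∀ {F F₀ : E3 × E3 → ℝ}, F =ᵐ[phaseMeasure Ω] F₀ → MemLp F₀ 2 →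
      K (S F) =ᵐ[phaseMeasure Ω] intK B (resolvent ν ((Ω ×ˢ univ).indicator F₀)) := fun h h₀ =>
    stepK (stepS h h₀) ((hR.comp hP).memLp h₀)
  have e0 : f =ᵐ[phaseMeasure Ω] f₀ := by
    rw [ae_eq_phase_iff hΩ.isOpen, hf₀, indicator_indicator, inter_self]
  have m1 := hK.memLp hf₀m
  have m2 := (hA.l2Op.comp hP).memLp m1
  have m3 := (hA.l2Op.comp hP).memLp m2
  have hg := stepKS (stepKS (stepKS (stepK e0 hf₀m) m1) m2) m3
  have hgm : MemLp g 2 (phaseMeasure Ω) :=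
    (memLp_phase (hV.memLp hf₀m) Ω).ae_eq hg.symm
  have b1 : eLpNorm g 2 (phaseMeasure Ω) ≤ C₁ * eLpNorm f 2 (phaseMeasure Ω) := by
    rw [eLpNorm_congr_ae hg, ← hnorm]
    exact (eLpNorm_phase_le _ Ω).trans (hC₁ f₀ hf₀m).2
  have b2 : slobodeckijSq Ω (1 - ε) g ≤ C₃ * C₂ ^ 2 * eLpNorm f 2 (phaseMeasure Ω) ^ 2 := by
    rw [slobodeckijSq_congr hg, ← hnorm]
    refine (hC₃ _ (hIn.memLp hf₀m)).trans ?_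
    rw [mul_assoc, ← mul_pow]
    gcongr
    exact (hC₂ f₀ hf₀m).2
  refine ⟨(hT f hf).trans hg.symm, ⟨hgm, b2.trans_lt ?_⟩, ?_⟩
  · exact ENNReal.mul_lt_top (by finiteness) (ENNReal.pow_lt_top hf.2)
  · have b3 : eLpNorm g 2 (phaseMeasure Ω) ^ 2 + slobodeckijSq Ω (1 - ε) g ≤
        ((NNReal.sqrt (C₁ ^ 2 + C₃ * C₂ ^ 2) : ℝ≥0∞) * eLpNorm f 2 (phaseMeasure Ω)) ^ 2 := by
      rw [mul_pow, ← ENNReal.coe_pow, NNReal.sq_sqrt]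
      push_cast
      rw [add_mul, ← mul_pow]
      gcongr
    rw [l2HsNorm]
    refine (ENNReal.rpow_le_rpow b3 (by norm_num)).trans (le_of_eq ?_)
    rw [← ENNReal.rpow_natCast, ← ENNReal.rpow_mul]
    norm_num
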